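/- Throughout, a scheme is a scheme $X$ locally of finite type over $\mathbb{C}$ whose connected components are quasi-compact and in which every finite set of points is contained in an affine open subset; products are over $\mathbb{C}$, and $\mathrm{Sym}^n(X)=X^n/\!\!/S_n$ is the quotient of $X^n$ by the symmetric group (with $\mathrm{Sym}^0(X)=\mathrm{Spec}\,\mathbb{C}$). A motivic theory $R$ consists of abelian groups $R(X)$, homomorphisms $u^*:R(Y)\to R(X)$ for all $u:X\to Y$ and $u_!:R(X)\to R(Y)$ for $u$ of finite type, both functorial, a biadditive, associative, symmetric exterior product $\boxtimes:R(X)\times R(Y)\to R(X\times Y)$ with unit $1\in R(\mathrm{Spec}\,\mathbb{C})$, and maps $\sigma^n:R(X)\to R(\mathrm{Sym}^n(X))$, $n\ge 0$, such that: (i) $R(X)\to\prod_i R(X_i)$ is bijective for the connected components $X_i$ of $X$; (ii) $\tilde u_!\tilde v^*=v^*u_!$ for every cartesian square with $u$ of finite type; (iii) $(u\times v)^*(a\boxtimes b)=u^*a\boxtimes v^*b$, and for finite type morphisms $(u\times v)_!(a\boxtimes b)=u_!a\boxtimes v_!b$ and $\mathrm{Sym}^n(u)_!\,\sigma^n(a)=\sigma^n(u_!a)$;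 (iv) $\sigma^0(a)=1$, $\sigma^1(a)=a$ and $\sigma^n(a+b)=\sum_{l=0}^n\oplus_!\big(\sigma^l(a)\boxtimes\sigma^{n-l}(b)\big)$ with $\oplus:\mathrm{Sym}^l(X)\times\mathrm{Sym}^{n-l}(X)\to\mathrm{Sym}^n(X)$ the concatenation; (v) for a closed subscheme $i:Z\hookrightarrow X$ with open complement $j:U\hookrightarrow X$ one has $i^*i_!=\mathrm{id}$, $j^*j_!=\mathrm{id}$, $j^*i_!=0$, $i^*j_!=0$ and $a=i_!i^*a+j_!j^*a$ for all $a\in R(X)$; (vi) $\sigma^n(\mathbf 1_X)=\mathbf 1_{\mathrm{Sym}^n(X)}$, where $\mathbf 1_X=(X\to\mathrm{Spec}\,\mathbb{C})^*(1)$. Let $R$ be a motivic theory. For $f:V\to X$ of finite type put $[V\xrightarrow{f}X]_R=f_!(\mathbf 1_V)$. Let $R^{gm}(X)\subseteq R(X)$ be the subgroup generated by all such classes if $X$ is connected, and $R^{gm}(X)=\prod_i R^{gm}(X_i)$ in general. Let $R^{gm}_{\mathbb{G}_m}(X\times\mathbb{A}^1)\subseteq R(X\times\mathbb{A}^1)$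 be, for connected $X$, the subgroup generated by the classes $[V\xrightarrow{f}X\times\mathbb{A}^1]_R$ of those $f$ of finite type for which $V$ has a $\mathbb{G}_m$-action such that every point of $V$ has a $\mathbb{G}_m$-invariant affine open neighbourhood and $f(gy)=g^d f(y)$ for some $d>0$, where $g(x,z)=(x,gz)$ on $X\times\mathbb{A}^1$; in general let it be the product over the connected components of $X$. Let $I^{gm}_X=\mathrm{pr}_X^*R^{gm}(X)$. On the groups $R(X\times\mathbb{A}^1)$ use the pull-backs $(u\times\mathrm{id})^*$, the push-forwards $(u\times\mathrm{id})_!$, the exterior product $R(X\times\mathbb{A}^1)\times R(Y\times\mathbb{A}^1)\xrightarrow{\boxtimes}R(X\times Y\times\mathbb{A}^2)\xrightarrow{(\mathrm{id}\times +)_!}R(X\times Y\times\mathbb{A}^1)$ with unit $0_!(1)\in R(\mathbb{A}^1)$, and the operations $R(X\times\mathbb{A}^1)\xrightarrow{\sigma^n}R(\mathrm{Sym}^n(X\times\mathbb{A}^1))\to R(\mathrm{Sym}^n(X)\times\mathbb{A}^1)$, the last map being the push-forward along $\{(x_i,z_i)\}_i\mapsto(\{x_i\}_i,\sum_i z_i)$.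 Then the subgroups $R^{gm}_{\mathbb{G}_m}(X\times\mathbb{A}^1)$ are stable under these pull-backs, push-forwards, exterior products and $\sigma^n$-operations. Moreover, $I^{gm}_X\subseteq R^{gm}_{\mathbb{G}_m}(X\times\mathbb{A}^1)$ is a $\lambda$-ideal: $a\boxtimes b\in I^{gm}_{X\times Y}$ for $a\in I^{gm}_X$, $b\in R^{gm}_{\mathbb{G}_m}(Y\times\mathbb{A}^1)$, and $\sigma^n(a)\in I^{gm}_{\mathrm{Sym}^n(X)}$ for $a\in I^{gm}_X$ and $n\ge 1$. Consequently the quotients $R^{gm}_{mon}(X)=R^{gm}_{\mathbb{G}_m}(X\times\mathbb{A}^1)/I^{gm}_X$, with the induced operations, form a motivic theory. -/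

import Mathlib

open CategoryTheory MonoidalCategory CartesianMonoidalCategory Limits AlgebraicGeometry

universe v

noncomputable section

namespace MotivicTheories

/-- The base `Spec ℂ`. -/
abbrev SpecC : Scheme.{0} := Spec (.of ℂ)

/-- The schemes under consideration: locally of finite type over `ℂ`, with quasi-compact connected
components (so that they are disjoint unions of schemes of finite type), and such that every finite
set of points lies in an affine open subset. The last condition implies that the scheme is separated
and is the usual condition under which the symmetric powers exist as schemes; together
the conditions are stable under fibre products, closed and open subschemes, and symmetric powers. -/
structure IsAdmissible (X : Over SpecC) : Prop where
  locallyOfFiniteType : LocallyOfFiniteType X.hom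
  isCompact_connectedComponent : ∀ x : X.left, IsCompact (connectedComponent x)
  exists_affine : ∀ s : Set X.left, s.Finite → ∃ U : X.left.Opens, IsAffineOpen U ∧ s ⊆ U

/-- `IsAdmissible` as a property of objects. -/
def admissible : ObjectProperty (Over SpecC) := fun X => IsAdmissible X

theorem isOpen_connectedComponent_of_locallyNoetherian (X : Scheme.{0}) [IsLocallyNoetherian X]
    (x : X) : IsOpen (connectedComponent x) := by
  rw [isOpen_iff_mem_nhds]
  intro y hy
  obtain ⟨W, hW, hyW, -⟩ := exists_isAffineOpen_mem_and_subset (X := X) (x := y) (U := ⊤) trivial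
  have : IsNoetherianRing Γ(X, W) := IsLocallyNoetherian.component_noetherian ⟨W, hW⟩
  have : TopologicalSpace.NoetherianSpace W := noetherianSpace_of_isAffineOpen W hW
  let y' : W := ⟨y, hyW⟩
  have hfin : (irreducibleComponents W).Finite :=
    TopologicalSpace.NoetherianSpace.finite_irreducibleComponents
  let F : Set W := ⋃₀ {Z | Z ∈ irreducibleComponents W ∧ y' ∉ Z}
  have hF : IsClosed F := by
    have h : F = ⋃ Z ∈ {Z | Z ∈ irreducibleComponents W ∧ y' ∉ Z}, Z := Set.sUnion_eq_biUnion
    rw [h]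
    exact Set.Finite.isClosed_biUnion (hfin.subset fun Z hZ => hZ.1)
      fun Z hZ => isClosed_of_mem_irreducibleComponents Z hZ.1
  have hyF : y' ∈ Fᶜ := fun ⟨Z, hZ, h⟩ => hZ.2 h
  have hsub : ((↑) : W → X) '' Fᶜ ⊆ connectedComponent x := by
    rintro _ ⟨z, hz, rfl⟩
    have h1 : y' ∈ irreducibleComponent z := by
      by_contra h
      exact hz ⟨_, ⟨irreducibleComponent_mem_irreducibleComponents z, h⟩, mem_irreducibleComponent⟩
    have h2 : _root_.IsPreconnected (((↑) : W → X) '' irreducibleComponent z) :=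
      (isIrreducible_irreducibleComponent.isConnected.isPreconnected).image _
        continuous_subtype_val.continuousOn
    rw [connectedComponent_eq hy] 
    exact h2.subset_connectedComponent (x := y) ⟨y', h1, rfl⟩ ⟨z, mem_irreducibleComponent, rfl⟩
  refine Filter.mem_of_superset ?_ hsub
  exact (W.isOpen.isOpenMap_subtype_val _ hF.isOpen_compl).mem_nhds ⟨y', hyF, rfl⟩


theorem IsAdmissible.isLocallyNoetherian {X : Over SpecC} (hX : IsAdmissible X) :
    IsLocallyNoetherian X.left := by
  have := hX.locallyOfFiniteType
  have : IsNoetherianRing ((CommRingCat.of ℂ : CommRingCat.{0}) : Type) :=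
    inferInstanceAs (IsNoetherianRing ℂ)
  exact LocallyOfFiniteType.isLocallyNoetherian X.hom

theorem IsAdmissible.of_iso {X Y : Over SpecC} (e : X ≅ Y) (hX : IsAdmissible X) :
    IsAdmissible Y := by
  have := hX.locallyOfFiniteType
  have hloc : LocallyOfFiniteType Y.hom := by
    rw [← Over.w e.inv]
    have : IsIso e.inv.left := inferInstanceAs (IsIso ((Over.forget _).map e.inv))
    infer_instance
  let φ : X.left ⟶ Y.left := e.hom.left
  let ψ : Y.left ⟶ X.left := e.inv.left
  have : IsIso ψ := inferInstanceAs (IsIso ((Over.forget _).map e.inv))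
  have hψφ : ψ ≫ φ = 𝟙 _ := by
    change (e.inv ≫ e.hom).left = _
    rw [e.inv_hom_id]; rfl
  have hφ : ∀ y, φ (ψ y) = y := fun y => by
    rw [← Scheme.Hom.comp_apply, hψφ]; rfl
  refine ⟨hloc, fun y => ?_, fun s hs => ?_⟩
  · have h1 := (hX.isCompact_connectedComponent (ψ y)).image φ.continuous
    refine h1.of_isClosed_subset isClosed_connectedComponent fun z hz => ?_
    refine ⟨ψ z, ?_, hφ z⟩
    exact ψ.continuous.image_connectedComponent_subset y ⟨z, hz, rfl⟩
  · obtain ⟨U, hU, hsU⟩ := hX.exists_affine (ψ '' s) (hs.image _)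
    exact ⟨ψ ⁻¹ᵁ U, hU.preimage ψ, fun y hy => hsU ⟨y, hy, rfl⟩⟩

/-- The product of two opens of the factors, as an open subset of the fibre product. -/
theorem exists_opens_prod {X Y : Over SpecC} (U : X.left.Opens) (V : Y.left.Opens) :
    ∃ f : pullback (U.ι ≫ X.hom) (V.ι ≫ Y.hom) ⟶ (X ⊗ Y).left, IsOpenImmersion f ∧
      Set.range f = (pullback.fst X.hom Y.hom) ⁻¹' U ∩ (pullback.snd X.hom Y.hom) ⁻¹' V := by
  refine ⟨pullback.map _ _ _ _ U.ι V.ι (𝟙 _) (by simp) (by simp), inferInstance, ?_⟩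
  rw [Scheme.Pullback.range_map]
  simp

theorem IsAdmissible.tensor {X Y : Over SpecC} (hX : IsAdmissible X) (hY : IsAdmissible Y) :
    IsAdmissible (X ⊗ Y) := by
  have := hX.locallyOfFiniteType
  have := hY.locallyOfFiniteType
  have := hX.isLocallyNoetherian
  have := hY.isLocallyNoetherian
  let p : (X ⊗ Y).left ⟶ X.left := pullback.fst X.hom Y.hom
  let q : (X ⊗ Y).left ⟶ Y.left := pullback.snd X.hom Y.hom
  refine ⟨?_, fun z => ?_, fun s hs => ?_⟩
  · change LocallyOfFiniteType (pullback.fst X.hom Y.hom ≫ X.hom)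
    infer_instance
  · let U : X.left.Opens := ⟨_, isOpen_connectedComponent_of_locallyNoetherian X.left (p z)⟩
    let V : Y.left.Opens := ⟨_, isOpen_connectedComponent_of_locallyNoetherian Y.left (q z)⟩
    have hU : IsCompact (U : Set X.left) := hX.isCompact_connectedComponent (p z)
    have hV : IsCompact (V : Set Y.left) := hY.isCompact_connectedComponent (q z)
    obtain ⟨f, hf, hfr⟩ := exists_opens_prod U V
    have : CompactSpace U := isCompact_iff_compactSpace.mp hU
    have : CompactSpace V := isCompact_iff_compactSpace.mp hV
    have : QuasiCompact (V.ι ≫ Y.hom) := by infer_instance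
    have : CompactSpace ↥(pullback (U.ι ≫ X.hom) (V.ι ≫ Y.hom)) :=
      QuasiCompact.compactSpace_of_compactSpace (pullback.fst (U.ι ≫ X.hom) (V.ι ≫ Y.hom))
    have hc : IsCompact (Set.range f) := isCompact_range f.continuous
    refine hc.of_isClosed_subset isClosed_connectedComponent fun w hw => ?_
    rw [hfr]
    exact ⟨p.continuous.image_connectedComponent_subset z ⟨w, hw, rfl⟩,
      q.continuous.image_connectedComponent_subset z ⟨w, hw, rfl⟩⟩
  · obtain ⟨U, hU, hsU⟩ := hX.exists_affine (p '' s) (hs.image _)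
    obtain ⟨V, hV, hsV⟩ := hY.exists_affine (q '' s) (hs.image _)
    obtain ⟨f, hf, hfr⟩ := exists_opens_prod U V
    have : IsAffine U := hU
    have : IsAffine V := hV
    refine ⟨f.opensRange, isAffineOpen_opensRange f, fun z hz => ?_⟩
    change z ∈ Set.range f
    rw [hfr]
    exact ⟨hsU ⟨z, hz, rfl⟩, hsV ⟨z, hz, rfl⟩⟩

/-- An affine scheme of finite type over `ℂ` is admissible. -/
theorem IsAdmissible.of_isAffine {X : Over SpecC} [IsAffine X.left] [LocallyOfFiniteType X.hom] :
    IsAdmissible X where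
  locallyOfFiniteType := inferInstance
  isCompact_connectedComponent _ := isClosed_connectedComponent.isCompact
  exists_affine _ _ := ⟨⊤, isAffineOpen_top _, fun _ _ => trivial⟩

instance : admissible.IsClosedUnderLimitsOfShape (Discrete PEmpty.{1}) where
  limitsOfShape_le := by
    rintro X ⟨p⟩
    have hX : IsTerminal X :=
      (IsLimit.equivOfNatIsoOfIso p.diag.uniqueFromEmpty _ _
        (by exact Cone.ext (Iso.refl _) (by rintro ⟨⟨⟩⟩))).1 p.isLimit
    have : IsAffine (𝟙_ (Over SpecC)).left := inferInstanceAs (IsAffine SpecC)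
    have : LocallyOfFiniteType (𝟙_ (Over SpecC)).hom :=
      inferInstanceAs (LocallyOfFiniteType (𝟙 SpecC))
    exact IsAdmissible.of_iso (isTerminalTensorUnit.uniqueUpToIso hX) IsAdmissible.of_isAffine

instance : admissible.IsClosedUnderLimitsOfShape (Discrete WalkingPair) where
  limitsOfShape_le := by
    rintro X ⟨p⟩
    have e := (IsLimit.postcomposeHomEquiv (diagramIsoPair p.diag) _).symm p.isLimit
    have e' := e.conePointUniqueUpToIso (tensorProductIsBinaryProduct _ _)
    exact IsAdmissible.of_iso e'.symm
      ((p.prop_diag_obj ⟨.left⟩).tensor (p.prop_diag_obj ⟨.right⟩))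

/-- The category of (admissible) schemes over `ℂ` and all morphisms over `ℂ`.
Its product `⊗` is the product over `ℂ` and its unit `𝟙_` is `Spec ℂ`. -/
abbrev SchC := admissible.FullSubcategory


/-- The underlying scheme. -/
abbrev SchC.scheme (X : SchC) : Scheme.{0} := X.obj.left

/-- The underlying morphism of schemes of a `ℂ`-morphism. -/
abbrev sch {X Y : SchC} (u : X ⟶ Y) : X.scheme ⟶ Y.scheme := u.hom.left

instance (X : SchC) : LocallyOfFiniteType X.obj.hom := X.property.locallyOfFiniteType

instance (X : SchC) : IsLocallyNoetherian X.scheme := X.property.isLocallyNoetherian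

/-- Morphisms of finite type. -/
structure IsFiniteType {X Y : SchC} (u : X ⟶ Y) : Prop where
  locallyOfFiniteType : LocallyOfFiniteType (sch u)
  quasiCompact : QuasiCompact (sch u)

theorem locallyOfFiniteType_sch {X Y : SchC} (u : X ⟶ Y) : LocallyOfFiniteType (sch u) := by
  have h : LocallyOfFiniteType (sch u ≫ Y.obj.hom) := by
    rw [Over.w u.hom]; infer_instance
  exact locallyOfFiniteType_of_comp (sch u) Y.obj.hom

theorem IsFiniteType.id (X : SchC) : IsFiniteType (𝟙 X) :=
  ⟨locallyOfFiniteType_sch _, inferInstanceAs (QuasiCompact (𝟙 X.scheme))⟩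

theorem IsFiniteType.comp {X Y Z : SchC} {u : X ⟶ Y} {v : Y ⟶ Z} (hu : IsFiniteType u)
    (hv : IsFiniteType v) : IsFiniteType (u ≫ v) := by
  have := hu.quasiCompact
  have := hv.quasiCompact
  exact ⟨locallyOfFiniteType_sch _, inferInstanceAs (QuasiCompact (sch u ≫ sch v))⟩

theorem IsFiniteType.of_comp {X Y Z : SchC} (u : X ⟶ Y) (v : Y ⟶ Z) (h : IsFiniteType (u ≫ v)) :
    IsFiniteType u := by
  have h1 : QuasiCompact (sch u ≫ sch v) := h.quasiCompact
  have : QuasiSeparated (sch v) := inferInstance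
  exact ⟨locallyOfFiniteType_sch _, QuasiCompact.of_comp (sch u) (sch v)⟩

theorem IsFiniteType.tensorHom {X Y X' Y' : SchC} {u : X ⟶ X'} {v : Y ⟶ Y'}
    (hu : IsFiniteType u) (hv : IsFiniteType v) : IsFiniteType (u ⊗ₘ v) := by
  have := hu.quasiCompact
  have := hv.quasiCompact
  refine ⟨locallyOfFiniteType_sch _, ?_⟩
  have eu : X.obj.hom = sch u ≫ X'.obj.hom := (Over.w u.hom).symm
  have ev : Y.obj.hom = sch v ≫ Y'.obj.hom := (Over.w v.hom).symm
  have h : sch (u ⊗ₘ v) = pullback.map X.obj.hom Y.obj.hom X'.obj.hom Y'.obj.hom (sch u) (sch v)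
      (𝟙 _) ((Category.comp_id _).trans eu) ((Category.comp_id _).trans ev) := rfl
  rw [h]
  exact MorphismProperty.pullbackMap (P := @QuasiCompact) hu.quasiCompact hv.quasiCompact eu ev

theorem IsFiniteType.whiskerRight {X Y : SchC} {u : X ⟶ Y} (hu : IsFiniteType u) (Z : SchC) :
    IsFiniteType (u ▷ Z) := by
  rw [← MonoidalCategory.tensorHom_id]
  exact hu.tensorHom (.id Z)

/-- The affine line over `ℂ`. -/
def A1 : SchC where
  obj := Over.mk (𝔸(PUnit; SpecC) ↘ SpecC)
  property := by
    have : IsAffine (Over.mk (𝔸(PUnit; SpecC) ↘ SpecC)).left :=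
      inferInstanceAs (IsAffine 𝔸(PUnit; SpecC))
    have : LocallyOfFiniteType (Over.mk (𝔸(PUnit; SpecC) ↘ SpecC)).hom :=
      inferInstanceAs (LocallyOfFiniteType (𝔸(PUnit; SpecC) ↘ SpecC))
    exact IsAdmissible.of_isAffine

/-- The function on `T` corresponding to a morphism `T ⟶ 𝔸¹`. -/
def coord {T : SchC} (z : T ⟶ A1) : Γ(T.scheme, ⊤) :=
  (sch z).appTop (AffineSpace.coord SpecC PUnit.unit)

/-- The morphism `T ⟶ 𝔸¹` corresponding to a function on `T`. -/
def ofSection {T : SchC} (s : Γ(T.scheme, ⊤)) : T ⟶ A1 :=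
  ObjectProperty.homMk (Over.homMk (AffineSpace.homOfVector T.obj.hom fun _ => s)
    (AffineSpace.homOfVector_over _ _))

theorem coord_ofSection {T : SchC} (s : Γ(T.scheme, ⊤)) : coord (ofSection s) = s :=
  AffineSpace.homOfVector_appTop_coord _ _ _

/-- `𝔾_m = 𝔸¹ ∖ {0}`. -/
def Gm : SchC where
  obj := Over.mk ((A1.scheme.basicOpen (AffineSpace.coord SpecC PUnit.unit)).ι ≫ A1.obj.hom)
  property := by
    have : IsAffine A1.scheme := inferInstanceAs (IsAffine 𝔸(PUnit; SpecC))
    have : IsAffine (A1.scheme.basicOpen (AffineSpace.coord SpecC PUnit.unit)).toScheme :=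
      (isAffineOpen_top A1.scheme).basicOpen _
    exact @IsAdmissible.of_isAffine (Over.mk _) this (by dsimp; infer_instance)

/-- The inclusion of `𝔾_m` into `𝔸¹`. -/
def GmToA1 : Gm ⟶ A1 :=
  ObjectProperty.homMk
    (Over.homMk (A1.scheme.basicOpen (AffineSpace.coord SpecC PUnit.unit)).ι rfl)

/-! ### Actions of `𝔾_m` -/

/-- An action of the group `𝔾_m` on `V`: a morphism `𝔾_m × V ⟶ V` that satisfies the axioms of an
action on points with values in every `T`. The unit and the product of `T`-points of `𝔾_m` are
expressed by their coordinates, which are invertible functions on `T`. -/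
structure GmAction (V : SchC) where
  act : Gm ⊗ V ⟶ V
  one_act : ∀ {T : SchC} (e : T ⟶ Gm) (y : T ⟶ V), coord (e ≫ GmToA1) = 1 →
    lift e y ≫ act = y
  mul_act : ∀ {T : SchC} (g h k : T ⟶ Gm) (y : T ⟶ V),
    coord (k ≫ GmToA1) = coord (g ≫ GmToA1) * coord (h ≫ GmToA1) →
      lift k y ≫ act = lift g (lift h y ≫ act) ≫ act

/-- Every point has an affine open neighbourhood that is invariant under the action. -/
def GmAction.IsGood {V : SchC} (ρ : GmAction V) : Prop :=
  ∀ y : V.scheme, ∃ U : V.scheme.Opens, IsAffineOpen U ∧ y ∈ U ∧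
    ∀ p : (Gm ⊗ V).scheme, sch (snd Gm V) p ∈ U → sch ρ.act p ∈ U

/-- `f (g y) = g ^ d f (y)`, where `𝔾_m` acts on `X × 𝔸¹` by `g (x, z) = (x, g z)`. -/
structure GmAction.IsHomogeneous {V X : SchC} (ρ : GmAction V) (f : V ⟶ X ⊗ A1) (d : ℕ) :
    Prop where
  fst_eq : ρ.act ≫ f ≫ fst X A1 = snd Gm V ≫ f ≫ fst X A1
  coord_eq : coord (ρ.act ≫ f ≫ snd X A1) =
    coord (fst Gm V ≫ GmToA1) ^ d * coord (snd Gm V ≫ f ≫ snd X A1)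

/-! ### Symmetric powers -/

/-- The product `Xⁿ` over `ℂ`. -/
abbrev power (X : SchC) (n : ℕ) : SchC := ∏ᶜ fun _ : Fin n => X

/-- The projections of `Xⁿ`. -/
abbrev proj (X : SchC) {n : ℕ} (i : Fin n) : power X n ⟶ X := Pi.π (fun _ : Fin n => X) i

/-- The morphism `uⁿ : Xⁿ ⟶ Yⁿ`. -/
abbrev powerMap {X Y : SchC} (u : X ⟶ Y) (n : ℕ) : power X n ⟶ power Y n :=
  Pi.lift fun i => proj X i ≫ u

/-- The automorphism of `Xⁿ` that permutes the coordinates by `e`. -/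
abbrev permute (X : SchC) {n : ℕ} (e : Equiv.Perm (Fin n)) : power X n ⟶ power X n :=
  Pi.lift fun i => proj X (e i)

/-- The identification `Xᵏ × Xˡ ⟶ Xⁿ` for `k + l = n` (concatenation of tuples). -/
abbrev concat (X : SchC) {k l n : ℕ} (h : k + l = n) : power X k ⊗ power X l ⟶ power X n :=
  Pi.lift fun i => Fin.addCases (motive := fun _ => (power X k ⊗ power X l ⟶ X))
    (fun j => fst _ _ ≫ proj X j) (fun j => snd _ _ ≫ proj X j) (Fin.cast h.symm i)

/-- A symmetric power `Symⁿ(X) = Xⁿ // S_n`: a quotient of `Xⁿ` by the symmetric group `S_n`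
permuting the factors. It is the quotient in the sense of ringed spaces: the points are
the `S_n`-orbits with the quotient topology, and the functions are the invariant functions. Such
a quotient exists for every object of `SchC`, and is unique up to a unique isomorphism. -/
structure SymPower (X : SchC) (n : ℕ) where
  obj : SchC
  π : power X n ⟶ obj
  /-- The quotient map is invariant. -/
  permute_π : ∀ e : Equiv.Perm (Fin n), permute X e ≫ π = π
  /-- The space carries the quotient topology (in particular `π` is surjective). -/
  isQuotientMap : Topology.IsQuotientMap (sch π)
  /-- The fibres are the orbits. -/
  exists_permute : ∀ x y : (power X n).scheme, sch π x = sch π y →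
    ∃ e : Equiv.Perm (Fin n), sch (permute X e) x = y
  /-- The functions on `U` are the invariant functions on the preimage of `U`. -/
  app_injective : ∀ U : obj.scheme.Opens, Function.Injective ((sch π).app U)
  exists_app : ∀ (U : obj.scheme.Opens) (s : Γ((power X n).scheme, sch π ⁻¹ᵁ U)),
    (∀ (e : Equiv.Perm (Fin n)) (h : sch π ⁻¹ᵁ U ≤ sch (permute X e) ⁻¹ᵁ (sch π ⁻¹ᵁ U)),
      (sch (permute X e)).appLE (sch π ⁻¹ᵁ U) (sch π ⁻¹ᵁ U) h s = s) →
    ∃ t : Γ(obj.scheme, U), (sch π).app U t = s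

/-- `j` is the inclusion of a connected component of `X`. -/
structure IsComponent {T X : SchC} (j : T ⟶ X) : Prop where
  isOpenImmersion : IsOpenImmersion (sch j)
  range_eq : ∃ x : X.scheme, Set.range (sch j) = connectedComponent x

/-- Motivic theories. -/
structure MotivicTheory where
  /-- The groups `R(X)`. -/
  obj : SchC → Type v
  [addCommGroup : ∀ X, AddCommGroup (obj X)]
  /-- The pull-backs `u^*`. -/
  pull {X Y : SchC} (u : X ⟶ Y) : obj Y →+ obj X
  /-- The push-forwards `u_!`. -/
  push {X Y : SchC} (u : X ⟶ Y) (hu : IsFiniteType u) : obj X →+ obj Y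
  /-- The exterior product. -/
  box {X Y : SchC} : obj X →+ obj Y →+ obj (X ⊗ Y)
  /-- The unit `1` of the exterior product. -/
  one : obj (𝟙_ SchC)
  /-- The operation `σⁿ : R(X) → R(Symⁿ(X))`. -/
  sigma {X : SchC} {n : ℕ} (S : SymPower X n) : obj X → obj S.obj
  pull_id {X : SchC} (a : obj X) : pull (𝟙 X) a = a
  pull_comp {X Y Z : SchC} (u : X ⟶ Y) (v : Y ⟶ Z) (a : obj Z) :
    pull (u ≫ v) a = pull u (pull v a)
  push_id {X : SchC} (a : obj X) : push (𝟙 X) (.id X) a = a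
  push_comp {X Y Z : SchC} (u : X ⟶ Y) (v : Y ⟶ Z) (hu : IsFiniteType u) (hv : IsFiniteType v)
    (a : obj X) : push (u ≫ v) (hu.comp hv) a = push v hv (push u hu a)
  box_assoc {X Y Z : SchC} (a : obj X) (b : obj Y) (c : obj Z) :
    pull (α_ X Y Z).inv (box (box a b) c) = box a (box b c)
  box_symm {X Y : SchC} (a : obj X) (b : obj Y) :
    pull (lift (snd X Y) (fst X Y)) (box b a) = box a b
  box_one {X : SchC} (a : obj X) : box a one = pull (fst X (𝟙_ SchC)) a
  one_box {X : SchC} (a : obj X) : box one a = pull (snd (𝟙_ SchC) X) a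
  /-- Restriction to the connected components is bijective. -/
  bijective_components {X : SchC} {I : Type} (T : I → SchC) (j : ∀ i, T i ⟶ X)
    (hj : ∀ i, IsComponent (j i)) (hX : ∀ x : X.scheme, ∃! i, x ∈ Set.range (sch (j i))) :
    Function.Bijective fun (a : obj X) (i : I) => pull (j i) a
  /-- Base change for cartesian squares. -/
  base_change {P X Y Z : SchC} (v' : P ⟶ X) (u' : P ⟶ Y) (u : X ⟶ Z) (v : Y ⟶ Z)
    (h : IsPullback (sch v') (sch u') (sch u) (sch v)) (hu : IsFiniteType u)
    (hu' : IsFiniteType u') (a : obj X) : push u' hu' (pull v' a) = pull v (push u hu a)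
  pull_box {X Y X' Y' : SchC} (u : X ⟶ X') (v : Y ⟶ Y') (a : obj X') (b : obj Y') :
    pull (u ⊗ₘ v) (box a b) = box (pull u a) (pull v b)
  push_box {X Y X' Y' : SchC} (u : X ⟶ X') (v : Y ⟶ Y') (hu : IsFiniteType u)
    (hv : IsFiniteType v) (a : obj X) (b : obj Y) :
    push (u ⊗ₘ v) (hu.tensorHom hv) (box a b) = box (push u hu a) (push v hv b)
  /-- `Symⁿ(u)_! ∘ σⁿ = σⁿ ∘ u_!`; here `m` is the morphism `Symⁿ(u)` induced by `uⁿ`. -/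
  push_sigma {X Y : SchC} {n : ℕ} (u : X ⟶ Y) (hu : IsFiniteType u) (S : SymPower X n)
    (S' : SymPower Y n) (m : S.obj ⟶ S'.obj) (hm : IsFiniteType m)
    (h : S.π ≫ m = powerMap u n ≫ S'.π) (a : obj X) :
    push m hm (sigma S a) = sigma S' (push u hu a)
  /-- `σⁿ(a + b) = ∑ₗ σˡ(a) σⁿ⁻ˡ(b)` for the convolution product; here `m k l n _` is the morphism
  `⊕ : Symᵏ(X) × Symˡ(X) ⟶ Symⁿ(X)` induced by the concatenation of tuples. -/
  sigma_add {X : SchC} (S : ∀ k, SymPower X k)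
    (m : ∀ k l n, k + l = n → ((S k).obj ⊗ (S l).obj ⟶ (S n).obj))
    (hm : ∀ k l n h, IsFiniteType (m k l n h))
    (hS : ∀ k l n h, ((S k).π ⊗ₘ (S l).π) ≫ m k l n h = concat X h ≫ (S n).π)
    (n : ℕ) (a b : obj X) :
    sigma (S n) (a + b) = ∑ l : Fin (n + 1),
      push (m l (n - l) n (Nat.add_sub_of_le l.is_le)) (hm _ _ _ _)
        (box (sigma (S l) a) (sigma (S (n - l)) b))
  /-- `σ¹(a) = a` under the identification of `Sym¹(X)` with `X`. -/
  sigma_one {X : SchC} (S : SymPower X 1) (a : obj X) :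
    pull S.π (sigma S a) = pull (proj X 0) a
  /-- `σ⁰(a) = 1` under the identification of `Sym⁰(X)` with `Spec ℂ`. -/
  sigma_zero {X : SchC} (S : SymPower X 0) (a : obj X) : sigma S a = pull (toUnit S.obj) one
  /-- The motivic property for a closed subscheme `Z` and its open complement `U`. -/
  closed_open {X Z U : SchC} (i : Z ⟶ X) (j : U ⟶ X) (hi : IsClosedImmersion (sch i))
    (hj : IsOpenImmersion (sch j)) (hij : Set.range (sch j) = (Set.range (sch i))ᶜ)
    (hi' : IsFiniteType i) (hj' : IsFiniteType j) :
    (∀ a, pull i (push i hi' a) = a) ∧ (∀ a, pull j (push j hj' a) = a) ∧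
    (∀ a, pull j (push i hi' a) = 0) ∧ (∀ a, pull i (push j hj' a) = 0) ∧
    ∀ a, a = push i hi' (pull i a) + push j hj' (pull j a)
  /-- `σⁿ(𝟙_X) = 𝟙_{Symⁿ(X)}`. -/
  sigma_unit {X : SchC} {n : ℕ} (S : SymPower X n) :
    sigma S (pull (toUnit X) one) = pull (toUnit S.obj) one

attribute [instance] MotivicTheory.addCommGroup


theorem isFiniteType_fst_A1 (X : SchC) : IsFiniteType (fst X A1) := by
  refine ⟨locallyOfFiniteType_sch _, ?_⟩
  have : IsAffine A1.obj.left := inferInstanceAs (IsAffine 𝔸(PUnit; SpecC))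
  have : QuasiCompact A1.obj.hom := inferInstance
  exact inferInstanceAs (QuasiCompact (pullback.fst X.obj.hom A1.obj.hom))

/-- The zero section `id × 0 : X ⟶ X × 𝔸¹`. -/
def zeroSection (X : SchC) : X ⟶ X ⊗ A1 := lift (𝟙 X) (ofSection 0)

theorem isFiniteType_zeroSection (X : SchC) : IsFiniteType (zeroSection X) := by
  refine .of_comp _ (fst X A1) ?_
  rw [zeroSection, lift_fst]
  exact .id X

/-- `((x, z), (y, w)) ↦ ((x, y), z + w)`. -/
def fiberAdd (X Y : SchC) : (X ⊗ A1) ⊗ (Y ⊗ A1) ⟶ (X ⊗ Y) ⊗ A1 :=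
  lift (fst X A1 ⊗ₘ fst Y A1)
    (ofSection (coord (fst (X ⊗ A1) (Y ⊗ A1) ≫ snd X A1) +
      coord (snd (X ⊗ A1) (Y ⊗ A1) ≫ snd Y A1)))

theorem isFiniteType_fiberAdd (X Y : SchC) : IsFiniteType (fiberAdd X Y) := by
  refine .of_comp _ (fst (X ⊗ Y) A1) ?_
  rw [fiberAdd, lift_fst]
  exact (isFiniteType_fst_A1 X).tensorHom (isFiniteType_fst_A1 Y)

/-- `m` is the morphism `Symⁿ(X × 𝔸¹) ⟶ Symⁿ(X) × 𝔸¹`, `{(xᵢ, zᵢ)} ↦ ({xᵢ}, z₁ + ⋯ + zₙ)`,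
that is, the composition of the natural morphism to `Symⁿ(X) × Symⁿ(𝔸¹)` with the addition
`Symⁿ(𝔸¹) ⟶ 𝔸¹`. -/
def IsFiberSum {X : SchC} {n : ℕ} (S : SymPower X n) (S' : SymPower (X ⊗ A1) n)
    (m : S'.obj ⟶ S.obj ⊗ A1) : Prop :=
  S'.π ≫ m = lift (powerMap (fst X A1) n ≫ S.π)
    (ofSection (∑ i : Fin n, coord (proj (X ⊗ A1) i ≫ snd X A1)))

namespace MotivicTheory

variable (R : MotivicTheory.{v})

/-- The class `[V ⟶ X]_R = f_! (V ⟶ Spec ℂ)^* 1`. -/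
def cls {V X : SchC} (f : V ⟶ X) (hf : IsFiniteType f) : R.obj X :=
  R.push f hf (R.pull (toUnit V) R.one)

/-- `R^{gm}(X)`: the elements whose restriction to every connected component `T` of `X` lies in the
subgroup generated by the classes `[V ⟶ T]_R`. -/
def geometric (X : SchC) : AddSubgroup (R.obj X) where
  carrier := {a | ∀ (T : SchC) (j : T ⟶ X), IsComponent j → R.pull j a ∈
    AddSubgroup.closure {b | ∃ (V : SchC) (f : V ⟶ T) (hf : IsFiniteType f), b = R.cls f hf}}
  zero_mem' T j hj := by
    rw [map_zero]; exact zero_mem _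
  add_mem' ha hb T j hj := by
    rw [map_add]; exact add_mem (ha T j hj) (hb T j hj)
  neg_mem' ha T j hj := by
    rw [map_neg]; exact neg_mem (ha T j hj)

/-- `R^{gm}_{𝔾_m}(X × 𝔸¹)`: the elements of `R(X × 𝔸¹)` whose restriction to `T × 𝔸¹`, for every
connected component `T` of `X`, lies in the subgroup generated by the classes `[V ⟶ T × 𝔸¹]_R` of
morphisms that are homogeneous of some degree `d > 0` for a good `𝔾_m`-action on `V`. -/
def homogeneous (X : SchC) : AddSubgroup (R.obj (X ⊗ A1)) where
  carrier := {a | ∀ (T : SchC) (j : T ⟶ X), IsComponent j → R.pull (j ▷ A1) a ∈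
    AddSubgroup.closure {b | ∃ (V : SchC) (f : V ⟶ T ⊗ A1) (hf : IsFiniteType f)
      (ρ : GmAction V) (d : ℕ), ρ.IsGood ∧ 0 < d ∧ ρ.IsHomogeneous f d ∧ b = R.cls f hf}}
  zero_mem' T j hj := by
    rw [map_zero]; exact zero_mem _
  add_mem' ha hb T j hj := by
    rw [map_add]; exact add_mem (ha T j hj) (hb T j hj)
  neg_mem' ha T j hj := by
    rw [map_neg]; exact neg_mem (ha T j hj)

/-- `I^{gm}_X = pr_X^* R^{gm}(X)`. -/
def monodromyIdeal (X : SchC) : AddSubgroup (R.obj (X ⊗ A1)) :=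
  (R.geometric X).map (R.pull (fst X A1))

/-! The operations of the theory `X ↦ R(X × 𝔸¹)`. -/

/-- The pull-back `(u × id)^*`. -/
def linePull {X Y : SchC} (u : X ⟶ Y) : R.obj (Y ⊗ A1) →+ R.obj (X ⊗ A1) := R.pull (u ▷ A1)

/-- The push-forward `(u × id)_!`. -/
def linePush {X Y : SchC} (u : X ⟶ Y) (hu : IsFiniteType u) :
    R.obj (X ⊗ A1) →+ R.obj (Y ⊗ A1) := R.push (u ▷ A1) (hu.whiskerRight A1)

/-- The exterior product, which convolves along `𝔸¹`. -/
def lineBox {X Y : SchC} (a : R.obj (X ⊗ A1)) (b : R.obj (Y ⊗ A1)) : R.obj ((X ⊗ Y) ⊗ A1) :=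
  R.push (fiberAdd X Y) (isFiniteType_fiberAdd X Y) (R.box a b)

/-- The unit `0_!(1)`. -/
def lineOne : R.obj (𝟙_ SchC ⊗ A1) :=
  R.push (zeroSection (𝟙_ SchC)) (isFiniteType_zeroSection _) R.one

/-- The `σⁿ`-operation `R(X × 𝔸¹) → R(Symⁿ(X × 𝔸¹)) → R(Symⁿ(X) × 𝔸¹)`, where `m` is the
morphism `Symⁿ(X × 𝔸¹) ⟶ Symⁿ(X) × 𝔸¹` of `IsFiberSum`. -/
def lineSigma {X : SchC} {n : ℕ} (S : SymPower X n) (S' : SymPower (X ⊗ A1) n)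
    (m : S'.obj ⟶ S.obj ⊗ A1) (hm : IsFiniteType m) (a : R.obj (X ⊗ A1)) :
    R.obj (S.obj ⊗ A1) :=
  R.push m hm (R.sigma S' a)

end MotivicTheory

end MotivicTheories

end

open MotivicTheories

/-!
The operations on the groups `R(X × 𝔸¹)` that add the coordinates in `𝔸¹` form a motivic theory
`MotivicTheory.lineTheory`. The theorem says that the homogeneous classes form a subtheory of it and
that the classes pulled back from `X` form a `λ`-ideal in this subtheory. The quotient of a motivic
theory by a `λ`-ideal is again one (`MotivicTheory.IsLambdaIdeal.quotient`): if `c` lies in the ideal,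
all terms of `σⁿ(a + c)` but `σⁿ(a)` do.

*Symmetric powers.* The quotient of an admissible scheme by a finite group is glued from spectra of
rings of invariants of invariant affine open subsets (`FiniteAction.exists_isQuotient`). Over `ℂ`,
averaging shows that such quotients commute with base change (`IsFiniteQuotient.baseChange`). Hence
products of symmetric powers are quotients as well, which provides the morphisms `SymPower.map`,
`SymPower.add` and `fiberSum`, and the `𝔾_m`-actions on symmetric powers. Moreover, `Symⁿ(U)` is
open in `Symⁿ(X)` for `U` open in `X`, and `σⁿ` commutes with restriction to it
(`MotivicTheory.pull_sigma_of_isOpenImmersion`).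

*Reduction to generators.* By the localisation axiom, membership in a family of subgroups that is
stable under push-forwards is a local question (`MotivicTheory.mem_of_list_cover`). Therefore each of
the three families of subgroups (geometric classes, homogeneous classes and the ideal) consists
of the elements whose pull-backs to affine schemes `W` are combinations of generators over `W`, and
the sources of these generators may be taken to be affine (`MotivicTheory.localSpan` and the lemmas
`geometric_eq_localSpan`, `homogeneous_eq_localSpan`, `monodromyIdeal_eq_localSpan`). For homogeneous
classes, this uses inclusion-exclusion over the invariant affine open subsets of the source
(`MotivicTheory.mem_closure_restrictExtend`). If the generators are stable under the operations
(`MotivicTheory.IsStableFamily`), so are these subgroups. For `σⁿ`, the formula for `σⁿ(a + b)`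
deals with sums and, by induction on `n`, with negatives; general elements are reduced to the affine
case by the open subsets `Symⁿ(U)` for `U` affine, which cover `Symⁿ(X)` because finite sets of points
have affine neighbourhoods.

*Stability of the generators.* For homogeneous classes, `𝔾_m` acts on fibre products, on products by
`g (v, w) = (gᵉ v, gᵈ w)`, where `d` and `e` are the degrees of the factors, and diagonally on
symmetric powers (`GmAction.exists_pullback`, `GmAction.exists_tensor`, `GmAction.exists_sym`). For
the ideal, the product of a pull-back of `a` with `b` is the pull-back of the exterior product of `a`
with the push-forward of `b` along `Y × 𝔸¹ ⟶ Y` (`MotivicTheory.lineBox_pull_fst`), which is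
geometric. Finally, translations by `t / n` in all coordinates identify `Symⁿ(V × 𝔸¹)` with
`K × 𝔸¹`, where `K` parametrises tuples with coordinate sum zero (`exists_fiberSum_eq`). Thus `σⁿ` of
a class pulled back from `X` is pulled back from `Symⁿ(X)`; this is where `n ≥ 1` is needed.
-/

noncomputable section

namespace MotivicTheories

/-! ### Admissible schemes -/

/-- Admissible schemes are separated: by the valuative criterion, two extensions of a morphism to
the spectrum of a valuation ring have to be compared. The two images of the closed point lie in
a common affine open subset, which contains the images of both extensions. -/
theorem IsAdmissible.isSeparated {X : Over SpecC} (hX : IsAdmissible X) : IsSeparated X.hom := by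
  have := hX.locallyOfFiniteType
  have := hX.isLocallyNoetherian
  refine IsSeparated.of_valuativeCriterion _ fun S => ⟨?_⟩
  rintro ⟨l₁, h₁, h₁'⟩ ⟨l₂, h₂, h₂'⟩
  ext : 1
  change l₁ = l₂
  let c : Spec (.of S.R) := IsLocalRing.closedPoint S.R
  obtain ⟨U, hU, hs⟩ := hX.exists_affine {l₁ c, l₂ c} (Set.toFinite _)
  -- every point specialises to the closed point, so the image lies in `U` if that of `c` does
  have hr : ∀ l : Spec (.of S.R) ⟶ X.left, l c ∈ U → Set.range l ⊆ Set.range U.ι := by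
    rintro l hl _ ⟨p, rfl⟩
    rw [Scheme.Opens.range_ι]
    have h := (IsLocalRing.specializes_closedPoint (R := S.R) p).map l.continuous
    exact h.mem_open U.isOpen hl
  have r₁ := hr l₁ (hs (by simp))
  have r₂ := hr l₂ (hs (by simp))
  have : IsAffine U := hU
  let f : U.toScheme ⟶ SpecC := U.ι ≫ X.hom
  have e₁ := IsOpenImmersion.lift_fac U.ι l₁ r₁
  have e₂ := IsOpenImmersion.lift_fac U.ι l₂ r₂
  let i := Spec.map (CommRingCat.ofHom (algebraMap S.R S.K))
  have hi : i ≫ IsOpenImmersion.lift U.ι l₁ r₁ = i ≫ IsOpenImmersion.lift U.ι l₂ r₂ := by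
    rw [← cancel_mono U.ι, Category.assoc, Category.assoc, e₁, e₂]
    exact h₁.trans h₂.symm
  let S' : ValuativeCommSq f :=
    { R := S.R
      K := S.K
      i₁ := i ≫ IsOpenImmersion.lift U.ι l₁ r₁
      i₂ := S.i₂
      commSq := ⟨by
        simp only [f, Category.assoc]
        rw [← Category.assoc (IsOpenImmersion.lift U.ι l₁ r₁), e₁]
        simp only [i]
        rw [h₁']⟩ }
  have := IsSeparated.valuativeCriterion f S'
  have h := this.elim ⟨IsOpenImmersion.lift U.ι l₁ r₁, rfl, by
      simp only [f]; rw [← Category.assoc, e₁]; exact h₁'⟩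
    ⟨IsOpenImmersion.lift U.ι l₂ r₂, hi.symm, by
      simp only [f]; rw [← Category.assoc, e₂]; exact h₂'⟩
  have h' : IsOpenImmersion.lift U.ι l₁ r₁ = IsOpenImmersion.lift U.ι l₂ r₂ :=
    congr_arg CommSq.LiftStruct.l h
  rw [← e₁, ← e₂, h']

instance (X : SchC) : IsSeparated X.obj.hom := X.property.isSeparated

instance (X : SchC) : X.scheme.IsSeparated := by
  have h : IsSeparated (X.obj.hom ≫ terminal.from _) := inferInstance
  rw [Subsingleton.elim (X.obj.hom ≫ terminal.from _) (terminal.from X.scheme)] at h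
  exact ⟨h⟩

instance {X Y : SchC} (u : X ⟶ Y) : LocallyOfFiniteType (sch u) := locallyOfFiniteType_sch u

/-- Admissibility passes to schemes that are affine over an admissible scheme: the preimage of an
affine open subset that contains the image of a finite set is affine. -/
theorem IsAdmissible.of_isAffineHom {X Z : Over SpecC} (hX : IsAdmissible X) (f : Z.left ⟶ X.left)
    [IsAffineHom f] [LocallyOfFiniteType Z.hom] : IsAdmissible Z where
  locallyOfFiniteType := inferInstance
  isCompact_connectedComponent z := by
    have := hX.isLocallyNoetherian
    let U : X.left.Opens := ⟨_, isOpen_connectedComponent_of_locallyNoetherian X.left (f z)⟩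
    have hU : IsCompact (U : Set X.left) := hX.isCompact_connectedComponent (f z)
    have hc : IsCompact ((f ⁻¹ᵁ U : Z.left.Opens) : Set Z.left) :=
      QuasiCompact.isCompact_preimage (f := f) _ U.isOpen hU
    refine hc.of_isClosed_subset isClosed_connectedComponent fun w hw => ?_
    exact f.continuous.image_connectedComponent_subset z ⟨w, hw, rfl⟩
  exists_affine s hs := by
    obtain ⟨U, hU, hsU⟩ := hX.exists_affine (f '' s) (hs.image _)
    exact ⟨f ⁻¹ᵁ U, hU.preimage f, fun y hy => hsU ⟨y, hy, rfl⟩⟩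

/-- The source of an affine morphism locally of finite type, as an object over `ℂ`. -/
def SchC.ofAffineHom (X : SchC) {Z : Scheme.{0}} (f : Z ⟶ X.scheme) [IsAffineHom f]
    [LocallyOfFiniteType f] : SchC where
  obj := Over.mk (f ≫ X.obj.hom)
  property :=
    have : LocallyOfFiniteType (Over.mk (f ≫ X.obj.hom)).hom :=
      inferInstanceAs (LocallyOfFiniteType (f ≫ X.obj.hom))
    X.property.of_isAffineHom (Z := Over.mk (f ≫ X.obj.hom)) f

/-- The structure morphism of `SchC.ofAffineHom`. -/
def SchC.ofAffineHomMap (X : SchC) {Z : Scheme.{0}} (f : Z ⟶ X.scheme) [IsAffineHom f]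
    [LocallyOfFiniteType f] : X.ofAffineHom f ⟶ X :=
  ObjectProperty.homMk (Over.homMk f rfl)

/-- The morphism of `SchC` given by a morphism of schemes that is compatible with the structure
morphisms to `Spec ℂ`. -/
def SchC.homMk {X Y : SchC} (f : X.scheme ⟶ Y.scheme) (h : f ≫ Y.obj.hom = X.obj.hom) : X ⟶ Y :=
  ObjectProperty.homMk (Over.homMk f h)

@[simp] theorem sch_homMk {X Y : SchC} (f : X.scheme ⟶ Y.scheme)
    (h : f ≫ Y.obj.hom = X.obj.hom) : sch (SchC.homMk f h) = f := rfl

theorem sch_injective {X Y : SchC} {u v : X ⟶ Y} (h : sch u = sch v) : u = v := by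
  apply ObjectProperty.hom_ext
  exact Over.OverMorphism.ext h

@[simp] theorem sch_comp {X Y Z : SchC} (u : X ⟶ Y) (v : Y ⟶ Z) : sch (u ≫ v) = sch u ≫ sch v := rfl

@[simp] theorem sch_id (X : SchC) : sch (𝟙 X) = 𝟙 X.scheme := rfl

instance isIso_sch {X Y : SchC} (u : X ⟶ Y) [IsIso u] : IsIso (sch u) :=
  ⟨sch (inv u), by rw [← sch_comp, IsIso.hom_inv_id]; rfl,
    by rw [← sch_comp, IsIso.inv_hom_id]; rfl⟩

theorem sch_w {X Y : SchC} (u : X ⟶ Y) : sch u ≫ Y.obj.hom = X.obj.hom := Over.w u.hom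

/-- Fibre products of admissible schemes. -/
def fiberProd {X Y Z : SchC} (f : X ⟶ Z) (g : Y ⟶ Z) : SchC where
  obj := Over.mk (pullback.fst (sch f) (sch g) ≫ X.obj.hom)
  property := by
    have h : LocallyOfFiniteType (pullback.fst (sch f) (sch g) ≫ X.obj.hom) := inferInstance
    have h' : LocallyOfFiniteType (Over.mk (pullback.fst (sch f) (sch g) ≫ X.obj.hom)).hom := h
    -- the fibre product is closed in the product, as `Z` is separated
    let k : pullback (sch f) (sch g) ⟶ (X ⊗ Y).obj.left :=
      pullback.mapDesc (sch f) (sch g) Z.obj.hom ≫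
        (pullback.congrHom (sch_w f) (sch_w g)).hom
    have : IsAffineHom k := inferInstance
    exact (X ⊗ Y).property.of_isAffineHom
      (Z := Over.mk (pullback.fst (sch f) (sch g) ≫ X.obj.hom)) k

/-- The first projection of a fibre product. -/
def fiberFst {X Y Z : SchC} (f : X ⟶ Z) (g : Y ⟶ Z) : fiberProd f g ⟶ X :=
  SchC.homMk (pullback.fst (sch f) (sch g)) rfl

/-- The second projection of a fibre product. -/
def fiberSnd {X Y Z : SchC} (f : X ⟶ Z) (g : Y ⟶ Z) : fiberProd f g ⟶ Y :=
  SchC.homMk (pullback.snd (sch f) (sch g)) (by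
    change _ = pullback.fst (sch f) (sch g) ≫ X.obj.hom
    rw [← sch_w f, ← sch_w g, pullback.condition_assoc]
    rfl)

theorem isPullback_of_sch {P X Y Z : SchC} {p : P ⟶ X} {q : P ⟶ Y} {f : X ⟶ Z} {g : Y ⟶ Z}
    (h : IsPullback (sch p) (sch q) (sch f) (sch g)) : IsPullback p q f g := by
  refine ⟨⟨sch_injective h.w⟩, ⟨PullbackCone.IsLimit.mk _
    (fun s => SchC.homMk (h.lift (sch s.fst) (sch s.snd) ?_) ?_) ?_ ?_ ?_⟩⟩
  · rw [← sch_comp, s.condition, sch_comp]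
  · rw [← sch_w p, h.lift_fst_assoc, sch_w]
  · intro s; apply sch_injective; simp
  · intro s; apply sch_injective; simp
  · intro s m h1 h2
    apply sch_injective
    apply h.hom_ext
    · rw [← sch_comp, h1]; simp
    · rw [← sch_comp, h2]; simp

theorem isPullback_fiberProd {X Y Z : SchC} (f : X ⟶ Z) (g : Y ⟶ Z) :
    IsPullback (fiberFst f g) (fiberSnd f g) f g :=
  isPullback_of_sch (IsPullback.of_hasPullback (sch f) (sch g))

theorem _root_.CategoryTheory.IsPullback.sch {P X Y Z : SchC} {p : P ⟶ X} {q : P ⟶ Y} {f : X ⟶ Z}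
    {g : Y ⟶ Z} (h : IsPullback p q f g) : IsPullback (sch p) (sch q) (sch f) (sch g) := by
  let e := h.isoIsPullback _ _ (isPullback_fiberProd f g)
  have h1 : e.hom ≫ fiberFst f g = p := h.isoIsPullback_hom_fst ..
  have h2 : e.hom ≫ fiberSnd f g = q := h.isoIsPullback_hom_snd ..
  let ε : (fiberProd f g).scheme ≅ P.scheme := asIso (MotivicTheories.sch e.inv)
  refine (IsPullback.of_hasPullback (MotivicTheories.sch f) (MotivicTheories.sch g)).of_iso
    ε (Iso.refl _) (Iso.refl _) (Iso.refl _) ?_ ?_ ?_ ?_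
  · rw [← h1]
    change _ ≫ 𝟙 _ = MotivicTheories.sch e.inv ≫ MotivicTheories.sch (e.hom ≫ fiberFst f g)
    rw [← sch_comp, e.inv_hom_id_assoc]
    exact Category.comp_id _
  · rw [← h2]
    change _ ≫ 𝟙 _ = MotivicTheories.sch e.inv ≫ MotivicTheories.sch (e.hom ≫ fiberSnd f g)
    rw [← sch_comp, e.inv_hom_id_assoc]
    exact Category.comp_id _
  · simp
  · simp

/-- A commutative square is cartesian if it is so on points with values in every `T`. -/
theorem isPullback_of_points {C : Type*} [Category C] {P X Y Z : C} {p : P ⟶ X} {q : P ⟶ Y}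
    {f : X ⟶ Z} {g : Y ⟶ Z}
    (w : p ≫ f = q ≫ g) (hex : ∀ {T : C} (a : T ⟶ X) (b : T ⟶ Y), a ≫ f = b ≫ g →
      ∃ l : T ⟶ P, l ≫ p = a ∧ l ≫ q = b)
    (hu : ∀ {T : C} (l m : T ⟶ P), l ≫ p = m ≫ p → l ≫ q = m ≫ q → l = m) :
    IsPullback p q f g :=
  ⟨⟨w⟩, ⟨PullbackCone.IsLimit.mk _
    (fun s => (hex s.fst s.snd s.condition).choose)
    (fun s => (hex s.fst s.snd s.condition).choose_spec.1)
    (fun s => (hex s.fst s.snd s.condition).choose_spec.2)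
    (fun s _ h1 h2 => hu _ _ (h1.trans (hex s.fst s.snd s.condition).choose_spec.1.symm)
      (h2.trans (hex s.fst s.snd s.condition).choose_spec.2.symm))⟩⟩

theorem _root_.CategoryTheory.IsPullback.isFiniteType {P X Y Z : SchC} {p : P ⟶ X} {q : P ⟶ Y}
    {f : X ⟶ Z} {g : Y ⟶ Z} (h : IsPullback p q f g) (hf : IsFiniteType f) : IsFiniteType q := by
  refine ⟨locallyOfFiniteType_sch _, ?_⟩
  have := hf.quasiCompact
  exact MorphismProperty.of_isPullback h.sch hf.quasiCompact

theorem IsFiniteType.of_isIso {X Y : SchC} (u : X ⟶ Y) [IsIso u] : IsFiniteType u :=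
  ⟨locallyOfFiniteType_sch _, inferInstance⟩

theorem IsFiniteType.of_compactSpace {X Y : SchC} (u : X ⟶ Y) [CompactSpace X.scheme] :
    IsFiniteType u := by
  refine ⟨locallyOfFiniteType_sch _, ?_⟩
  exact inferInstance

/-! ### The affine line -/

instance : IsAffine A1.scheme := inferInstanceAs (IsAffine 𝔸(PUnit; SpecC))

theorem coord_injective {T : SchC} {y z : T ⟶ A1} (h : coord y = coord z) : y = z := by
  apply sch_injective
  refine AffineSpace.hom_ext ?_ ?_
  · exact (sch_w y).trans (sch_w z).symm
  · rintro ⟨⟩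
    exact h

theorem coord_comp {S T : SchC} (u : S ⟶ T) (z : T ⟶ A1) :
    coord (u ≫ z) = (sch u).appTop (coord z) := by
  simp [coord]
  rfl

theorem comp_ofSection {S T : SchC} (u : S ⟶ T) (s : Γ(T.scheme, ⊤)) :
    u ≫ ofSection s = ofSection ((sch u).appTop s) :=
  coord_injective (by rw [coord_comp, coord_ofSection, coord_ofSection])

/-! ### Quotients by finite groups: universal property -/

/-- An action of a group on an object of a category. The convention is that of `permute`: the
product `g * h` acts as first `g`, then `h`. -/
structure FiniteAction (G : Type) [Group G] {C : Type*} [Category C] (P : C) where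
  hom : G → (P ⟶ P)
  hom_one : hom 1 = 𝟙 P
  hom_mul : ∀ g h, hom (g * h) = hom g ≫ hom h

/-- Geometric quotients of schemes by a group action, with the same conditions as in
`SymPower`. -/
structure IsGeometricQuotient {G : Type} [Group G] {P Q : Scheme.{0}} (ρ : FiniteAction G P)
    (π : P ⟶ Q) : Prop where
  hom_π : ∀ g, ρ.hom g ≫ π = π
  isQuotientMap : Topology.IsQuotientMap π
  exists_hom : ∀ x y : P, π x = π y → ∃ g, ρ.hom g x = y
  app_injective : ∀ U : Q.Opens, Function.Injective (π.app U)
  exists_app : ∀ (U : Q.Opens) (s : Γ(P, π ⁻¹ᵁ U)),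
    (∀ (g : G) (h : π ⁻¹ᵁ U ≤ ρ.hom g ⁻¹ᵁ (π ⁻¹ᵁ U)),
      (ρ.hom g).appLE (π ⁻¹ᵁ U) (π ⁻¹ᵁ U) h s = s) →
    ∃ t : Γ(Q, U), π.app U t = s

theorem appLE_congr_apply {X Y : Scheme.{0}} {f g : X ⟶ Y} (h : f = g) (U : Y.Opens) (V : X.Opens)
    (e : V ≤ f ⁻¹ᵁ U) (e' : V ≤ g ⁻¹ᵁ U) (s : Γ(Y, U)) : f.appLE U V e s = g.appLE U V e' s := by
  subst h; rfl

theorem appLE_appLE_apply {X Y Z : Scheme.{0}} (f : X ⟶ Y) (g : Y ⟶ Z) (U : Z.Opens) (V : Y.Opens)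
    (W : X.Opens) (e₁ : V ≤ g ⁻¹ᵁ U) (e₂ : W ≤ f ⁻¹ᵁ V) (e : W ≤ (f ≫ g) ⁻¹ᵁ U) (s : Γ(Z, U)) :
    f.appLE V W e₂ (g.appLE U V e₁ s) = (f ≫ g).appLE U W e s := by
  rw [← Scheme.Hom.appLE_comp_appLE f g U V W e₁ e₂]; rfl

theorem app_apply_eq_appLE {X Y : Scheme.{0}} (f : X ⟶ Y) (U : Y.Opens) (s : Γ(Y, U)) :
    f.app U s = f.appLE U (f ⁻¹ᵁ U) le_rfl s := by
  rw [Scheme.Hom.appLE_eq_app]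

/-- A surjective morphism that is injective on functions is an epimorphism: the first condition
determines a morphism on points, the second one on functions. -/
theorem epi_of_surjective_of_injective {P Q : Scheme.{0}} (π : P ⟶ Q)
    (hs : Function.Surjective π) (hi : ∀ U : Q.Opens, Function.Injective (π.app U)) : Epi π := by
  refine ⟨fun {Z} m m' h => ?_⟩
  have hb : m.base = m'.base := by
    ext q
    obtain ⟨p, rfl⟩ := hs q
    have := congr_arg (fun f : P ⟶ Z => f p) h
    exact this
  refine Scheme.Hom.ext hb fun U => ?_
  ext x
  apply hi
  have e : m' ⁻¹ᵁ U ≤ m ⁻¹ᵁ U := by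
    intro q hq
    change m q ∈ U
    have : m q = m' q := congr_arg (fun b => b q) hb
    rw [this]; exact hq
  have h1 : m.app U ≫ Q.presheaf.map (eqToHom congr((TopologicalSpace.Opens.map $hb.symm).obj U)).op
    = m.appLE U (m' ⁻¹ᵁ U) e := by
    rw [Scheme.Hom.app_eq_appLE, Scheme.Hom.appLE_map]
  have e2 : π ⁻¹ᵁ (m' ⁻¹ᵁ U) ≤ (π ≫ m) ⁻¹ᵁ U := fun p (hp : π p ∈ m' ⁻¹ᵁ U) => e hp
  rw [h1, app_apply_eq_appLE m', app_apply_eq_appLE, app_apply_eq_appLE]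
  rw [appLE_appLE_apply π m U _ _ e le_rfl e2, appLE_appLE_apply π m' U _ _ le_rfl le_rfl le_rfl]
  exact appLE_congr_apply h U _ e2 le_rfl x

namespace IsGeometricQuotient

variable {G : Type} [Group G] {P Q : Scheme.{0}} {ρ : FiniteAction G P} {π : P ⟶ Q}

theorem surjective (hπ : IsGeometricQuotient ρ π) : Function.Surjective π :=
  hπ.isQuotientMap.surjective

theorem epi (hπ : IsGeometricQuotient ρ π) : Epi π :=
  epi_of_surjective_of_injective π hπ.surjective hπ.app_injective

theorem apply_hom (hπ : IsGeometricQuotient ρ π) (g : G) (x : P) : π (ρ.hom g x) = π x := by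
  rw [← Scheme.Hom.comp_apply, hπ.hom_π]

theorem injective_appLE (hπ : IsGeometricQuotient ρ π) {U : Q.Opens} {V : P.Opens}
    (hV : V = π ⁻¹ᵁ U) : Function.Injective (π.appLE U V hV.le) := by
  subst hV
  have h := hπ.app_injective U
  rwa [← Scheme.Hom.appLE_eq_app] at h

theorem exists_appLE (hπ : IsGeometricQuotient ρ π) {U : Q.Opens} {V : P.Opens}
    (hV : V = π ⁻¹ᵁ U) (s : Γ(P, V))
    (hs : ∀ (g : G) (h : V ≤ ρ.hom g ⁻¹ᵁ V), (ρ.hom g).appLE V V h s = s) :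
    ∃ t, π.appLE U V hV.le t = s := by
  subst hV
  obtain ⟨t, ht⟩ := hπ.exists_app U s hs
  exact ⟨t, by rw [← app_apply_eq_appLE]; exact ht⟩

section Desc

variable (hπ : IsGeometricQuotient ρ π) {Z : Scheme.{0}} (f : P ⟶ Z) (hf : ∀ g, ρ.hom g ≫ f = f)

include hπ hf in
/-- The map on points of the morphism that an invariant morphism induces on the quotient. -/
theorem exists_base : ∃ b : C(Q, Z), ∀ p, b (π p) = f p := by
  let f' : C(P, Z) := ⟨f, f.continuous⟩
  let π' : C(P, Q) := ⟨π, π.continuous⟩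
  have hq : Topology.IsQuotientMap π' := hπ.isQuotientMap
  have hfac : Function.FactorsThrough f' π' := fun x y hxy => by
    obtain ⟨g, rfl⟩ := hπ.exists_hom x y hxy
    change f x = f (ρ.hom g x)
    rw [← Scheme.Hom.comp_apply, hf]
  exact ⟨hq.lift f' hfac, fun p => congr_arg (fun k : C(P, Z) => k p) (hq.lift_comp f' hfac)⟩

include hπ hf in
/-- Geometric quotients are categorical quotients. -/
theorem exists_desc : ∃ m : Q ⟶ Z, π ≫ m = f := by
  obtain ⟨b, hb⟩ := hπ.exists_base f hf
  let B : Q.toPresheafedSpace.carrier ⟶ Z.toPresheafedSpace.carrier := TopCat.ofHom b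
  have hBU : ∀ U : Z.Opens, f ⁻¹ᵁ U = π ⁻¹ᵁ ((TopologicalSpace.Opens.map B).obj U) := by
    intro U
    ext p
    change f p ∈ U ↔ b (π p) ∈ U
    rw [hb]
  -- pulled back functions are invariant, hence come from the quotient; they do so uniquely
  have hex : ∀ (U : Z.Opens) (x : Γ(Z, U)), ∃ t : Γ(Q, (TopologicalSpace.Opens.map B).obj U),
      π.appLE _ (f ⁻¹ᵁ U) (hBU U).le t = f.app U x := by
    intro U x
    refine hπ.exists_appLE (hBU U) _ fun g h => ?_
    rw [app_apply_eq_appLE, appLE_appLE_apply _ _ _ _ _ _ _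
      (by rw [hf g])]
    exact appLE_congr_apply (hf g) _ _ _ _ x
  choose T hT using hex
  have hinj := fun U => hπ.injective_appLE (hBU U)
  let r : ∀ U : Z.Opens, Γ(Z, U) →+* Γ(Q, (TopologicalSpace.Opens.map B).obj U) := fun U =>
    { toFun := T U
      map_one' := hinj U (by rw [hT, map_one, map_one])
      map_zero' := hinj U (by rw [hT, map_zero, map_zero])
      map_add' := fun x y => hinj U (by rw [hT, map_add, map_add, hT, hT])
      map_mul' := fun x y => hinj U (by rw [hT, map_mul, map_mul, hT, hT]) }
  have hr : ∀ (U : Z.Opens) (x : Γ(Z, U)), π.appLE _ (f ⁻¹ᵁ U) (hBU U).le (r U x) = f.app U x :=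
    hT
  let c : Z.presheaf ⟶ (TopCat.Presheaf.pushforward CommRingCat B).obj Q.presheaf :=
    { app := fun U => CommRingCat.ofHom (r U.unop)
      naturality := by
        intro U V i
        ext x
        apply hinj V.unop
        change π.appLE _ (f ⁻¹ᵁ V.unop) (hBU V.unop).le (r V.unop (Z.presheaf.map i x)) =
          π.appLE _ (f ⁻¹ᵁ V.unop) (hBU V.unop).le
            (Q.presheaf.map ((TopologicalSpace.Opens.map B).op.map i) (r U.unop x))
        rw [hr]
        have h1 : π.appLE _ (f ⁻¹ᵁ V.unop) (hBU V.unop).le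
            (Q.presheaf.map ((TopologicalSpace.Opens.map B).op.map i) (r U.unop x)) =
            P.presheaf.map ((TopologicalSpace.Opens.map f.base).op.map i)
              (π.appLE _ (f ⁻¹ᵁ U.unop) (hBU U.unop).le (r U.unop x)) := by
          rw [← CommRingCat.comp_apply, ← CommRingCat.comp_apply, Scheme.Hom.map_appLE,
            Scheme.Hom.appLE_map]
        rw [h1, hr, ← CommRingCat.comp_apply, ← CommRingCat.comp_apply]
        exact congr_arg (fun k => k.hom x) (f.naturality i) }
  -- a morphism of ringed spaces, which is local as the composition with `π` is
  let m₀ : Q.toPresheafedSpace ⟶ Z.toPresheafedSpace := ⟨B, c⟩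
  have hm₀ : π.toLRSHom.toHom ≫ m₀ = f.toLRSHom.toHom := by
    have hbase : (π.toLRSHom.toHom ≫ m₀).base = f.toLRSHom.toHom.base := by
      ext p
      exact hb p
    refine PresheafedSpace.Hom.ext _ _ hbase ?_
    ext U x
    refine Eq.trans ?_ (hr U x)
    rw [Scheme.Hom.appLE]
    exact congr_arg (fun i => P.presheaf.map i (π.app _ (r U x))) (Subsingleton.elim _ _)
  let m : Q.toLocallyRingedSpace ⟶ Z.toLocallyRingedSpace := ⟨m₀, fun q => by
    obtain ⟨p, rfl⟩ := hπ.surjective q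
    have h1 : IsLocalHom ((π.toLRSHom.toHom ≫ m₀).stalkMap p).hom := by
      rw [PresheafedSpace.stalkMap.congr_hom _ _ hm₀ p]
      have : IsLocalHom (f.toLRSHom.toHom.stalkMap p).hom := f.toLRSHom.prop p
      infer_instance
    rw [PresheafedSpace.stalkMap.comp] at h1
    exact @isLocalHom_of_comp _ _ _ _ _ _ (m₀.stalkMap _).hom
      (π.toLRSHom.toHom.stalkMap p).hom h1⟩
  exact ⟨⟨m⟩, Scheme.Hom.ext' (LocallyRingedSpace.Hom.ext' hm₀)⟩

end Desc

/-- Two geometric quotients of the same action are isomorphic. -/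
theorem isIso (hπ : IsGeometricQuotient ρ π) {Q' : Scheme.{0}} {π' : P ⟶ Q'}
    (hπ' : IsGeometricQuotient ρ π') (m : Q ⟶ Q') (hm : π ≫ m = π') : IsIso m := by
  obtain ⟨m', hm'⟩ := hπ'.exists_desc π hπ.hom_π
  have := hπ.epi
  have := hπ'.epi
  refine ⟨m', ?_, ?_⟩
  · rw [← cancel_epi π, reassoc_of% hm, hm', Category.comp_id]
  · rw [← cancel_epi π', reassoc_of% hm', hm, Category.comp_id]

end IsGeometricQuotient

/-- An open immersion identifies the functions on an open subset of its image with those on the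
preimage. -/
theorem bijective_appLE_of_isOpenImmersion {X Y : Scheme.{0}} (j : X ⟶ Y) [IsOpenImmersion j]
    {U : Y.Opens} {V : X.Opens} (hV : V = j ⁻¹ᵁ U) (hU : (U : Set Y) ⊆ Set.range j) :
    Function.Bijective (j.appLE U V hV.le) := by
  subst hV
  have : IsIso (j.app U) := j.isIso_app U hU
  rw [Scheme.Hom.appLE_eq_app]
  exact ConcreteCategory.bijective_of_isIso (j.app U)

/-- A geometric quotient restricts to a geometric quotient over an open subset of the target. -/
theorem IsGeometricQuotient.of_isOpenImmersion {G : Type} [Group G] {P Q P' Q' : Scheme.{0}}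
    {ρ : FiniteAction G P} {π : P ⟶ Q} (hπ : IsGeometricQuotient ρ π) (ρ' : FiniteAction G P')
    (j : P' ⟶ P) (k : Q' ⟶ Q) (π' : P' ⟶ Q') [IsOpenImmersion j] [IsOpenImmersion k]
    (hj : ∀ g, ρ'.hom g ≫ j = j ≫ ρ.hom g) (w : π' ≫ k = j ≫ π)
    (hr : ∀ p, p ∈ Set.range j ↔ π p ∈ Set.range k) : IsGeometricQuotient ρ' π' := by
  have hw : ∀ p, k (π' p) = π (j p) := fun p => by
    rw [← Scheme.Hom.comp_apply, w, Scheme.Hom.comp_apply]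
  have hkinj : Function.Injective k := k.isOpenEmbedding.injective
  have hjinj : Function.Injective j := j.isOpenEmbedding.injective
  -- the open subsets of `Q'` are those of `Q` inside the range of `k`, and similarly for `P'`
  have hV : ∀ V : Q'.Opens, ∃ V₂ : Q.Opens, (V₂ : Set Q) ⊆ Set.range k ∧ V = k ⁻¹ᵁ V₂ := fun V =>
    ⟨k ''ᵁ V, by rintro _ ⟨x, -, rfl⟩; exact ⟨x, rfl⟩, (k.preimage_image_eq V).symm⟩
  have hpre : ∀ V₂ : Q.Opens, π' ⁻¹ᵁ (k ⁻¹ᵁ V₂) = j ⁻¹ᵁ (π ⁻¹ᵁ V₂) := fun V₂ => by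
    ext p
    change k (π' p) ∈ V₂ ↔ π (j p) ∈ V₂
    rw [hw]
  have hsub : ∀ V₂ : Q.Opens, (V₂ : Set Q) ⊆ Set.range k →
      ((π ⁻¹ᵁ V₂ : P.Opens) : Set P) ⊆ Set.range j := fun V₂ h p hp => (hr p).2 (h hp)
  have hcomp : ∀ (V₂ : Q.Opens) (τ : Γ(Q, V₂)),
      π'.app (k ⁻¹ᵁ V₂) (k.app V₂ τ) = j.appLE (π ⁻¹ᵁ V₂) _ (hpre V₂).le (π.app V₂ τ) := by
    intro V₂ τ
    have e : π' ⁻¹ᵁ (k ⁻¹ᵁ V₂) ≤ (j ≫ π) ⁻¹ᵁ V₂ := by rw [← w]; exact le_rfl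
    rw [app_apply_eq_appLE, app_apply_eq_appLE, app_apply_eq_appLE,
      appLE_appLE_apply π' k V₂ _ _ le_rfl le_rfl le_rfl,
      appLE_appLE_apply j π V₂ _ _ le_rfl (hpre V₂).le e]
    exact appLE_congr_apply w _ _ _ _ _
  refine ⟨fun g => ?_, ?_, fun x y hxy => ?_, fun V => ?_, fun V s hs => ?_⟩
  · rw [← cancel_mono k, Category.assoc, w, reassoc_of% (hj g), hπ.hom_π]
  · refine ⟨.of_isOpen_preimage_iff_isOpen fun s => ?_, fun q => ?_⟩
    swap
    · obtain ⟨p, hp⟩ := hπ.surjective (k q)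
      obtain ⟨p', rfl⟩ := (hr p).2 ⟨q, hp.symm⟩
      exact ⟨p', hkinj (by rw [hw, hp])⟩
    · rw [k.isOpenEmbedding.isOpen_iff_image_isOpen, ← hπ.isQuotientMap.isOpen_preimage,
        j.isOpenEmbedding.isOpen_iff_image_isOpen]
      have : (π ⁻¹' (k '' s)) = j '' (π' ⁻¹' s) := by
        ext p
        constructor
        · rintro ⟨q, hq, hqp⟩
          obtain ⟨p', rfl⟩ := (hr p).2 ⟨q, hqp⟩
          refine ⟨p', ?_, rfl⟩
          have : π' p' = q := hkinj (by rw [hw, hqp])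
          rwa [Set.mem_preimage, this]
        · rintro ⟨p', hp', rfl⟩
          exact ⟨π' p', hp', hw p'⟩
      rw [this]
  · obtain ⟨g, hg⟩ := hπ.exists_hom (j x) (j y) (by rw [← hw, ← hw, hxy])
    refine ⟨g, hjinj ?_⟩
    rw [← hg, ← Scheme.Hom.comp_apply, hj, Scheme.Hom.comp_apply]
  · obtain ⟨V₂, hV₂, rfl⟩ := hV V
    have hk := bijective_appLE_of_isOpenImmersion k (V := k ⁻¹ᵁ V₂) rfl hV₂
    rw [Scheme.Hom.appLE_eq_app] at hk
    have hj' := bijective_appLE_of_isOpenImmersion j (hpre V₂) (hsub V₂ hV₂)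
    intro t t' h
    obtain ⟨τ, rfl⟩ := hk.2 t
    obtain ⟨τ', rfl⟩ := hk.2 t'
    rw [hcomp, hcomp] at h
    rw [hπ.app_injective V₂ (hj'.1 h)]
  · obtain ⟨V₂, hV₂, rfl⟩ := hV V
    have hj' := bijective_appLE_of_isOpenImmersion j (hpre V₂) (hsub V₂ hV₂)
    obtain ⟨σ, rfl⟩ := hj'.2 s
    obtain ⟨τ, hτ⟩ := hπ.exists_app V₂ σ fun g h => by
      apply hj'.1
      have e2 : π' ⁻¹ᵁ (k ⁻¹ᵁ V₂) ≤ ρ'.hom g ⁻¹ᵁ (π' ⁻¹ᵁ (k ⁻¹ᵁ V₂)) := by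
        intro p hp
        change k (π' (ρ'.hom g p)) ∈ V₂
        have : j (ρ'.hom g p) = ρ.hom g (j p) := by
          rw [← Scheme.Hom.comp_apply, hj, Scheme.Hom.comp_apply]
        rw [hw, this, hπ.apply_hom, ← hw]
        exact hp
      have e3 : π' ⁻¹ᵁ (k ⁻¹ᵁ V₂) ≤ (j ≫ ρ.hom g) ⁻¹ᵁ (π ⁻¹ᵁ V₂) :=
        (hpre V₂).le.trans fun p hp => h hp
      have e4 : π' ⁻¹ᵁ (k ⁻¹ᵁ V₂) ≤ (ρ'.hom g ≫ j) ⁻¹ᵁ (π ⁻¹ᵁ V₂) := by rw [hj]; exact e3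
      have := hs g e2
      rw [appLE_appLE_apply (ρ'.hom g) j _ _ _ _ _ e4] at this
      rw [appLE_appLE_apply j (ρ.hom g) _ _ _ _ _ e3, ← this]
      exact (appLE_congr_apply (hj g) _ _ _ _ _).symm
    exact ⟨k.app V₂ τ, by rw [hcomp, hτ]⟩

/-! ### Quotients by finite groups: the local criterion -/

/-- The condition on an affine open subset `W` of the target that over `W`, the morphism is given
by the inclusion of the ring of invariants into the ring of an affine scheme. -/
structure IsInvariantChart {G : Type} [Group G] {P Q : Scheme.{0}} (ρ : FiniteAction G P)
    (π : P ⟶ Q) (W : Q.Opens) : Prop where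
  isAffineOpen : IsAffineOpen W
  isAffineOpen_preimage : IsAffineOpen (π ⁻¹ᵁ W)
  injective : Function.Injective (π.app W)
  exists_app : ∀ s : Γ(P, π ⁻¹ᵁ W),
    (∀ (g : G) (h : π ⁻¹ᵁ W ≤ ρ.hom g ⁻¹ᵁ (π ⁻¹ᵁ W)),
      (ρ.hom g).appLE (π ⁻¹ᵁ W) (π ⁻¹ᵁ W) h s = s) → ∃ t : Γ(Q, W), π.app W t = s

/-- Quotients by a finite group that are affine locally the spectra of the rings of invariants. -/
structure IsFiniteQuotient {G : Type} [Group G] {P Q : Scheme.{0}} (ρ : FiniteAction G P)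
    (π : P ⟶ Q) : Prop where
  hom_π : ∀ g, ρ.hom g ≫ π = π
  exists_chart : ∀ q : Q, ∃ W : Q.Opens, q ∈ W ∧ IsInvariantChart ρ π W

section

variable {G : Type} [Group G] {P : Scheme.{0}} (ρ : FiniteAction G P)

/-- The action of the group on the functions on an invariant open subset. -/
@[reducible] def FiniteAction.mulSemiringAction (O : P.Opens) (hO : ∀ g, O ≤ ρ.hom g ⁻¹ᵁ O) :
    MulSemiringAction G Γ(P, O) where
  smul g s := (ρ.hom g).appLE O O (hO g) s
  one_smul s := by
    change (ρ.hom 1).appLE O O (hO 1) s = s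
    rw [appLE_congr_apply ρ.hom_one O O (hO 1) le_rfl]
    have h : P.presheaf.map (𝟙 (Opposite.op O)) s = s := by simp
    exact h
  mul_smul g h s := by
    change (ρ.hom (g * h)).appLE O O (hO _) s =
      (ρ.hom g).appLE O O (hO g) ((ρ.hom h).appLE O O (hO h) s)
    have e : O ≤ (ρ.hom g ≫ ρ.hom h) ⁻¹ᵁ O := by rw [← ρ.hom_mul]; exact hO _
    rw [appLE_appLE_apply _ _ _ _ _ _ _ e]
    exact appLE_congr_apply (ρ.hom_mul g h) O O (hO _) e s
  smul_zero g := map_zero _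
  smul_add g := map_add _
  smul_one g := map_one _
  smul_mul g := map_mul _

end

variable {G : Type} [Group G] {P Q : Scheme.{0}} {ρ : FiniteAction G P} {π : P ⟶ Q}

theorem preimage_le_of_hom_π (h : ∀ g, ρ.hom g ≫ π = π) (U : Q.Opens) (g : G) :
    π ⁻¹ᵁ U ≤ ρ.hom g ⁻¹ᵁ (π ⁻¹ᵁ U) := by
  intro p hp
  change π (ρ.hom g p) ∈ U
  rw [← Scheme.Hom.comp_apply, h]
  exact hp

namespace IsInvariantChart

variable [Finite G] {W : Q.Opens}

/-- Every function is a root of the polynomial with the translates of the function as its roots,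
which has invariant coefficients. -/
theorem isIntegral (hW : IsInvariantChart ρ π W) (h : ∀ g, ρ.hom g ≫ π = π) :
    (π.app W).hom.IsIntegral := by
  let _ := ρ.mulSemiringAction (π ⁻¹ᵁ W) (preimage_le_of_hom_π h W)
  let _ := (π.app W).hom.toAlgebra
  have : Algebra.IsInvariant Γ(Q, W) Γ(P, π ⁻¹ᵁ W) G :=
    ⟨fun b hb => hW.exists_app b fun g _ => hb g⟩
  exact (Algebra.IsInvariant.isIntegral Γ(Q, W) Γ(P, π ⁻¹ᵁ W) G).isIntegral

theorem exists_apply_eq (hW : IsInvariantChart ρ π W) (h : ∀ g, ρ.hom g ≫ π = π) {q : Q}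
    (hq : q ∈ W) : ∃ p, π p = q := by
  obtain ⟨x, hx⟩ := (hW.isIntegral h).comap_surjective hW.injective
    (hW.isAffineOpen.primeIdealOf ⟨q, hq⟩)
  let x' : Spec Γ(P, π ⁻¹ᵁ W) := x
  refine ⟨hW.isAffineOpen_preimage.fromSpec x', ?_⟩
  have h1 := IsAffineOpen.SpecMap_appLE_fromSpec π hW.isAffineOpen hW.isAffineOpen_preimage le_rfl
  rw [← Scheme.Hom.comp_apply, ← h1, Scheme.Hom.comp_apply, Scheme.Hom.appLE_eq_app]
  have h2 : Spec.map (π.app W) x' = hW.isAffineOpen.primeIdealOf ⟨q, hq⟩ := hx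
  rw [h2, IsAffineOpen.fromSpec_primeIdealOf]

/-- A finite group acts transitively on the primes over a given prime of the ring of invariants. -/
theorem exists_hom (hW : IsInvariantChart ρ π W) (h : ∀ g, ρ.hom g ≫ π = π) {x y : P}
    (hx : π x ∈ W) (hxy : π x = π y) : ∃ g, ρ.hom g x = y := by
  let _ := ρ.mulSemiringAction (π ⁻¹ᵁ W) (preimage_le_of_hom_π h W)
  let _ := (π.app W).hom.toAlgebra
  have : Algebra.IsInvariant Γ(Q, W) Γ(P, π ⁻¹ᵁ W) G :=
    ⟨fun b hb => hW.exists_app b fun g _ => hb g⟩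
  have hinv : ∀ (g : G) (a : Γ(Q, W)), g • (π.app W a) = π.app W a := fun g a => by
    change (ρ.hom g).appLE _ _ (preimage_le_of_hom_π h W g) (π.app W a) = _
    rw [app_apply_eq_appLE, appLE_appLE_apply _ _ _ _ _ _ _ (by rw [h])]
    exact appLE_congr_apply (h g) _ _ _ _ _
  have : SMulCommClass G Γ(Q, W) Γ(P, π ⁻¹ᵁ W) := ⟨fun g a b => by
    rw [Algebra.smul_def, Algebra.smul_def, smul_mul']
    congr 1
    exact hinv g a⟩
  have hy : π y ∈ W := hxy ▸ hx
  let hO := hW.isAffineOpen_preimage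
  let px := hO.primeIdealOf ⟨x, hx⟩
  let py := hO.primeIdealOf ⟨y, hy⟩
  have e1 := IsAffineOpen.comap_primeIdealOf_appLE W hW.isAffineOpen _ hO le_rfl (f := π) hx
  have e2 := IsAffineOpen.comap_primeIdealOf_appLE W hW.isAffineOpen _ hO le_rfl (f := π) hy
  have e : px.asIdeal.under Γ(Q, W) = py.asIdeal.under Γ(Q, W) := by
    have : hW.isAffineOpen.primeIdealOf ⟨π x, hx⟩ = hW.isAffineOpen.primeIdealOf ⟨π y, hy⟩ := by
      congr 2
    rw [Scheme.Hom.appLE_eq_app] at e1 e2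
    exact congr_arg PrimeSpectrum.asIdeal (e1.trans (this.trans e2.symm))
  obtain ⟨g, hg⟩ := Algebra.IsInvariant.exists_smul_of_under_eq Γ(Q, W) Γ(P, π ⁻¹ᵁ W) G
    px.asIdeal py.asIdeal e
  refine ⟨g⁻¹, ?_⟩
  have hgx : ρ.hom g⁻¹ x ∈ π ⁻¹ᵁ W := preimage_le_of_hom_π h W g⁻¹ hx
  have e3 := IsAffineOpen.comap_primeIdealOf_appLE _ hO _ hO (preimage_le_of_hom_π h W g⁻¹)
    (f := ρ.hom g⁻¹) (x := x) hx
  have e4 : py = hO.primeIdealOf ⟨ρ.hom g⁻¹ x, hgx⟩ := by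
    rw [← e3]
    ext b
    rw [hg, Ideal.mem_pointwise_smul_iff_inv_smul_mem]
    rfl
  have e5 := congr_arg hO.fromSpec e4
  rw [hO.fromSpec_primeIdealOf, hO.fromSpec_primeIdealOf] at e5
  exact e5.symm

/-- The conditions on functions pass from a chart to its basic open subsets. -/
theorem basicOpen (hW : IsInvariantChart ρ π W) (h : ∀ g, ρ.hom g ≫ π = π) (f : Γ(Q, W)) :
    IsInvariantChart ρ π (Q.basicOpen f) := by
  have hpre : π ⁻¹ᵁ Q.basicOpen f = P.basicOpen (π.app W f) := Scheme.preimage_basicOpen π f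
  have hle := Q.basicOpen_le f
  have hleP : π ⁻¹ᵁ Q.basicOpen f ≤ π ⁻¹ᵁ W := fun p hp => hle hp
  -- restriction of functions from the chart to the basic open subset, on `Q` and on `P`
  let r : Γ(Q, W) →+* Γ(Q, Q.basicOpen f) := (Q.presheaf.map (homOfLE hle).op).hom
  let rP : Γ(P, π ⁻¹ᵁ W) →+* Γ(P, π ⁻¹ᵁ Q.basicOpen f) := (P.presheaf.map (homOfLE hleP).op).hom
  have hr : ∀ a, π.app _ (r a) = rP (π.app W a) := fun a =>
    congr_arg (fun k => k.hom a) (π.naturality (homOfLE hle).op)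
  have hu : IsUnit (r f) := RingedSpace.isUnit_res_basicOpen _ f
  have hQ : ∀ t : Γ(Q, Q.basicOpen f), ∃ (n : ℕ) (a : Γ(Q, W)), r a = (r f) ^ n * t := fun t =>
    exists_eq_pow_mul_of_isCompact_of_isQuasiSeparated Q W hW.isAffineOpen.isCompact
      hW.isAffineOpen.isQuasiSeparated f t
  have hO := hW.isAffineOpen_preimage
  have hP : ∀ s : Γ(P, π ⁻¹ᵁ Q.basicOpen f), ∃ (n : ℕ) (b : Γ(P, π ⁻¹ᵁ W)),
      rP b = (rP (π.app W f)) ^ n * s := by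
    simp only [rP]
    clear hr rP
    revert hleP
    rw [hpre]
    intro hleP s
    exact exists_eq_pow_mul_of_isCompact_of_isQuasiSeparated P _ hO.isCompact
      hO.isQuasiSeparated _ s
  have hP0 : ∀ b : Γ(P, π ⁻¹ᵁ W), rP b = 0 → ∃ n : ℕ, (π.app W f) ^ n * b = 0 := by
    simp only [rP]
    clear hr hP rP
    revert hleP
    rw [hpre]
    intro hleP b hb
    exact exists_pow_mul_eq_zero_of_res_basicOpen_eq_zero_of_isCompact P hO.isCompact b _ hb
  have hact : ∀ (g : G) (b : Γ(P, π ⁻¹ᵁ W)),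
      (ρ.hom g).appLE _ _ (preimage_le_of_hom_π h (Q.basicOpen f) g) (rP b) =
        rP ((ρ.hom g).appLE _ _ (preimage_le_of_hom_π h W g) b) := fun g b => by
    simp only [rP]
    rw [← CommRingCat.comp_apply, ← CommRingCat.comp_apply, Scheme.Hom.map_appLE,
      Scheme.Hom.appLE_map]
  have hπinv : ∀ (U : Q.Opens) (g : G) (a : Γ(Q, U)),
      (ρ.hom g).appLE _ _ (preimage_le_of_hom_π h U g) (π.app U a) = π.app U a := fun U g a => by
    rw [app_apply_eq_appLE, appLE_appLE_apply _ _ _ _ _ _ _ (by rw [h])]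
    exact appLE_congr_apply (h g) _ _ _ _ _
  refine ⟨hW.isAffineOpen.basicOpen f, ?_, ?_, ?_⟩
  · rw [hpre]; exact hO.basicOpen _
  · rw [injective_iff_map_eq_zero]
    intro t ht
    obtain ⟨n, a, ha⟩ := hQ t
    have h1 : rP (π.app W a) = 0 := by rw [← hr, ha, map_mul, ht, mul_zero]
    obtain ⟨m, hm⟩ := hP0 _ h1
    rw [← map_pow, ← map_mul, ← map_zero (π.app W).hom] at hm
    have h2 := congr_arg r (hW.injective hm)
    rw [map_mul, map_pow, map_zero, ha, ← mul_assoc] at h2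
    exact ((((hu.pow m).mul (hu.pow n))).mul_right_eq_zero).1 h2
  · intro s hs
    obtain ⟨n, b, hb⟩ := hP s
    -- the function `b` clears the denominators of `s`; it is invariant only up to a power of `f`,
    -- so that a further power of `f`, large enough for all `g` at once, is needed
    have h1 : ∀ g, ∃ m : ℕ, (π.app W f) ^ m *
        ((ρ.hom g).appLE _ _ (preimage_le_of_hom_π h W g) b - b) = 0 := fun g => by
      apply hP0
      rw [map_sub, ← hact, hb, map_mul, map_pow, ← hr, hπinv, hs g, sub_self]
    choose m hm using h1
    classical
    cases nonempty_fintype G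
    obtain ⟨a, ha⟩ := hW.exists_app ((π.app W f) ^ (∑ g, m g) * b) fun g hg => by
      rw [map_mul, map_pow, hπinv, ← sub_eq_zero, ← mul_sub,
        ← Finset.add_sum_erase _ _ (Finset.mem_univ g), pow_add, mul_right_comm, hm, zero_mul]
    obtain ⟨u, hu'⟩ := hu.pow (n + ∑ g, m g)
    refine ⟨r a * ↑u⁻¹, ?_⟩
    have h3 : IsUnit (π.app _ (r f ^ (n + ∑ g, m g))) := (hu.pow _).map _
    apply h3.mul_left_cancel
    rw [← map_mul, ← hu', mul_left_comm, Units.mul_inv, mul_one, hr, ha, hu', map_mul, hb,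
      map_pow, map_pow, ← hr, pow_add]
    ring

end IsInvariantChart

namespace IsFiniteQuotient

variable [Finite G]

/-- The morphism to the quotient is integral; hence it is closed, and the quotient carries the
quotient topology. -/
theorem isIntegralHom (hπ : IsFiniteQuotient ρ π) : IsIntegralHom π := by
  choose W hqW hW using hπ.exists_chart
  have inst := IsIntegralHom.hasAffineProperty.{0}
  refine (@HasAffineProperty.iff_of_iSup_eq_top _ _ inst _ _ π _
    (fun q => (⟨W q, (hW q).isAffineOpen⟩ : Q.affineOpens))
    (top_le_iff.1 fun q _ => TopologicalSpace.Opens.mem_iSup.2 ⟨q, hqW q⟩)).2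
    fun q => ⟨(hW q).isAffineOpen_preimage, ?_⟩
  rw [morphismRestrict_app']
  have e1 : W q = (W q).ι ''ᵁ ⊤ := (W q).ι_image_top.symm
  have e2 : π ⁻¹ᵁ (W q) = (π ⁻¹ᵁ (W q)).ι ''ᵁ ((π ∣_ W q) ⁻¹ᵁ ⊤) := (π ⁻¹ᵁ (W q)).ι_image_top.symm
  refine (Scheme.Hom.appLE_congr (f := π) le_rfl e1 e2
    (fun φ => φ.hom.IsIntegral)).1 ?_
  rw [Scheme.Hom.appLE_eq_app]
  exact (hW q).isIntegral hπ.hom_π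

theorem surjective (hπ : IsFiniteQuotient ρ π) : Function.Surjective π := fun q => by
  obtain ⟨W, hq, hW⟩ := hπ.exists_chart q
  exact hW.exists_apply_eq hπ.hom_π hq

/-- The basic open subsets of charts form a basis of the topology. -/
theorem exists_chart_le (hπ : IsFiniteQuotient ρ π) {U : Q.Opens} {q : Q} (hq : q ∈ U) :
    ∃ W : Q.Opens, q ∈ W ∧ W ≤ U ∧ IsInvariantChart ρ π W := by
  obtain ⟨W, hqW, hW⟩ := hπ.exists_chart q
  obtain ⟨f, hf, hqf⟩ := hW.isAffineOpen.exists_basicOpen_le ⟨q, hq⟩ hqW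
  exact ⟨_, hqf, hf, hW.basicOpen hπ.hom_π f⟩

theorem app_injective (hπ : IsFiniteQuotient ρ π) (U : Q.Opens) :
    Function.Injective (π.app U) := by
  rw [injective_iff_map_eq_zero]
  intro t ht
  choose W hqW hWU hW using fun q : U => hπ.exists_chart_le q.2
  refine Q.sheaf.eq_of_locally_eq' W U (fun q => homOfLE (hWU q))
    (fun q hq => TopologicalSpace.Opens.mem_iSup.2 ⟨⟨q, hq⟩, hqW _⟩) t 0 fun q => ?_
  apply (hW q).injective
  have h := congr_arg (fun k => k.hom t) (π.naturality (homOfLE (hWU q)).op)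
  refine Eq.trans h ?_
  change P.presheaf.map _ (π.app U t) = π.app (W q) (Q.presheaf.map _ 0)
  rw [ht, map_zero, map_zero, map_zero]

theorem exists_app (hπ : IsFiniteQuotient ρ π) (U : Q.Opens) (s : Γ(P, π ⁻¹ᵁ U))
    (hs : ∀ (g : G) (h : π ⁻¹ᵁ U ≤ ρ.hom g ⁻¹ᵁ (π ⁻¹ᵁ U)),
      (ρ.hom g).appLE (π ⁻¹ᵁ U) (π ⁻¹ᵁ U) h s = s) : ∃ t : Γ(Q, U), π.app U t = s := by
  choose W hqW hWU hW using fun q : U => hπ.exists_chart_le q.2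
  have hnat : ∀ {V V' : Q.Opens} (i : V' ⟶ V) (t : Γ(Q, V)), π.app V' (Q.presheaf.map i.op t) =
      P.presheaf.map ((TopologicalSpace.Opens.map π.base).map i).op (π.app V t) := fun i t =>
    congr_arg (fun k => k.hom t) (π.naturality i.op)
  have hex : ∀ q : U, ∃ t : Γ(Q, W q), π.app (W q) t =
      P.presheaf.map ((TopologicalSpace.Opens.map π.base).map (homOfLE (hWU q))).op s := by
    intro q
    refine (hW q).exists_app _ fun g h => ?_
    conv_rhs => rw [← hs g (preimage_le_of_hom_π hπ.hom_π U g)]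
    rw [← CommRingCat.comp_apply, ← CommRingCat.comp_apply, Scheme.Hom.map_appLE,
      Scheme.Hom.appLE_map]
  choose t ht using hex
  obtain ⟨t', ht', -⟩ := Q.sheaf.existsUnique_gluing' W U (fun q => homOfLE (hWU q))
    (fun q hq => TopologicalSpace.Opens.mem_iSup.2 ⟨⟨q, hq⟩, hqW _⟩) t fun q q' => by
      apply hπ.app_injective
      refine (hnat _ _).trans (Eq.trans ?_ (hnat _ _).symm)
      rw [ht, ht, ← CommRingCat.comp_apply, ← CommRingCat.comp_apply, ← Functor.map_comp,
        ← Functor.map_comp]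
      rfl
  refine ⟨t', ?_⟩
  refine P.sheaf.eq_of_locally_eq' (fun q => π ⁻¹ᵁ (W q)) (π ⁻¹ᵁ U)
    (fun q => (TopologicalSpace.Opens.map π.base).map (homOfLE (hWU q)))
    (fun p hp => TopologicalSpace.Opens.mem_iSup.2 ⟨⟨π p, hp⟩, hqW _⟩) _ _ fun q => ?_
  refine Eq.trans (hnat (homOfLE (hWU q)) t').symm ?_
  refine Eq.trans (congr_arg (π.app (W q)) (ht' q)) (ht q)

theorem isGeometricQuotient (hπ : IsFiniteQuotient ρ π) : IsGeometricQuotient ρ π where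
  hom_π := hπ.hom_π
  isQuotientMap :=
    have := hπ.isIntegralHom
    π.isClosedMap.isQuotientMap π.continuous hπ.surjective
  exists_hom x y hxy := by
    obtain ⟨W, hq, hW⟩ := hπ.exists_chart (π x)
    exact hW.exists_hom hπ.hom_π hq hxy
  app_injective := hπ.app_injective
  exists_app := hπ.exists_app

end IsFiniteQuotient

/-! ### Quotients by finite groups: existence -/

section AffineQuotient

variable {G : Type} [Group G] {P : Scheme.{0}} (ρ : FiniteAction G P)

/-- The ring of invariant functions. -/
def FiniteAction.invariants : Subring Γ(P, ⊤) where
  carrier := {s | ∀ g, (ρ.hom g).appTop s = s}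
  zero_mem' g := map_zero _
  one_mem' g := map_one _
  add_mem' ha hb g := by rw [map_add, ha g, hb g]
  mul_mem' ha hb g := by rw [map_mul, ha g, hb g]
  neg_mem' ha g := by rw [map_neg, ha g]

/-- The spectrum of the ring of invariant functions. -/
abbrev FiniteAction.affineQuotient : Scheme.{0} := Spec (.of ρ.invariants)

/-- The morphism to the spectrum of the ring of invariant functions. -/
def FiniteAction.toAffineQuotient : P ⟶ ρ.affineQuotient :=
  P.toSpecΓ ≫ Spec.map (CommRingCat.ofHom ρ.invariants.subtype)

theorem FiniteAction.toAffineQuotient_appTop : ρ.toAffineQuotient.appTop =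
    (Scheme.ΓSpecIso _).hom ≫ CommRingCat.ofHom ρ.invariants.subtype := by
  rw [toAffineQuotient, Scheme.Hom.comp_appTop, Scheme.toSpecΓ_appTop, Scheme.ΓSpecIso_naturality]

theorem FiniteAction.hom_toAffineQuotient (g : G) :
    ρ.hom g ≫ ρ.toAffineQuotient = ρ.toAffineQuotient := by
  rw [toAffineQuotient, Scheme.toSpecΓ_naturality_assoc, ← Spec.map_comp]
  congr 2
  ext s
  exact s.2 g

/-- The quotient of an affine scheme is the spectrum of the ring of invariants. -/
theorem FiniteAction.isFiniteQuotient_toAffineQuotient [IsAffine P] :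
    IsFiniteQuotient ρ ρ.toAffineQuotient := by
  refine ⟨ρ.hom_toAffineQuotient, fun q => ⟨⊤, trivial, ?_⟩⟩
  have key : ∀ t, ρ.toAffineQuotient.app ⊤ t = ((Scheme.ΓSpecIso (.of ρ.invariants)).hom t).1 :=
    fun t => congr_arg (fun k => k.hom t) ρ.toAffineQuotient_appTop
  refine ⟨isAffineOpen_top _, isAffineOpen_top _, fun s t h => ?_, fun s hs => ?_⟩
  · rw [key, key] at h
    exact (ConcreteCategory.bijective_of_isIso (Scheme.ΓSpecIso (.of ρ.invariants)).hom).1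
      (Subtype.ext h)
  · obtain ⟨t, ht⟩ := (ConcreteCategory.bijective_of_isIso
      (Scheme.ΓSpecIso (.of ρ.invariants)).hom).2 ⟨s, fun g =>
        (app_apply_eq_appLE (ρ.hom g) ⊤ s).trans (hs g le_top)⟩
    exact ⟨t, by rw [key, ht]⟩

end AffineQuotient

/-- An equivariant open immersion induces an open immersion of the geometric quotients. -/
theorem IsGeometricQuotient.isOpenImmersion {G : Type} [Group G] {P Q P' Q' : Scheme.{0}}
    {ρ : FiniteAction G P} {π : P ⟶ Q} (hπ : IsGeometricQuotient ρ π) {ρ' : FiniteAction G P'}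
    {π' : P' ⟶ Q'} (hπ' : IsGeometricQuotient ρ' π') (j : P' ⟶ P) [IsOpenImmersion j]
    (hj : ∀ g, ρ'.hom g ≫ j = j ≫ ρ.hom g) (m : Q' ⟶ Q) (hm : π' ≫ m = j ≫ π) :
    IsOpenImmersion m := by
  -- the image of `j` is saturated, so that its image `W` in the quotient is open
  have hsat : ∀ p, π p ∈ π '' Set.range j ↔ p ∈ Set.range j := by
    refine fun p => ⟨?_, fun hp => ⟨p, hp, rfl⟩⟩
    rintro ⟨_, ⟨p', rfl⟩, hp'⟩
    obtain ⟨g, rfl⟩ := hπ.exists_hom _ _ hp'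
    exact ⟨ρ'.hom g p', by rw [← Scheme.Hom.comp_apply, hj, Scheme.Hom.comp_apply]⟩
  let W : Q.Opens := ⟨π '' Set.range j, by
    rw [← hπ.isQuotientMap.isOpen_preimage]
    have : π ⁻¹' (π '' Set.range j) = Set.range j := Set.ext hsat
    rw [this]
    exact j.isOpenEmbedding.isOpen_range⟩
  have hW : Set.range (j ≫ π) ⊆ Set.range W.ι := by
    rw [Scheme.Opens.range_ι]
    rintro _ ⟨p, rfl⟩
    exact ⟨j p, ⟨p, rfl⟩, rfl⟩
  have hl := IsOpenImmersion.lift_fac W.ι (j ≫ π) hW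
  have h1 : IsGeometricQuotient ρ' (IsOpenImmersion.lift W.ι (j ≫ π) hW) :=
    hπ.of_isOpenImmersion ρ' j W.ι _ hj hl fun p => by
      rw [Scheme.Opens.range_ι]; exact (hsat p).symm
  obtain ⟨e, he⟩ := hπ'.exists_desc _ h1.hom_π
  have := hπ'.isIso h1 e he
  have := hπ'.epi
  have h2 : m = e ≫ W.ι := by
    rw [← cancel_epi π', hm, reassoc_of% he, hl]
  rw [h2]
  infer_instance

/-- A chart can be given by open immersions to the source and the target. -/
theorem IsInvariantChart.of_isOpenImmersion {G : Type} [Group G] {P Q P' Q' : Scheme.{0}}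
    {ρ : FiniteAction G P} {π : P ⟶ Q} {ρ' : FiniteAction G P'}
    (j : P' ⟶ P) (k : Q' ⟶ Q) (π' : P' ⟶ Q') [IsAffine P'] [IsAffine Q'] [IsOpenImmersion j]
    [IsOpenImmersion k] (hj : ∀ g, ρ'.hom g ≫ j = j ≫ ρ.hom g) (w : π' ≫ k = j ≫ π)
    (hr : ∀ p, p ∈ Set.range j ↔ π p ∈ Set.range k) (h : ∀ g, ρ.hom g ≫ π = π)
    (hπ' : IsGeometricQuotient ρ' π') : IsInvariantChart ρ π k.opensRange := by
  have hpre : π ⁻¹ᵁ k.opensRange = j.opensRange := by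
    ext p; exact (hr p).symm
  have hk := bijective_appLE_of_isOpenImmersion k (U := k.opensRange) (V := ⊤)
    (by ext p; exact ⟨fun _ => ⟨p, rfl⟩, fun _ => trivial⟩) le_rfl
  have hj' := bijective_appLE_of_isOpenImmersion j (U := π ⁻¹ᵁ k.opensRange) (V := ⊤)
    (by rw [hpre]; ext p; exact ⟨fun _ => ⟨p, rfl⟩, fun _ => trivial⟩) (by rw [hpre]; exact le_rfl)
  have e2 : (⊤ : P'.Opens) ≤ (j ≫ π) ⁻¹ᵁ k.opensRange := by
    rw [← w]; rintro p -; exact ⟨π' p, rfl⟩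
  have e1 : (⊤ : P'.Opens) ≤ (π' ≫ k) ⁻¹ᵁ k.opensRange := by rw [w]; exact e2
  have hcomp : ∀ τ h0 h1 h2, π'.appLE ⊤ ⊤ h0 (k.appLE k.opensRange ⊤ h1 τ) =
      j.appLE (π ⁻¹ᵁ k.opensRange) ⊤ h2 (π.app k.opensRange τ) := by
    intro τ h0 h1 h2
    rw [app_apply_eq_appLE, appLE_appLE_apply π' k _ _ _ _ _ e1,
      appLE_appLE_apply j π _ _ _ _ _ e2]
    exact appLE_congr_apply w _ _ _ _ _
  refine ⟨isAffineOpen_opensRange k, ?_, fun t t' ht => ?_, fun s hs => ?_⟩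
  · rw [hpre]; exact isAffineOpen_opensRange j
  · apply hk.1
    apply hπ'.injective_appLE (U := ⊤) (V := ⊤) rfl
    exact (hcomp t le_top _ e2).trans ((congr_arg _ ht).trans (hcomp t' le_top _ e2).symm)
  · have e3 : (⊤ : P'.Opens) ≤ j ⁻¹ᵁ (π ⁻¹ᵁ k.opensRange) := e2
    obtain ⟨t', ht'⟩ := hπ'.exists_appLE (U := ⊤) (V := ⊤) rfl
      (j.appLE (π ⁻¹ᵁ k.opensRange) ⊤ e3 s) fun g hg => by
        have e4 : (⊤ : P'.Opens) ≤ (j ≫ ρ.hom g) ⁻¹ᵁ (π ⁻¹ᵁ k.opensRange) := fun p hp =>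
          preimage_le_of_hom_π h _ g (e3 hp)
        have e5 : (⊤ : P'.Opens) ≤ (ρ'.hom g ≫ j) ⁻¹ᵁ (π ⁻¹ᵁ k.opensRange) := by
          rw [hj]; exact e4
        rw [appLE_appLE_apply (ρ'.hom g) j _ _ _ _ _ e5, appLE_congr_apply (hj g) _ _ e5 e4,
          ← appLE_appLE_apply j (ρ.hom g) _ _ _ (preimage_le_of_hom_π h _ g) e3, hs]
    obtain ⟨t, rfl⟩ := hk.2 t'
    refine ⟨t, hj'.1 ?_⟩
    exact (hcomp t le_top _ e3).symm.trans ht'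

section Gluing

variable {G : Type} [Group G] {P : Scheme.{0}} (ρ : FiniteAction G P)

/-- The restriction of an action to an invariant open subset. -/
def FiniteAction.restrict (O : P.Opens) (hO : ∀ g, O ≤ ρ.hom g ⁻¹ᵁ O) :
    FiniteAction G O.toScheme where
  hom g := (ρ.hom g).resLE O O (hO g)
  hom_one := by
    rw [← cancel_mono O.ι, Scheme.Hom.resLE_comp_ι, ρ.hom_one]; simp
  hom_mul g h := by
    rw [← cancel_mono O.ι, Scheme.Hom.resLE_comp_ι, Category.assoc, Scheme.Hom.resLE_comp_ι,
      Scheme.Hom.resLE_comp_ι_assoc, ρ.hom_mul]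

/-- Invariant affine open subsets. -/
abbrev FiniteAction.InvariantAffine : Type :=
  {O : P.Opens // IsAffineOpen O ∧ ∀ g, O ≤ ρ.hom g ⁻¹ᵁ O}

namespace FiniteAction

variable {ρ}

/-- The action on an invariant affine open subset. -/
abbrev InvariantAffine.action (O : ρ.InvariantAffine) : FiniteAction G O.1.toScheme :=
  ρ.restrict O.1 O.2.2

instance (O : ρ.InvariantAffine) : IsAffine O.1.toScheme := O.2.1

theorem InvariantAffine.action_hom_ι (O : ρ.InvariantAffine) (g : G) :
    O.action.hom g ≫ O.1.ι = O.1.ι ≫ ρ.hom g := Scheme.Hom.resLE_comp_ι _ _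

theorem InvariantAffine.action_hom_homOfLE {O O' : ρ.InvariantAffine} (h : O ≤ O') (g : G) :
    O.action.hom g ≫ P.homOfLE h = P.homOfLE h ≫ O'.action.hom g := by
  rw [← cancel_mono O'.1.ι, Category.assoc, Category.assoc, Scheme.homOfLE_ι, O.action_hom_ι,
    O'.action_hom_ι, Scheme.homOfLE_ι_assoc]

variable [Finite G]

theorem InvariantAffine.isGeometricQuotient (O : ρ.InvariantAffine) :
    IsGeometricQuotient O.action O.action.toAffineQuotient :=
  O.action.isFiniteQuotient_toAffineQuotient.isGeometricQuotient

instance (O : ρ.InvariantAffine) : Epi O.action.toAffineQuotient := O.isGeometricQuotient.epi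

theorem InvariantAffine.exists_map {O O' : ρ.InvariantAffine} (h : O ≤ O') :
    ∃ m : O.action.affineQuotient ⟶ O'.action.affineQuotient,
      O.action.toAffineQuotient ≫ m = P.homOfLE h ≫ O'.action.toAffineQuotient :=
  O.isGeometricQuotient.exists_desc _ fun g => by
    rw [← Category.assoc, InvariantAffine.action_hom_homOfLE h, Category.assoc,
      hom_toAffineQuotient]

/-- The morphism of affine quotients induced by an inclusion of invariant open subsets. -/
def InvariantAffine.map {O O' : ρ.InvariantAffine} (h : O ≤ O') :
    O.action.affineQuotient ⟶ O'.action.affineQuotient := (exists_map h).choose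

theorem InvariantAffine.π_map {O O' : ρ.InvariantAffine} (h : O ≤ O') :
    O.action.toAffineQuotient ≫ map h = P.homOfLE h ≫ O'.action.toAffineQuotient :=
  (exists_map h).choose_spec

theorem InvariantAffine.π_map_assoc {O O' : ρ.InvariantAffine} (h : O ≤ O') {Z : Scheme.{0}}
    (u : O'.action.affineQuotient ⟶ Z) : O.action.toAffineQuotient ≫ map h ≫ u =
      P.homOfLE h ≫ O'.action.toAffineQuotient ≫ u := by
  rw [← Category.assoc, π_map, Category.assoc]

variable (ρ) in
/-- The diagram of the quotients of the invariant affine open subsets. -/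
def quotientDiagram : ρ.InvariantAffine ⥤ Scheme.{0} where
  obj O := O.action.affineQuotient
  map f := InvariantAffine.map (leOfHom f)
  map_id O := by
    rw [← cancel_epi O.action.toAffineQuotient, InvariantAffine.π_map]; simp
  map_comp {O O' O''} f g := by
    rw [← cancel_epi O.action.toAffineQuotient, InvariantAffine.π_map,
      InvariantAffine.π_map_assoc, InvariantAffine.π_map, Scheme.homOfLE_homOfLE_assoc]

instance {O O' : ρ.InvariantAffine} (f : O ⟶ O') :
    IsOpenImmersion ((quotientDiagram ρ).map f) :=
  O'.isGeometricQuotient.isOpenImmersion O.isGeometricQuotient (P.homOfLE (leOfHom f))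
    (InvariantAffine.action_hom_homOfLE _) _ (InvariantAffine.π_map _)

/-- If points of the quotients of `i` and `j` are identified in the quotient of `k`, some `g` moves
a representative of the first one to a representative of the second one, which therefore lies in the
intersection of `i` and `j`. The intersection is affine as the scheme is separated. -/
instance [P.IsSeparated] : ((quotientDiagram ρ) ⋙ Scheme.forget).IsLocallyDirected where
  cond {i j k} fi fj xi xj h := by
    obtain ⟨pi, rfl⟩ := i.isGeometricQuotient.surjective xi
    obtain ⟨pj, rfl⟩ := j.isGeometricQuotient.surjective xj
    let a : k.1.toScheme := P.homOfLE (leOfHom fi) pi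
    let b : k.1.toScheme := P.homOfLE (leOfHom fj) pj
    have h' : k.action.toAffineQuotient a = k.action.toAffineQuotient b := by
      have e := fun {o : ρ.InvariantAffine} (f : o ⟶ k) (p : o.1.toScheme) =>
        congr_arg (fun u => u p) (InvariantAffine.π_map (leOfHom f))
      exact (e fi pi).symm.trans (Eq.trans h (e fj pj))
    obtain ⟨g, hg⟩ := k.isGeometricQuotient.exists_hom a b h'
    let l : ρ.InvariantAffine := ⟨i.1 ⊓ j.1, i.2.1.inf j.2.1, fun g p hp =>
      ⟨i.2.2 g hp.1, j.2.2 g hp.2⟩⟩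
    have hli : l ≤ i := (inf_le_left : i.1 ⊓ j.1 ≤ i.1)
    have hlj : l ≤ j := (inf_le_right : i.1 ⊓ j.1 ≤ j.1)
    have h1 : ρ.hom g pi.1 = pj.1 := by
      have e1 : k.1.ι (k.action.hom g a) = ρ.hom g (k.1.ι a) :=
        congr_arg (fun u => u a) (k.action_hom_ι g)
      rw [hg] at e1
      have e2 : k.1.ι a = pi.1 := congr_arg (fun u => u pi) (P.homOfLE_ι (leOfHom fi))
      have e3 : k.1.ι b = pj.1 := congr_arg (fun u => u pj) (P.homOfLE_ι (leOfHom fj))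
      rw [← e2, ← e3, e1]
    have hmem : pj.1 ∈ i.1 := by
      rw [← h1]
      exact i.2.2 g pi.2
    let q : l.1.toScheme := ⟨pj.1, hmem, pj.2⟩
    refine ⟨l, homOfLE hli, homOfLE hlj, l.action.toAffineQuotient q, ?_, ?_⟩
    · have e := congr_arg (fun u => u q) (InvariantAffine.π_map hli)
      refine Eq.trans e ?_
      have h2 : P.homOfLE hli q = i.action.hom g pi := by
        apply i.1.ι.isOpenEmbedding.injective
        have e4 : i.1.ι (P.homOfLE hli q) = pj.1 := congr_arg (fun u => u q) (P.homOfLE_ι hli)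
        have e5 : i.1.ι (i.action.hom g pi) = ρ.hom g pi.1 :=
          congr_arg (fun u => u pi) (i.action_hom_ι g)
        rw [e4, e5, h1]
      change i.action.toAffineQuotient (P.homOfLE hli q) = _
      rw [h2]
      exact i.isGeometricQuotient.apply_hom g pi
    · have e := congr_arg (fun u => u q) (InvariantAffine.π_map hlj)
      refine Eq.trans e ?_
      have h2 : P.homOfLE hlj q = pj := by
        apply j.1.ι.isOpenEmbedding.injective
        exact congr_arg (fun u => u q) (P.homOfLE_ι hlj)
      exact congr_arg j.action.toAffineQuotient h2

/-- The pieces of the quotient morphism agree on intersections. -/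
theorem InvariantAffine.toAffineQuotient_ι_eq [P.IsSeparated] {T : Scheme.{0}}
    {O O' : ρ.InvariantAffine} (x : T ⟶ O.1.toScheme) (x' : T ⟶ O'.1.toScheme)
    (h : x ≫ O.1.ι = x' ≫ O'.1.ι) :
    x ≫ O.action.toAffineQuotient ≫ colimit.ι (quotientDiagram ρ) O =
      x' ≫ O'.action.toAffineQuotient ≫ colimit.ι (quotientDiagram ρ) O' := by
  let l : ρ.InvariantAffine := ⟨O.1 ⊓ O'.1, O.2.1.inf O'.2.1, fun g p hp =>
    ⟨O.2.2 g hp.1, O'.2.2 g hp.2⟩⟩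
  have hl : l ≤ O := (inf_le_left : O.1 ⊓ O'.1 ≤ O.1)
  have hl' : l ≤ O' := (inf_le_right : O.1 ⊓ O'.1 ≤ O'.1)
  have hr : Set.range (x ≫ O.1.ι) ⊆ Set.range l.1.ι := by
    rw [Scheme.Opens.range_ι]
    rintro _ ⟨t, rfl⟩
    refine ⟨(x t).2, ?_⟩
    rw [h]
    exact (x' t).2
  let y := IsOpenImmersion.lift l.1.ι (x ≫ O.1.ι) hr
  have hy : y ≫ l.1.ι = x ≫ O.1.ι := IsOpenImmersion.lift_fac _ _ _
  have e1 : x = y ≫ P.homOfLE hl := by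
    rw [← cancel_mono O.1.ι, Category.assoc, P.homOfLE_ι, hy]
  have e2 : x' = y ≫ P.homOfLE hl' := by
    rw [← cancel_mono O'.1.ι, Category.assoc, P.homOfLE_ι, hy, h]
  have e3 : ∀ {o : ρ.InvariantAffine} (hlo : l ≤ o),
      P.homOfLE hlo ≫ o.action.toAffineQuotient ≫ colimit.ι (quotientDiagram ρ) o =
        l.action.toAffineQuotient ≫ colimit.ι (quotientDiagram ρ) l := fun {o} hlo => by
    rw [← colimit.w (quotientDiagram ρ) (homOfLE hlo)]
    exact (InvariantAffine.π_map_assoc hlo _).symm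
  rw [e1, e2, Category.assoc, Category.assoc, e3, e3]

variable (ρ) in
/-- Quotients by finite groups exist for separated schemes in which every point has an invariant
affine open neighbourhood; every invariant affine open subset is the preimage of a chart. -/
theorem exists_isFiniteQuotient [P.IsSeparated] (h : ∀ p, ∃ O : ρ.InvariantAffine, p ∈ O.1) :
    ∃ (Q : Scheme.{0}) (π : P ⟶ Q), IsFiniteQuotient ρ π ∧
      ∀ O : ρ.InvariantAffine, ∃ W, IsInvariantChart ρ π W ∧ π ⁻¹ᵁ W = O.1 := by
  -- the quotient is the colimit of the affine quotients
  let 𝒰 : P.OpenCover := Scheme.openCoverOfIsOpenCover P (fun O : ρ.InvariantAffine => O.1)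
    (top_le_iff.1 fun p _ => TopologicalSpace.Opens.mem_iSup.2 (h p))
  let π : P ⟶ colimit (quotientDiagram ρ) := 𝒰.glueMorphisms
    (fun O : ρ.InvariantAffine =>
      O.action.toAffineQuotient ≫ colimit.ι (quotientDiagram ρ) O)
    fun O O' => InvariantAffine.toAffineQuotient_ι_eq _ _ pullback.condition
  have hπ : ∀ O : ρ.InvariantAffine, O.1.ι ≫ π =
      O.action.toAffineQuotient ≫ colimit.ι (quotientDiagram ρ) O := fun O =>
    𝒰.ι_glueMorphisms _ _ O
  have hinv : ∀ g, ρ.hom g ≫ π = π := fun g => 𝒰.hom_ext _ _ fun O => by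
    let O : ρ.InvariantAffine := O
    change O.1.ι ≫ ρ.hom g ≫ π = O.1.ι ≫ π
    rw [← reassoc_of% InvariantAffine.action_hom_ι, hπ]
    exact (Category.assoc _ _ _).symm.trans
      (congr_arg (· ≫ colimit.ι (quotientDiagram ρ) O) (O.action.hom_toAffineQuotient g))
  have hπ' : ∀ (O : ρ.InvariantAffine) (p : O.1.toScheme), π p.1 =
      colimit.ι (quotientDiagram ρ) O (O.action.toAffineQuotient p) := fun O p =>
    congr_arg (fun u => u p) (hπ O)
  -- `O` is the preimage of the chart given by `O`
  have hr : ∀ (O : ρ.InvariantAffine) (p : P),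
      p ∈ Set.range O.1.ι ↔ π p ∈ Set.range (colimit.ι (quotientDiagram ρ) O) := by
    intro O p
    rw [Scheme.Opens.range_ι]
    constructor
    · intro hp
      exact ⟨_, (hπ' O ⟨p, hp⟩).symm⟩
    · rintro ⟨x, hx⟩
      obtain ⟨o, ho⟩ := O.isGeometricQuotient.surjective x
      subst ho
      obtain ⟨O', hp⟩ := h p
      rw [hπ' O' ⟨p, hp⟩] at hx
      obtain ⟨k, fi, fj, x, h1, h2⟩ := (Scheme.IsLocallyDirected.ι_eq_ι_iff _).1 hx
      obtain ⟨q, rfl⟩ := k.isGeometricQuotient.surjective x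
      have e2 := congr_arg (fun u => u q) (InvariantAffine.π_map (leOfHom fj))
      obtain ⟨g, hg⟩ := O'.isGeometricQuotient.exists_hom
        (P.homOfLE (leOfHom fj) q) ⟨p, hp⟩ (Eq.trans e2.symm h2)
      have e3 : O'.1.ι (O'.action.hom g (P.homOfLE (leOfHom fj) q)) =
          ρ.hom g (O'.1.ι (P.homOfLE (leOfHom fj) q)) :=
        congr_arg (fun u => u (P.homOfLE (leOfHom fj) q)) (O'.action_hom_ι g)
      rw [hg] at e3
      have e4 : O'.1.ι (P.homOfLE (leOfHom fj) q) = q.1 :=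
        congr_arg (fun u => u q) (P.homOfLE_ι (leOfHom fj))
      have e5 : p = ρ.hom g q.1 := Eq.trans e3 (congr_arg (ρ.hom g) e4)
      rw [e5]
      exact O.2.2 g (leOfHom fi q.2)
  have hchart : ∀ O : ρ.InvariantAffine,
      IsInvariantChart ρ π (colimit.ι (quotientDiagram ρ) O).opensRange := fun O => by
    have : IsAffine ((quotientDiagram ρ).obj O) := inferInstanceAs (IsAffine (Spec _))
    exact IsInvariantChart.of_isOpenImmersion (ρ' := O.action) O.1.ι _ _ O.action_hom_ι (hπ O).symm
      (hr O) hinv O.isGeometricQuotient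
  refine ⟨_, π, ⟨hinv, fun q => ?_⟩, fun O => ⟨_, hchart O, ?_⟩⟩
  · obtain ⟨O, x, rfl⟩ := Scheme.IsLocallyDirected.ι_jointly_surjective _ q
    exact ⟨(colimit.ι (quotientDiagram ρ) O).opensRange, ⟨x, rfl⟩, hchart O⟩
  · ext p
    have := hr O p
    rw [Scheme.Opens.range_ι] at this
    exact this.symm

end FiniteAction

end Gluing

/-! ### Quotients by finite groups: base change -/

/-- Rings of invariants commute with base change if the order of the group is invertible: the
average over the group is a projection that is compatible with base change. -/
theorem invariants_baseChange {C A B E : Type} [CommRing C] [CommRing A] [CommRing B] [CommRing E]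
    [Algebra C A] [Algebra C B] [Algebra A E] [Algebra B E] [Algebra C E] [IsScalarTower C A E]
    [IsScalarTower C B E] [h : Algebra.IsPushout C A B E] {G : Type} [Group G] [Fintype G]
    (γ : G → B →+* B) (ε : G → E →+* E) (hγ : ∀ g c, γ g (algebraMap C B c) = algebraMap C B c)
    (hmul : ∀ g g' b, γ (g * g') b = γ g (γ g' b))
    (hε : ∀ g b, ε g (algebraMap B E b) = algebraMap B E (γ g b))
    (hε' : ∀ g a, ε g (algebraMap A E a) = algebraMap A E a) (hu : IsUnit (Fintype.card G : C))
    (hinj : Function.Injective (algebraMap C B))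
    (hinv : ∀ b, (∀ g, γ g b = b) → ∃ c, algebraMap C B c = b) :
    Function.Injective (algebraMap A E) ∧
      ∀ e, (∀ g, ε g e = e) → ∃ a, algebraMap A E a = e := by
  obtain ⟨u, hu⟩ := hu
  have hex : ∀ b, ∃ c, algebraMap C B c = ∑ g, γ g b := fun b => hinv _ fun g => by
    rw [map_sum]
    exact Fintype.sum_equiv (Equiv.mulLeft g) _ _ fun g' => (hmul g g' b).symm
  choose t ht using hex
  -- the sum over the group as a `C`-linear map to the ring of invariants
  let T : B →ₗ[C] C :=
    { toFun := t
      map_add' := fun x y => hinj (by simp only [map_add, ht, Finset.sum_add_distrib])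
      map_smul' := fun c x => hinj (by
        simp only [Algebra.smul_def, map_mul, ht, hγ, Finset.mul_sum, RingHom.id_apply,
          Algebra.algebraMap_self_apply]) }
  have hT : ∀ b, algebraMap C B (T b) = ∑ g, γ g b := ht
  -- its base change
  let R : E →ₗ[A] A := h.out.lift ((Algebra.linearMap C A).comp T)
  have hR : ∀ b, R (algebraMap B E b) = algebraMap C A (T b) := fun b => h.out.lift_eq _ b
  have hT1 : T 1 = Fintype.card G := hinj (by
    rw [hT]; simp)
  have hRA : ∀ a, R (algebraMap A E a) = a * algebraMap C A (u : C) := fun a => by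
    have : algebraMap A E a = a • algebraMap B E 1 := by rw [map_one, Algebra.smul_def, mul_one]
    rw [this, map_smul, hR, hT1, hu, smul_eq_mul]
  have hRE : ∀ e, algebraMap A E (R e) = ∑ g, ε g e := fun e => by
    induction e using h.out.inductionOn with
    | zero => simp
    | tmul b =>
      change algebraMap A E (R (algebraMap B E b)) = ∑ g, ε g (algebraMap B E b)
      rw [hR, ← IsScalarTower.algebraMap_apply, IsScalarTower.algebraMap_apply C B E, hT, map_sum]
      exact Finset.sum_congr rfl fun g _ => (hε g b).symm
    | smul a e he =>
      rw [map_smul, smul_eq_mul, map_mul, he, Finset.mul_sum]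
      exact Finset.sum_congr rfl fun g _ => by rw [Algebra.smul_def, map_mul, hε']
    | add e e' he he' => simp only [map_add, he, he', Finset.sum_add_distrib]
  have hinvu : algebraMap C A (u : C) * algebraMap C A (↑u⁻¹ : C) = 1 := by
    rw [← map_mul, Units.mul_inv, map_one]
  refine ⟨fun a a' haa => ?_, fun e he => ⟨R e * algebraMap C A (↑u⁻¹ : C), ?_⟩⟩
  · have := congr_arg R haa
    rw [hRA, hRA] at this
    have h2 := congr_arg (· * algebraMap C A (↑u⁻¹ : C)) this
    simpa [mul_assoc, hinvu] using h2
  · have h1 : (∑ g : G, ε g e) = algebraMap A E (algebraMap C A (u : C)) * e := by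
      rw [Finset.sum_congr rfl fun g _ => he g, Finset.sum_const, Finset.card_univ, hu]
      simp
    rw [map_mul, hRE, h1, mul_right_comm, ← map_mul, hinvu, map_one, one_mul]

theorem FiniteAction.hom_mul_appTop_apply {G : Type} [Group G] {P : Scheme.{0}}
    (ρ : FiniteAction G P) (g h : G) (s : Γ(P, ⊤)) :
    (ρ.hom (g * h)).appTop s = (ρ.hom g).appTop ((ρ.hom h).appTop s) := by
  rw [ρ.hom_mul]; rfl

/-- The affine case of base change, in which the quotients are given by rings of invariants. -/
theorem IsGeometricQuotient.baseChange_of_isAffine {G : Type} [Group G] [Finite G]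
    {P Q P' Q' : Scheme.{0}} [IsAffine P] [IsAffine Q] [IsAffine Q'] {ρ : FiniteAction G P}
    {π : P ⟶ Q} (hπ : IsGeometricQuotient ρ π) {p : P' ⟶ P} {π' : P' ⟶ Q'} {f : Q' ⟶ Q}
    (h : IsPullback p π' π f) (ρ' : FiniteAction G P') (hp : ∀ g, ρ'.hom g ≫ p = p ≫ ρ.hom g)
    (hπ' : ∀ g, ρ'.hom g ≫ π' = π') (hu : IsUnit (Nat.card G : Γ(Q, ⊤))) :
    IsGeometricQuotient ρ' π' := by
  have : IsAffine P' := by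
    have : IsAffineHom f := inferInstance
    exact IsAffine.of_isPullback h
  cases nonempty_fintype G
  have hpush := isPushout_appTop_of_isPullback h.flip
  let _ : Algebra Γ(Q, ⊤) Γ(P, ⊤) := π.appTop.hom.toAlgebra
  let _ : Algebra Γ(Q, ⊤) Γ(Q', ⊤) := f.appTop.hom.toAlgebra
  let _ : Algebra Γ(P, ⊤) Γ(P', ⊤) := p.appTop.hom.toAlgebra
  let _ : Algebra Γ(Q', ⊤) Γ(P', ⊤) := π'.appTop.hom.toAlgebra
  let _ : Algebra Γ(Q, ⊤) Γ(P', ⊤) := (p ≫ π).appTop.hom.toAlgebra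
  have : IsScalarTower Γ(Q, ⊤) Γ(P, ⊤) Γ(P', ⊤) := .of_algebraMap_eq fun _ => rfl
  have : IsScalarTower Γ(Q, ⊤) Γ(Q', ⊤) Γ(P', ⊤) := .of_algebraMap_eq fun x => by
    change (p ≫ π).appTop x = (π' ≫ f).appTop x
    rw [h.w]
  have : Algebra.IsPushout Γ(Q, ⊤) Γ(Q', ⊤) Γ(P, ⊤) Γ(P', ⊤) :=
    CommRingCat.isPushout_iff_isPushout.1 hpush
  obtain ⟨h1, h2⟩ := invariants_baseChange (fun g => (ρ.hom g).appTop.hom)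
    (fun g => (ρ'.hom g).appTop.hom) (C := Γ(Q, ⊤)) (A := Γ(Q', ⊤)) (B := Γ(P, ⊤)) (E := Γ(P', ⊤))
    (fun g c => by
      change (ρ.hom g ≫ π).appTop c = π.appTop c
      rw [hπ.hom_π])
    (fun g g' b => ρ.hom_mul_appTop_apply g g' b)
    (fun g b => by
      change (ρ'.hom g ≫ p).appTop b = (p ≫ ρ.hom g).appTop b
      rw [hp])
    (fun g c => by
      change (ρ'.hom g ≫ π').appTop c = π'.appTop c
      rw [hπ'])
    (by rwa [Nat.card_eq_fintype_card] at hu)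
    (hπ.app_injective ⊤)
    (fun b hb => hπ.exists_app ⊤ b fun g h =>
      (app_apply_eq_appLE (ρ.hom g) ⊤ b).symm.trans (hb g))
  exact IsFiniteQuotient.isGeometricQuotient ⟨hπ', fun q => ⟨⊤, trivial, isAffineOpen_top _,
    isAffineOpen_top _, h1, fun s hs => h2 s fun g =>
      (app_apply_eq_appLE (ρ'.hom g) ⊤ s).trans (hs g le_top)⟩⟩

theorem isUnit_natCast_of_hom {Q : Scheme.{0}} (f : Q ⟶ SpecC) {n : ℕ} (hn : n ≠ 0) :
    IsUnit (n : Γ(Q, ⊤)) := by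
  let r : ℂ →+* Γ(Q, ⊤) := ((Scheme.ΓSpecIso (.of ℂ)).inv ≫ f.appTop).hom
  have : (n : Γ(Q, ⊤)) = r n := (map_natCast r n).symm
  rw [this]
  exact ((Nat.cast_ne_zero (R := ℂ)).2 hn).isUnit.map r

theorem FiniteAction.restrict_hom_ι {G : Type} [Group G] {P : Scheme.{0}} (ρ : FiniteAction G P)
    (O : P.Opens) (hO : ∀ g, O ≤ ρ.hom g ⁻¹ᵁ O) (g : G) :
    (ρ.restrict O hO).hom g ≫ O.ι = O.ι ≫ ρ.hom g := Scheme.Hom.resLE_comp_ι _ _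

/-- Over `ℂ`, quotients by finite groups are stable under base change. -/
theorem IsFiniteQuotient.baseChange {G : Type} [Group G] [Finite G] {P Q P' Q' : Scheme.{0}}
    {ρ : FiniteAction G P} {π : P ⟶ Q} (hπ : IsFiniteQuotient ρ π) {p : P' ⟶ P} {π' : P' ⟶ Q'}
    {f : Q' ⟶ Q} (h : IsPullback p π' π f) (ρ' : FiniteAction G P')
    (hp : ∀ g, ρ'.hom g ≫ p = p ≫ ρ.hom g) (hπ' : ∀ g, ρ'.hom g ≫ π' = π') (s : Q ⟶ SpecC) :
    IsFiniteQuotient ρ' π' := by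
  refine ⟨hπ', fun q => ?_⟩
  obtain ⟨W, hqW, hW⟩ := hπ.exists_chart (f q)
  obtain ⟨V, hV, hqV, hVW⟩ := exists_isAffineOpen_mem_and_subset (X := Q') (x := q)
    (U := f ⁻¹ᵁ W) hqW
  refine ⟨V, hqV, ?_⟩
  have hO : π' ⁻¹ᵁ V = p ⁻¹ᵁ (π ⁻¹ᵁ W) ⊓ π' ⁻¹ᵁ V := by
    refine le_antisymm (le_inf (fun x hx => ?_) le_rfl) inf_le_right
    have h1 : f (π' x) ∈ W := hVW hx
    have h2 : π (p x) = f (π' x) := congr_arg (fun u => u x) h.w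
    change π (p x) ∈ W
    rwa [h2]
  have hres := Scheme.Hom.isPullback_resLE h hVW (UX := π ⁻¹ᵁ W) le_rfl hO
  let ρW := ρ.restrict (π ⁻¹ᵁ W) (preimage_le_of_hom_π hπ.hom_π W)
  let ρV := ρ'.restrict (π' ⁻¹ᵁ V) (preimage_le_of_hom_π hπ' V)
  have : IsAffine (π ⁻¹ᵁ W).toScheme := hW.isAffineOpen_preimage
  have : IsAffine W.toScheme := hW.isAffineOpen
  have : IsAffine V.toScheme := hV
  have hπW : IsGeometricQuotient ρW (π.resLE W (π ⁻¹ᵁ W) le_rfl) :=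
    hπ.isGeometricQuotient.of_isOpenImmersion ρW (π ⁻¹ᵁ W).ι W.ι _ (ρ.restrict_hom_ι _ _)
      (Scheme.Hom.resLE_comp_ι _ _) fun x => by
        rw [Scheme.Opens.range_ι, Scheme.Opens.range_ι]; rfl
  have key := hπW.baseChange_of_isAffine hres ρV (fun g => by
      rw [← cancel_mono (π ⁻¹ᵁ W).ι, Category.assoc, Category.assoc, Scheme.Hom.resLE_comp_ι,
        ρ.restrict_hom_ι, Scheme.Hom.resLE_comp_ι_assoc,
        ← Category.assoc, ρ'.restrict_hom_ι, Category.assoc, hp])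
    (fun g => by
      rw [← cancel_mono V.ι, Category.assoc, Scheme.Hom.resLE_comp_ι, ← Category.assoc,
        ρ'.restrict_hom_ι, Category.assoc, hπ'])
    (isUnit_natCast_of_hom (W.ι ≫ s) Nat.card_pos.ne')
  have : IsAffine (π' ⁻¹ᵁ V).toScheme := by
    exact IsAffine.of_isPullback hres
  have := IsInvariantChart.of_isOpenImmersion (π' ⁻¹ᵁ V).ι V.ι _ (ρ'.restrict_hom_ι _ _)
    (Scheme.Hom.resLE_comp_ι _ _) (fun x => by
        rw [Scheme.Opens.range_ι, Scheme.Opens.range_ι]; rfl) hπ' key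
  rwa [Scheme.Opens.opensRange_ι] at this

/-- Quotients by finite groups can be transported along isomorphisms of the target. -/
theorem IsFiniteQuotient.comp_iso {G : Type} [Group G] {P Q Q' : Scheme.{0}}
    {ρ : FiniteAction G P} {π : P ⟶ Q} (hπ : IsFiniteQuotient ρ π) (m : Q ⟶ Q') [IsIso m]
    {π' : P ⟶ Q'} (hm : π ≫ m = π') : IsFiniteQuotient ρ π' := by
  subst hm
  refine ⟨fun g => by rw [← Category.assoc, hπ.hom_π], fun q => ?_⟩
  obtain ⟨W, hq, hW⟩ := hπ.exists_chart (inv m q)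
  refine ⟨inv m ⁻¹ᵁ W, hq, ?_⟩
  have h1 : π ⁻¹ᵁ W = (π ≫ m) ⁻¹ᵁ (inv m ⁻¹ᵁ W) := by
    change _ = ((π ≫ m) ≫ inv m) ⁻¹ᵁ W
    rw [Category.assoc, IsIso.hom_inv_id, Category.comp_id]
  have h2 : ∀ t, (π ≫ m).appLE (inv m ⁻¹ᵁ W) (π ⁻¹ᵁ W) h1.le ((inv m).app W t) = π.app W t :=
    fun t => by
    have e : π ⁻¹ᵁ W ≤ ((π ≫ m) ≫ inv m) ⁻¹ᵁ W := by
      rw [Category.assoc, IsIso.hom_inv_id, Category.comp_id]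
    rw [app_apply_eq_appLE, app_apply_eq_appLE,
      appLE_appLE_apply (π ≫ m) (inv m) W _ _ le_rfl h1.le e]
    exact appLE_congr_apply (by simp) W _ e le_rfl t
  have hb := ConcreteCategory.bijective_of_isIso ((inv m).app W)
  have key : Function.Injective ((π ≫ m).appLE (inv m ⁻¹ᵁ W) (π ⁻¹ᵁ W) h1.le) ∧
      ∀ s : Γ(P, π ⁻¹ᵁ W), (∀ (g : G) (h : π ⁻¹ᵁ W ≤ ρ.hom g ⁻¹ᵁ (π ⁻¹ᵁ W)),
        (ρ.hom g).appLE (π ⁻¹ᵁ W) (π ⁻¹ᵁ W) h s = s) →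
        ∃ t, (π ≫ m).appLE (inv m ⁻¹ᵁ W) (π ⁻¹ᵁ W) h1.le t = s := by
    refine ⟨fun t t' h => ?_, fun s hs => ?_⟩
    · obtain ⟨τ, rfl⟩ := hb.2 t
      obtain ⟨τ', rfl⟩ := hb.2 t'
      rw [h2, h2] at h
      rw [hW.injective h]
    · obtain ⟨t, ht⟩ := hW.exists_app s hs
      exact ⟨_, (h2 t).trans ht⟩
  have hO := hW.isAffineOpen_preimage
  clear h2
  generalize π ⁻¹ᵁ W = O at h1 key hO
  subst h1
  simp only [Scheme.Hom.appLE_eq_app] at key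
  exact ⟨hW.isAffineOpen.preimage _, hO, key.1, key.2⟩

/-! ### Quotients of admissible schemes by finite groups -/

/-- The induced action on the underlying scheme. -/
def FiniteAction.sch {G : Type} [Group G] {P : SchC} (ρ : FiniteAction G P) :
    FiniteAction G P.scheme where
  hom g := MotivicTheories.sch (ρ.hom g)
  hom_one := by rw [ρ.hom_one]; rfl
  hom_mul g h := by rw [ρ.hom_mul]; rfl

/-- The morphism `π` of admissible schemes is a quotient by a finite group. -/
abbrev IsQuotient {G : Type} [Group G] {P Q : SchC} (ρ : FiniteAction G P) (π : P ⟶ Q) : Prop :=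
  IsFiniteQuotient ρ.sch (sch π)

theorem mem_iInf_opens {X : Type*} [TopologicalSpace X] {ι : Type*} [Finite ι]
    {U : ι → TopologicalSpace.Opens X} {x : X} : x ∈ ⨅ i, U i ↔ ∀ i, x ∈ U i := by
  refine ⟨fun h i => iInf_le U i h, fun h => ?_⟩
  have : (⟨⋂ i, U i, isOpen_iInter_of_finite fun i => (U i).isOpen⟩ : TopologicalSpace.Opens X) ≤
      ⨅ i, U i := le_iInf fun i y hy => Set.mem_iInter.1 hy i
  exact this (Set.mem_iInter.2 h)

section

variable {G : Type} [Group G] [Finite G]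

/-- Every finite set of points lies in an invariant affine open subset. -/
theorem FiniteAction.exists_invariantAffine {P : SchC} (ρ : FiniteAction G P) (s : Set P.scheme)
    (hs : s.Finite) : ∃ O : ρ.sch.InvariantAffine, s ⊆ O.1 := by
  obtain ⟨U, hU, hsU⟩ := P.property.exists_affine (⋃ g, ρ.sch.hom g '' s)
    (Set.finite_iUnion fun g => hs.image _)
  have : ∀ g, IsIso (ρ.sch.hom g) := fun g =>
    ⟨ρ.sch.hom g⁻¹, by rw [← ρ.sch.hom_mul, mul_inv_cancel, ρ.sch.hom_one],
      by rw [← ρ.sch.hom_mul, inv_mul_cancel, ρ.sch.hom_one]⟩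
  refine ⟨⟨⨅ g, ρ.sch.hom g ⁻¹ᵁ U, IsAffineOpen.iInf fun g => hU.preimage _, fun g p hp => ?_⟩,
    fun p hp => ?_⟩
  · have h1 := mem_iInf_opens.1 hp
    refine mem_iInf_opens.2 fun g' => ?_
    have := h1 (g * g')
    rw [ρ.sch.hom_mul] at this
    exact this
  · exact mem_iInf_opens.2 fun g => hsU (Set.mem_iUnion.2 ⟨g, p, hp, rfl⟩)

/-- The ring of functions on a chart of the quotient is finitely generated (Artin–Tate). -/
theorem IsInvariantChart.finiteType_appLE {P Q : Scheme.{0}} {ρ : FiniteAction G P} {π : P ⟶ Q}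
    {W : Q.Opens} (hW : IsInvariantChart ρ π W) (h : ∀ g, ρ.hom g ≫ π = π) (s : Q ⟶ SpecC)
    (hs : LocallyOfFiniteType (π ≫ s)) : (s.appLE ⊤ W le_top).hom.FiniteType := by
  have hft : ((π ≫ s).appLE ⊤ (π ⁻¹ᵁ W) le_top).hom.FiniteType :=
    HasRingHomProperty.appLE @LocallyOfFiniteType (π ≫ s) hs ⟨⊤, isAffineOpen_top _⟩
      ⟨_, hW.isAffineOpen_preimage⟩ le_top
  let A := Γ(SpecC, ⊤)
  let _ : Algebra A Γ(Q, W) := (s.appLE ⊤ W le_top).hom.toAlgebra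
  let _ : Algebra Γ(Q, W) Γ(P, π ⁻¹ᵁ W) := (π.app W).hom.toAlgebra
  let _ : Algebra A Γ(P, π ⁻¹ᵁ W) := ((π ≫ s).appLE ⊤ (π ⁻¹ᵁ W) le_top).hom.toAlgebra
  have : IsScalarTower A Γ(Q, W) Γ(P, π ⁻¹ᵁ W) := .of_algebraMap_eq fun a => by
    change (π ≫ s).appLE ⊤ (π ⁻¹ᵁ W) le_top a = π.app W (s.appLE ⊤ W le_top a)
    rw [app_apply_eq_appLE]
    exact (appLE_appLE_apply π s ⊤ W _ le_top le_rfl le_top a).symm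
  have : IsNoetherianRing A := by
    have : IsNoetherianRing ((CommRingCat.of ℂ : CommRingCat.{0}) : Type) :=
      inferInstanceAs (IsNoetherianRing ℂ)
    exact isNoetherianRing_of_ringEquiv _
      (Scheme.ΓSpecIso (CommRingCat.of ℂ)).symm.commRingCatIsoToRingEquiv
  have hft' : Algebra.FiniteType A Γ(P, π ⁻¹ᵁ W) := hft
  have : Algebra.IsIntegral Γ(Q, W) Γ(P, π ⁻¹ᵁ W) := ⟨hW.isIntegral h⟩
  have : Algebra.FiniteType Γ(Q, W) Γ(P, π ⁻¹ᵁ W) := .of_restrictScalars_finiteType A _ _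
  have : Module.Finite Γ(Q, W) Γ(P, π ⁻¹ᵁ W) := Algebra.IsIntegral.finite
  exact ⟨fg_of_fg_of_fg A Γ(Q, W) Γ(P, π ⁻¹ᵁ W) hft'.1 this.1 hW.injective⟩

/-- The quotient of an admissible scheme by a finite group exists and is admissible. Every invariant
affine open subset is the preimage of a chart. -/
theorem FiniteAction.exists_isQuotient {P : SchC} (ρ : FiniteAction G P) :
    ∃ (Q : SchC) (π : P ⟶ Q), IsQuotient ρ π ∧
      ∀ O : ρ.sch.InvariantAffine, ∃ W, IsInvariantChart ρ.sch (MotivicTheories.sch π) W ∧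
        MotivicTheories.sch π ⁻¹ᵁ W = O.1 := by
  obtain ⟨Q, π, hπ, hO⟩ := ρ.sch.exists_isFiniteQuotient fun p => by
    obtain ⟨O, hO⟩ := ρ.exists_invariantAffine {p} (Set.finite_singleton p)
    exact ⟨O, hO rfl⟩
  have hg := hπ.isGeometricQuotient
  obtain ⟨s, hs⟩ := hg.exists_desc P.obj.hom fun g => sch_w (ρ.hom g)
  have hs' : LocallyOfFiniteType (π ≫ s) := by rw [hs]; infer_instance
  have hloc : LocallyOfFiniteType s := by
    choose W hqW hW using hπ.exists_chart
    exact HasRingHomProperty.of_iSup_eq_top (P := @LocallyOfFiniteType)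
      (fun q => ⟨W q, (hW q).isAffineOpen⟩)
      (top_le_iff.1 fun q _ => TopologicalSpace.Opens.mem_iSup.2 ⟨q, hqW q⟩)
      fun q => (hW q).finiteType_appLE hπ.hom_π s hs'
  have hadm : IsAdmissible (Over.mk s) := by
    refine ⟨hloc, fun q => ?_, fun t ht => ?_⟩
    · change IsCompact (connectedComponent (α := Q) q)
      obtain ⟨p, rfl⟩ := hπ.surjective q
      have hK : IsCompact (π '' connectedComponent p) :=
        (P.property.isCompact_connectedComponent p).image π.continuous
      -- the image of a connected component is open and closed
      refine hK.of_isClosed_subset isClosed_connectedComponent ?_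
      -- its preimage consists of the translates of a connected component
      have hopen : IsOpen (π '' connectedComponent p) := by
        rw [← hg.isQuotientMap.isOpen_preimage]
        have : π ⁻¹' (π '' connectedComponent p) =
            ⋃ g, (ρ.sch.hom g) ⁻¹' connectedComponent p := by
          ext x
          simp only [Set.mem_preimage, Set.mem_image, Set.mem_iUnion]
          constructor
          · rintro ⟨y, hy, hxy⟩
            obtain ⟨g, hg⟩ := hg.exists_hom x y hxy.symm
            exact ⟨g, hg ▸ hy⟩
          · rintro ⟨g, hg'⟩
            exact ⟨_, hg', hg.apply_hom g x⟩
        rw [this]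
        exact isOpen_iUnion fun g =>
          (isOpen_connectedComponent_of_locallyNoetherian P.scheme p).preimage
            (ρ.sch.hom g).continuous
      have hclosed : IsClosed (π '' connectedComponent p) := by
        have := hπ.isIntegralHom
        exact π.isClosedMap _ isClosed_connectedComponent
      exact (show IsClopen _ from ⟨hclosed, hopen⟩).connectedComponent_subset
        ⟨p, mem_connectedComponent, rfl⟩
    -- lifting a finite set of points to `P`, where it lies in an invariant affine open subset
    · let t' : Set Q := t
      obtain ⟨r, hr, hrt⟩ : ∃ r : Set P.scheme, r.Finite ∧ π '' r = t' :=
        ⟨(Function.surjInv hπ.surjective) '' t', Set.Finite.image _ ht, by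
          rw [← Set.image_comp]
          have : π ∘ Function.surjInv hπ.surjective = id :=
            funext (Function.surjInv_eq hπ.surjective)
          rw [this, Set.image_id]⟩
      obtain ⟨O, hrO⟩ := ρ.exists_invariantAffine r hr
      obtain ⟨W, hW, hWO⟩ := hO O
      refine ⟨W, hW.isAffineOpen, ?_⟩
      change t' ⊆ W
      rw [← hrt]
      rintro _ ⟨p, hp, rfl⟩
      have : p ∈ π ⁻¹ᵁ W := by rw [hWO]; exact hrO hp
      exact this
  let Q' : SchC := ⟨Over.mk s, hadm⟩
  exact ⟨Q', SchC.homMk (Y := Q') π hs, hπ, hO⟩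

variable {P Q : SchC} {ρ : FiniteAction G P} {π : P ⟶ Q}

theorem epi_of_epi_sch {X Y : SchC} (u : X ⟶ Y) (h : Epi (sch u)) : Epi u :=
  ⟨fun v w hvw => sch_injective (by
    rw [← cancel_epi (sch u)]
    exact congr_arg sch hvw)⟩

theorem IsFiniteQuotient.epi_of_sch (hπ : IsQuotient ρ π) : Epi π :=
  epi_of_epi_sch π hπ.isGeometricQuotient.epi

theorem IsFiniteQuotient.exists_desc_of_sch (hπ : IsQuotient ρ π) {Z : SchC} (f : P ⟶ Z)
    (hf : ∀ g, ρ.hom g ≫ f = f) : ∃ m : Q ⟶ Z, π ≫ m = f := by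
  obtain ⟨m, hm⟩ := hπ.isGeometricQuotient.exists_desc (sch f) fun g => congr_arg sch (hf g)
  refine ⟨SchC.homMk m ?_, sch_injective hm⟩
  have := hπ.isGeometricQuotient.epi
  rw [← cancel_epi (sch π), reassoc_of% hm, sch_w, sch_w]

/-- A geometric quotient of an admissible scheme is the constructed one. -/
theorem IsGeometricQuotient.isFiniteQuotient (hπ : IsGeometricQuotient ρ.sch (sch π)) :
    IsQuotient ρ π := by
  obtain ⟨Q', π', hπ', -⟩ := ρ.exists_isQuotient
  obtain ⟨m, hm⟩ := hπ'.isGeometricQuotient.exists_desc (sch π) hπ.hom_π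
  have := hπ'.isGeometricQuotient.isIso hπ m hm
  exact hπ'.comp_iso m hm

/-- The quotient of an affine scheme is affine, as the whole scheme is the preimage of a chart. -/
theorem IsFiniteQuotient.isAffine (hπ : IsQuotient ρ π) [IsAffine P.scheme] :
    IsAffine Q.scheme := by
  obtain ⟨Q', π', hπ', h⟩ := ρ.exists_isQuotient
  obtain ⟨m, hm⟩ := hπ'.isGeometricQuotient.exists_desc (sch π) hπ.hom_π
  have := hπ'.isGeometricQuotient.isIso hπ.isGeometricQuotient m hm
  obtain ⟨W, hW, hWO⟩ := h ⟨⊤, isAffineOpen_top _, fun _ => le_top⟩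
  have : W = ⊤ := top_le_iff.1 fun q _ => by
    obtain ⟨p, rfl⟩ := hπ'.surjective q
    have : p ∈ sch π' ⁻¹ᵁ W := by rw [hWO]; trivial
    exact this
  have h1 : IsAffineOpen (⊤ : Q'.scheme.Opens) := this ▸ hW.isAffineOpen
  have : IsAffine (⊤ : Q'.scheme.Opens).toScheme := h1
  have : IsAffine Q'.scheme := .of_isIso (Scheme.topIso Q'.scheme).inv
  exact .of_isIso (inv m)

theorem IsFiniteQuotient.isFiniteType (hπ : IsQuotient ρ π) : IsFiniteType π := by
  have := hπ.isIntegralHom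
  exact ⟨locallyOfFiniteType_sch _, inferInstance⟩

/-- The product of an action with a fixed factor on the left. -/
def FiniteAction.whiskerLeft (ρ : FiniteAction G P) (Y : SchC) : FiniteAction G (Y ⊗ P) where
  hom g := Y ◁ ρ.hom g
  hom_one := by rw [ρ.hom_one, MonoidalCategory.whiskerLeft_id]
  hom_mul g h := by rw [ρ.hom_mul, MonoidalCategory.whiskerLeft_comp]

/-- The product of an action with a fixed factor on the right. -/
def FiniteAction.whiskerRight (ρ : FiniteAction G P) (Y : SchC) : FiniteAction G (P ⊗ Y) where
  hom g := ρ.hom g ▷ Y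
  hom_one := by rw [ρ.hom_one, MonoidalCategory.id_whiskerRight]
  hom_mul g h := by rw [ρ.hom_mul, MonoidalCategory.comp_whiskerRight]

end

theorem isPullback_snd_whiskerLeft {A B : SchC} (Y : SchC) (u : A ⟶ B) :
    IsPullback (snd Y A) (Y ◁ u) u (snd Y B) := by
  refine isPullback_of_points (by simp) (fun {T} a b h => ⟨lift (b ≫ fst _ _) a, by simp, ?_⟩)
    fun {T} l m h1 h2 => ?_
  · apply CartesianMonoidalCategory.hom_ext <;> simp [h]
  · have h3 := congr_arg (· ≫ fst _ _) h2
    simp only [Category.assoc, whiskerLeft_fst] at h3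
    exact CartesianMonoidalCategory.hom_ext _ _ h3 h1

theorem isPullback_fst_whiskerRight {A B : SchC} (u : A ⟶ B) (Y : SchC) :
    IsPullback (fst A Y) (u ▷ Y) u (fst B Y) := by
  refine isPullback_of_points (by simp) (fun {T} a b h => ⟨lift a (b ≫ snd _ _), by simp, ?_⟩)
    fun {T} l m h1 h2 => ?_
  · apply CartesianMonoidalCategory.hom_ext <;> simp [h]
  · have h3 := congr_arg (· ≫ snd _ _) h2
    simp only [Category.assoc, whiskerRight_snd] at h3
    exact CartesianMonoidalCategory.hom_ext _ _ h1 h3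

theorem IsFiniteQuotient.hom_π_of_sch {G : Type} [Group G] {P Q : SchC} {ρ : FiniteAction G P}
    {π : P ⟶ Q} (hπ : IsQuotient ρ π) (g : G) : ρ.hom g ≫ π = π :=
  sch_injective (hπ.hom_π g)

section

variable {G : Type} [Group G] [Finite G] {P Q : SchC} {ρ : FiniteAction G P} {π : P ⟶ Q}

theorem IsFiniteQuotient.whiskerLeft (hπ : IsQuotient ρ π) (Y : SchC) :
    IsQuotient (ρ.whiskerLeft Y) (Y ◁ π) :=
  hπ.baseChange (isPullback_snd_whiskerLeft Y π).sch _
    (fun g => congr_arg sch (show Y ◁ ρ.hom g ≫ snd Y P = snd Y P ≫ ρ.hom g by simp))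
    (fun g => congr_arg sch (show Y ◁ ρ.hom g ≫ Y ◁ π = _ by
      rw [← MonoidalCategory.whiskerLeft_comp, hπ.hom_π_of_sch])) Q.obj.hom

theorem IsFiniteQuotient.whiskerRight (hπ : IsQuotient ρ π) (Y : SchC) :
    IsQuotient (ρ.whiskerRight Y) (π ▷ Y) :=
  hπ.baseChange (isPullback_fst_whiskerRight π Y).sch _
    (fun g => congr_arg sch (show ρ.hom g ▷ Y ≫ fst P Y = fst P Y ≫ ρ.hom g by simp))
    (fun g => congr_arg sch (show ρ.hom g ▷ Y ≫ π ▷ Y = _ by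
      rw [← MonoidalCategory.comp_whiskerRight, hπ.hom_π_of_sch])) Q.obj.hom

end

/-! ### Symmetric powers -/

@[simp]
theorem permute_proj (X : SchC) {n : ℕ} (e : Equiv.Perm (Fin n)) (i : Fin n) :
    permute X e ≫ proj X i = proj X (e i) := by
  simp [permute, proj]

theorem power_hom_ext {T X : SchC} {n : ℕ} {u v : T ⟶ power X n}
    (h : ∀ i, u ≫ proj X i = v ≫ proj X i) : u = v :=
  Pi.hom_ext _ _ h

/-- The action of the symmetric group on `Xⁿ`. -/
def permAction (X : SchC) (n : ℕ) : FiniteAction (Equiv.Perm (Fin n)) (power X n) where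
  hom e := permute X e
  hom_one := power_hom_ext fun i => by simp
  hom_mul e e' := power_hom_ext fun i => by
    rw [Category.assoc, permute_proj, permute_proj, permute_proj]; rfl

namespace SymPower

variable {X : SchC} {n : ℕ}

theorem isGeometricQuotient (S : SymPower X n) :
    IsGeometricQuotient (permAction X n).sch (sch S.π) where
  hom_π e := congr_arg sch (S.permute_π e)
  isQuotientMap := S.isQuotientMap
  exists_hom := S.exists_permute
  app_injective := S.app_injective
  exists_app := S.exists_app

theorem isQuotient (S : SymPower X n) : IsQuotient (permAction X n) S.π :=
  S.isGeometricQuotient.isFiniteQuotient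

theorem nonempty (X : SchC) (n : ℕ) : Nonempty (SymPower X n) := by
  obtain ⟨Q, π, hπ, -⟩ := (permAction X n).exists_isQuotient
  have hg := hπ.isGeometricQuotient
  exact ⟨⟨Q, π, fun e => sch_injective (hg.hom_π e), hg.isQuotientMap, hg.exists_hom,
    hg.app_injective, hg.exists_app⟩⟩

end SymPower

/-- A chosen symmetric power. -/
def symPower (X : SchC) (n : ℕ) : SymPower X n := (SymPower.nonempty X n).some

/-! ### Products and powers -/

instance isAffine_tensor (X Y : SchC) [IsAffine X.scheme] [IsAffine Y.scheme] :
    IsAffine (X ⊗ Y).scheme :=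
  inferInstanceAs (IsAffine (pullback X.obj.hom Y.obj.hom))

instance : IsAffine (𝟙_ SchC).scheme := inferInstanceAs (IsAffine SpecC)

theorem sch_tensorHom {X Y X' Y' : SchC} (u : X ⟶ X') (v : Y ⟶ Y') :
    sch (u ⊗ₘ v) = pullback.map X.obj.hom Y.obj.hom X'.obj.hom Y'.obj.hom (sch u) (sch v)
      (𝟙 _) ((Category.comp_id _).trans (sch_w u).symm)
      ((Category.comp_id _).trans (sch_w v).symm) :=
  rfl

theorem isOpenImmersion_tensorHom {X Y X' Y' : SchC} {u : X ⟶ X'} {v : Y ⟶ Y'}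
    (hu : IsOpenImmersion (sch u)) (hv : IsOpenImmersion (sch v)) :
    IsOpenImmersion (sch (u ⊗ₘ v)) := by
  rw [sch_tensorHom]
  exact MorphismProperty.pullbackMap (P := @IsOpenImmersion) hu hv (sch_w u).symm (sch_w v).symm

theorem mem_range_tensorHom {X Y X' Y' : SchC} (u : X ⟶ X') (v : Y ⟶ Y')
    (z : (X' ⊗ Y').scheme) : z ∈ Set.range (sch (u ⊗ₘ v)) ↔
      sch (fst X' Y') z ∈ Set.range (sch u) ∧ sch (snd X' Y') z ∈ Set.range (sch v) := by
  have h := Scheme.Pullback.range_map X.obj.hom Y.obj.hom X'.obj.hom Y'.obj.hom (sch u) (sch v)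
    (𝟙 _) ((Category.comp_id _).trans (sch_w u).symm) ((Category.comp_id _).trans (sch_w v).symm)
  rw [sch_tensorHom]
  exact Set.ext_iff.1 h z

theorem surjective_tensorHom {X Y X' Y' : SchC} {u : X ⟶ X'} {v : Y ⟶ Y'}
    (hu : Function.Surjective (sch u)) (hv : Function.Surjective (sch v)) :
    Function.Surjective (sch (u ⊗ₘ v)) := fun z =>
  (mem_range_tensorHom u v z).2 ⟨hu _, hv _⟩

theorem sch_surjective_of_isIso {X Y : SchC} (u : X ⟶ Y) [IsIso u] :
    Function.Surjective (sch u) := fun y => ⟨sch (inv u) y, by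
  rw [← Scheme.Hom.comp_apply, ← sch_comp, IsIso.inv_hom_id]; rfl⟩

/-- The first coordinate and the remaining ones. -/
def powerSucc (X : SchC) (n : ℕ) : power X (n + 1) ⟶ X ⊗ power X n :=
  lift (proj X 0) (Pi.lift fun i => proj X i.succ)

instance (X : SchC) (n : ℕ) : IsIso (powerSucc X n) := by
  refine ⟨Pi.lift fun i => Fin.cases (motive := fun _ => (X ⊗ power X n ⟶ X)) (fst _ _)
    (fun j => snd _ _ ≫ proj X j) i, ?_, ?_⟩
  · refine power_hom_ext fun i => ?_
    refine Fin.cases ?_ (fun j => ?_) i <;> simp [powerSucc]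
  · refine CartesianMonoidalCategory.hom_ext _ _ ?_ (power_hom_ext fun i => ?_) <;>
      simp [powerSucc]

theorem powerMap_powerSucc {X Y : SchC} (u : X ⟶ Y) (n : ℕ) :
    powerMap u (n + 1) ≫ powerSucc Y n = powerSucc X n ≫ (u ⊗ₘ powerMap u n) := by
  refine CartesianMonoidalCategory.hom_ext _ _ ?_ (power_hom_ext fun i => ?_) <;>
    simp [powerSucc]

theorem isIso_powerMap_zero {X Y : SchC} (u : X ⟶ Y) : IsIso (powerMap u 0) :=
  ⟨Pi.lift fun i => i.elim0, power_hom_ext fun i => i.elim0, power_hom_ext fun i => i.elim0⟩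

theorem powerMap_succ {X Y : SchC} (u : X ⟶ Y) (n : ℕ) :
    powerMap u (n + 1) = powerSucc X n ≫ (u ⊗ₘ powerMap u n) ≫ inv (powerSucc Y n) := by
  rw [← Category.assoc, ← powerMap_powerSucc, Category.assoc, IsIso.hom_inv_id, Category.comp_id]

theorem IsFiniteType.powerMap {X Y : SchC} {u : X ⟶ Y} (hu : IsFiniteType u) :
    ∀ n, IsFiniteType (powerMap u n)
  | 0 => have := isIso_powerMap_zero u; .of_isIso _
  | n + 1 => by
    rw [powerMap_succ]
    exact (IsFiniteType.of_isIso _).comp ((hu.tensorHom (hu.powerMap n)).comp (.of_isIso _))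

theorem isOpenImmersion_powerMap {X Y : SchC} {u : X ⟶ Y} (hu : IsOpenImmersion (sch u)) :
    ∀ n, IsOpenImmersion (sch (powerMap u n))
  | 0 => have := isIso_powerMap_zero u; inferInstance
  | n + 1 => by
    have := isOpenImmersion_tensorHom hu (isOpenImmersion_powerMap hu n)
    rw [powerMap_succ, sch_comp, sch_comp]
    infer_instance

theorem isAffine_of_isIso {X Y : SchC} (u : X ⟶ Y) [IsIso u] [IsAffine Y.scheme] :
    IsAffine X.scheme := .of_isIso (sch u)

instance isAffine_power (X : SchC) [IsAffine X.scheme] : ∀ n, IsAffine (power X n).scheme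
  | 0 =>
    have : IsIso (toUnit (power X 0)) :=
      ⟨Pi.lift fun i => i.elim0, power_hom_ext fun i => i.elim0, toUnit_unique _ _⟩
    isAffine_of_isIso (toUnit (power X 0))
  | n + 1 =>
    have := isAffine_power X n
    isAffine_of_isIso (powerSucc X n)

theorem sch_comp_apply {X Y Z : SchC} (u : X ⟶ Y) (v : Y ⟶ Z) (x : X.scheme) :
    sch (u ≫ v) x = sch v (sch u x) := rfl

theorem mem_range_powerMap {X Y : SchC} (u : X ⟶ Y) : ∀ (n : ℕ) (z : (power Y n).scheme),
    z ∈ Set.range (sch (powerMap u n)) ↔ ∀ i, sch (proj Y i) z ∈ Set.range (sch u)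
  | 0, z => by
    have := isIso_powerMap_zero u
    exact ⟨fun _ i => i.elim0, fun _ => sch_surjective_of_isIso _ z⟩
  | n + 1, z => by
    have h1 : z ∈ Set.range (sch (powerMap u (n + 1))) ↔
        sch (powerSucc Y n) z ∈ Set.range (sch (u ⊗ₘ powerMap u n)) := by
      constructor
      · rintro ⟨x, rfl⟩
        refine ⟨sch (powerSucc X n) x, ?_⟩
        rw [← sch_comp_apply, ← sch_comp_apply, powerMap_powerSucc]
      · rintro ⟨y, hy⟩
        obtain ⟨x, rfl⟩ := sch_surjective_of_isIso (powerSucc X n) y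
        refine ⟨x, ?_⟩
        have h2 := congr_arg (sch (inv (powerSucc Y n))) hy
        rw [← sch_comp_apply, ← sch_comp_apply, ← powerMap_succ] at h2
        refine h2.trans ?_
        rw [← sch_comp_apply, IsIso.hom_inv_id]
        rfl
    rw [h1, mem_range_tensorHom, mem_range_powerMap u n, Fin.forall_fin_succ,
      ← sch_comp_apply, ← sch_comp_apply]
    refine and_congr (by rw [powerSucc, lift_fst]) (forall_congr' fun i => ?_)
    rw [← sch_comp_apply, powerSucc, lift_snd]
    simp

instance isIso_concat (X : SchC) {k l n : ℕ} (h : k + l = n) : IsIso (concat X h) := by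
  subst h
  refine ⟨lift (Pi.lift fun i => proj X (i.castAdd l)) (Pi.lift fun i => proj X (i.natAdd k)),
    ?_, ?_⟩
  · refine CartesianMonoidalCategory.hom_ext _ _ (power_hom_ext fun i => ?_)
      (power_hom_ext fun i => ?_) <;> simp
  · refine power_hom_ext fun i => ?_
    refine Fin.addCases (fun j => ?_) (fun j => ?_) i <;> simp

/-- If the composition with a surjective morphism is of finite type, so is the second morphism. -/
theorem IsFiniteType.of_surjective_comp {X Y Z : SchC} {u : X ⟶ Y} {v : Y ⟶ Z}
    (h : IsFiniteType (u ≫ v)) (hu : Function.Surjective (sch u)) : IsFiniteType v := by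
  refine ⟨locallyOfFiniteType_sch _, ⟨fun K hK hK' => ?_⟩⟩
  have h1 := (h.quasiCompact.1 K hK hK').image (sch u).continuous
  have h2 : sch u '' (sch (u ≫ v) ⁻¹' K) = sch v ⁻¹' K := by
    change sch u '' (sch u ⁻¹' (sch v ⁻¹' K)) = _
    exact Set.image_preimage_eq _ hu
  exact h2 ▸ h1

/-! ### Morphisms between symmetric powers -/

namespace SymPower

variable {X Y : SchC} {n : ℕ}

instance (S : SymPower X n) : Epi S.π := S.isQuotient.epi_of_sch

theorem surjective_π (S : SymPower X n) : Function.Surjective (sch S.π) :=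
  S.isQuotientMap.surjective

theorem exists_desc (S : SymPower X n) {Z : SchC} (f : power X n ⟶ Z)
    (hf : ∀ e, permute X e ≫ f = f) : ∃ m : S.obj ⟶ Z, S.π ≫ m = f :=
  S.isQuotient.exists_desc_of_sch f hf

theorem isFiniteType_π (S : SymPower X n) : IsFiniteType S.π := S.isQuotient.isFiniteType

instance epi_whiskerLeft (S : SymPower X n) (Z : SchC) : Epi (Z ◁ S.π) :=
  (S.isQuotient.whiskerLeft Z).epi_of_sch

instance epi_whiskerRight (S : SymPower X n) (Z : SchC) : Epi (S.π ▷ Z) :=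
  (S.isQuotient.whiskerRight Z).epi_of_sch

theorem exists_desc_whiskerLeft (S : SymPower X n) (Z : SchC) {W : SchC} (f : Z ⊗ power X n ⟶ W)
    (hf : ∀ e, Z ◁ permute X e ≫ f = f) : ∃ m : Z ⊗ S.obj ⟶ W, Z ◁ S.π ≫ m = f :=
  (S.isQuotient.whiskerLeft Z).exists_desc_of_sch f hf

theorem exists_desc_whiskerRight (S : SymPower X n) (Z : SchC) {W : SchC}
    (f : power X n ⊗ Z ⟶ W) (hf : ∀ e, permute X e ▷ Z ≫ f = f) :
    ∃ m : S.obj ⊗ Z ⟶ W, S.π ▷ Z ≫ m = f :=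
  (S.isQuotient.whiskerRight Z).exists_desc_of_sch f hf

instance epi_tensorHom {k : ℕ} (S : SymPower X n) (S' : SymPower Y k) : Epi (S.π ⊗ₘ S'.π) := by
  rw [MonoidalCategory.tensorHom_def]
  exact epi_comp _ _

theorem exists_desc_tensorHom {k : ℕ} (S : SymPower X n) (S' : SymPower Y k) {W : SchC}
    (f : power X n ⊗ power Y k ⟶ W) (h : ∀ e, permute X e ▷ power Y k ≫ f = f)
    (h' : ∀ e, power X n ◁ permute Y e ≫ f = f) :
    ∃ m : S.obj ⊗ S'.obj ⟶ W, (S.π ⊗ₘ S'.π) ≫ m = f := by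
  obtain ⟨f₁, hf₁⟩ := S.exists_desc_whiskerRight _ f h
  obtain ⟨m, hm⟩ := S'.exists_desc_whiskerLeft S.obj f₁ fun e => by
    rw [← cancel_epi (S.π ▷ _), hf₁, ← MonoidalCategory.whisker_exchange_assoc, hf₁, h']
  exact ⟨m, by rw [MonoidalCategory.tensorHom_def, Category.assoc, hm, hf₁]⟩

instance (S : SymPower X n) [IsAffine X.scheme] : IsAffine S.obj.scheme := S.isQuotient.isAffine

theorem permute_powerMap (u : X ⟶ Y) (e : Equiv.Perm (Fin n)) :
    permute X e ≫ powerMap u n = powerMap u n ≫ permute Y e :=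
  power_hom_ext fun i => by simp

theorem exists_map (u : X ⟶ Y) (S : SymPower X n) (S' : SymPower Y n) :
    ∃ m : S.obj ⟶ S'.obj, S.π ≫ m = powerMap u n ≫ S'.π :=
  S.exists_desc _ fun e => by rw [← Category.assoc, permute_powerMap, Category.assoc, S'.permute_π]

/-- The morphism `Symⁿ(u)`. -/
def map (u : X ⟶ Y) (S : SymPower X n) (S' : SymPower Y n) : S.obj ⟶ S'.obj :=
  (exists_map u S S').choose

theorem π_map (u : X ⟶ Y) (S : SymPower X n) (S' : SymPower Y n) :
    S.π ≫ map u S S' = powerMap u n ≫ S'.π := (exists_map u S S').choose_spec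

theorem isFiniteType_map {u : X ⟶ Y} (hu : IsFiniteType u) (S : SymPower X n)
    (S' : SymPower Y n) : IsFiniteType (map u S S') := by
  refine IsFiniteType.of_surjective_comp (u := S.π) ?_ S.surjective_π
  rw [π_map]
  exact (hu.powerMap n).comp S'.isFiniteType_π

theorem exists_concat {k l : ℕ} (h : k + l = n) (S : SymPower X k) (S' : SymPower X l)
    (S'' : SymPower X n) :
    ∃ m : S.obj ⊗ S'.obj ⟶ S''.obj, (S.π ⊗ₘ S'.π) ≫ m = concat X h ≫ S''.π := by
  subst h
  refine S.exists_desc_tensorHom S' _ (fun e => ?_) fun e => ?_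
  -- permutations of the first `k` and of the last `l` coordinates extend to all coordinates
  · let e' : Equiv.Perm (Fin (k + l)) :=
      finSumFinEquiv.symm.trans ((Equiv.sumCongr e (Equiv.refl _)).trans finSumFinEquiv)
    have : permute X e ▷ power X l ≫ concat X rfl = concat X rfl ≫ permute X e' :=
      power_hom_ext fun i => by
        refine Fin.addCases (fun j => ?_) (fun j => ?_) i <;> simp [e']
    rw [← Category.assoc, this, Category.assoc, S''.permute_π]
  · let e' : Equiv.Perm (Fin (k + l)) :=
      finSumFinEquiv.symm.trans ((Equiv.sumCongr (Equiv.refl _) e).trans finSumFinEquiv)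
    have : power X k ◁ permute X e ≫ concat X rfl = concat X rfl ≫ permute X e' :=
      power_hom_ext fun i => by
        refine Fin.addCases (fun j => ?_) (fun j => ?_) i <;> simp [e']
    rw [← Category.assoc, this, Category.assoc, S''.permute_π]

/-- The morphism `⊕ : Symᵏ(X) × Symˡ(X) ⟶ Symⁿ(X)`. -/
def add {k l : ℕ} (h : k + l = n) (S : SymPower X k) (S' : SymPower X l) (S'' : SymPower X n) :
    S.obj ⊗ S'.obj ⟶ S''.obj := (exists_concat h S S' S'').choose

theorem π_add {k l : ℕ} (h : k + l = n) (S : SymPower X k) (S' : SymPower X l)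
    (S'' : SymPower X n) : (S.π ⊗ₘ S'.π) ≫ add h S S' S'' = concat X h ≫ S''.π :=
  (exists_concat h S S' S'').choose_spec

theorem isFiniteType_of_π {k l : ℕ} (h : k + l = n) (S : SymPower X k) (S' : SymPower X l)
    (S'' : SymPower X n) (m : S.obj ⊗ S'.obj ⟶ S''.obj)
    (hm : (S.π ⊗ₘ S'.π) ≫ m = concat X h ≫ S''.π) : IsFiniteType m := by
  refine IsFiniteType.of_surjective_comp (u := S.π ⊗ₘ S'.π) ?_
    (surjective_tensorHom S.surjective_π S'.surjective_π)
  rw [hm]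
  exact (IsFiniteType.of_isIso _).comp S''.isFiniteType_π

theorem isFiniteType_add {k l : ℕ} (h : k + l = n) (S : SymPower X k) (S' : SymPower X l)
    (S'' : SymPower X n) : IsFiniteType (add h S S' S'') :=
  isFiniteType_of_π h S S' S'' _ (π_add h S S' S'')

/-- The quotient by a trivial group is an isomorphism. -/
theorem isIso_π_of_subsingleton [Subsingleton (Equiv.Perm (Fin n))] (S : SymPower X n) :
    IsIso S.π := by
  obtain ⟨r, hr⟩ := S.exists_desc (𝟙 _) fun e => by
    rw [Subsingleton.elim e 1]
    exact (Category.comp_id _).trans (permAction X n).hom_one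
  exact ⟨r, hr, by rw [← cancel_epi S.π, reassoc_of% hr, Category.comp_id]⟩

instance (S : SymPower X 0) : IsIso S.π := S.isIso_π_of_subsingleton

instance (S : SymPower X 1) : IsIso S.π := S.isIso_π_of_subsingleton

/-- `Symⁿ(U)` is open in `Symⁿ(X)` if `U` is open in `X`. -/
theorem isOpenImmersion_map {u : X ⟶ Y} (hu : IsOpenImmersion (sch u)) (S : SymPower X n)
    (S' : SymPower Y n) (m : S.obj ⟶ S'.obj) (hm : S.π ≫ m = powerMap u n ≫ S'.π) :
    IsOpenImmersion (sch m) := by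
  have := isOpenImmersion_powerMap hu n
  exact S'.isGeometricQuotient.isOpenImmersion S.isGeometricQuotient (sch (powerMap u n))
    (fun e => congr_arg sch (permute_powerMap u e)) _ (congr_arg sch hm)

/-- A point of `Yⁿ` maps to `Symⁿ(U)` only if its coordinates lie in `U`. -/
theorem mem_range_of_mem_range_map {u : X ⟶ Y} (S : SymPower X n) (S' : SymPower Y n)
    (m : S.obj ⟶ S'.obj) (hm : S.π ≫ m = powerMap u n ≫ S'.π) {z : (power Y n).scheme}
    (hz : sch S'.π z ∈ Set.range (sch m)) (i : Fin n) : sch (proj Y i) z ∈ Set.range (sch u) := by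
  obtain ⟨s, hs⟩ := hz
  obtain ⟨x, rfl⟩ := S.surjective_π s
  rw [← sch_comp_apply, hm, sch_comp_apply] at hs
  obtain ⟨e, rfl⟩ := S'.exists_permute _ _ hs
  rw [← sch_comp_apply, permute_proj, ← sch_comp_apply]
  simp only [limit.lift_π, Fan.mk_π_app]
  exact ⟨_, rfl⟩

end SymPower

/-! ### Open and closed subschemes -/

theorem isAffineHom_of_isAffine_source {X Y : Scheme.{0}} (f : X ⟶ Y) [IsAffine X] (s : Y ⟶ SpecC)
    [IsSeparated s] : IsAffineHom f :=
  have : IsAffineHom (f ≫ s) := inferInstance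
  .of_comp f s

/-- An affine open subset as an object of `SchC`. -/
def affineOpen {X : SchC} (U : X.scheme.Opens) (hU : IsAffineOpen U) : SchC :=
  have : IsAffine U.toScheme := hU
  have : IsAffineHom U.ι := isAffineHom_of_isAffine_source _ X.obj.hom
  X.ofAffineHom U.ι

/-- The inclusion of an affine open subset. -/
def affineOpenι {X : SchC} (U : X.scheme.Opens) (hU : IsAffineOpen U) : affineOpen U hU ⟶ X :=
  have : IsAffine U.toScheme := hU
  have : IsAffineHom U.ι := isAffineHom_of_isAffine_source _ X.obj.hom
  X.ofAffineHomMap U.ι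

theorem isAffine_affineOpen {X : SchC} (U : X.scheme.Opens) (hU : IsAffineOpen U) :
    IsAffine (affineOpen U hU).scheme := hU

theorem isOpenImmersion_affineOpenι {X : SchC} (U : X.scheme.Opens) (hU : IsAffineOpen U) :
    IsOpenImmersion (sch (affineOpenι U hU)) := inferInstanceAs (IsOpenImmersion U.ι)

theorem range_affineOpenι {X : SchC} (U : X.scheme.Opens) (hU : IsAffineOpen U) :
    Set.range (sch (affineOpenι U hU)) = U := Scheme.Opens.range_ι U

theorem isFiniteType_affineOpenι {X : SchC} (U : X.scheme.Opens) (hU : IsAffineOpen U) :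
    IsFiniteType (affineOpenι U hU) := by
  have := isAffine_affineOpen U hU
  exact .of_compactSpace _

/-- The complement of an open subset, with the reduced structure. -/
theorem exists_closedComplement {X : SchC} (U : X.scheme.Opens) :
    ∃ (Z : SchC) (i : Z ⟶ X), IsClosedImmersion (sch i) ∧
      Set.range (sch i) = (U : Set X.scheme)ᶜ := by
  let I := Scheme.IdealSheafData.vanishingIdeal (⟨(U : Set X.scheme)ᶜ, U.isOpen.isClosed_compl⟩ :
    TopologicalSpace.Closeds X.scheme)
  refine ⟨X.ofAffineHom I.subschemeι, X.ofAffineHomMap I.subschemeι,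
    inferInstanceAs (IsClosedImmersion I.subschemeι), ?_⟩
  change Set.range I.subschemeι = _
  rw [Scheme.IdealSheafData.range_subschemeι, Scheme.IdealSheafData.coe_support_vanishingIdeal]
  rfl

theorem isFiniteType_of_isClosedImmersion {X Y : SchC} {u : X ⟶ Y}
    (h : IsClosedImmersion (sch u)) : IsFiniteType u := ⟨locallyOfFiniteType_sch _, inferInstance⟩

/-- Morphisms whose image lies in an open subscheme factor through it. -/
theorem exists_lift_of_range_subset {T X W : SchC} (j : T ⟶ X) (hj : IsOpenImmersion (sch j))
    (w : W ⟶ X) (h : Set.range (sch w) ⊆ Set.range (sch j)) : ∃ l : W ⟶ T, l ≫ j = w := by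
  refine ⟨SchC.homMk (IsOpenImmersion.lift (sch j) (sch w) h) ?_,
    sch_injective (IsOpenImmersion.lift_fac _ _ _)⟩
  rw [← sch_w j, IsOpenImmersion.lift_fac_assoc, sch_w]

theorem mono_of_isOpenImmersion {T X : SchC} (j : T ⟶ X) (hj : IsOpenImmersion (sch j)) : Mono j :=
  ⟨fun u v h => sch_injective (by
    rw [← cancel_mono (sch j)]
    exact congr_arg sch h)⟩

theorem isClosedImmersion_of_isOpenImmersion {T X : Scheme.{0}} (j : T ⟶ X) [IsOpenImmersion j]
    (h : IsClosed (Set.range j)) : IsClosedImmersion j where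
  isClosedEmbedding := ⟨j.isOpenEmbedding.isEmbedding, h⟩

/-- Every point lies in an open subscheme that is a connected component. -/
theorem exists_isComponent {X : SchC} (x : X.scheme) :
    ∃ (T : SchC) (j : T ⟶ X), IsComponent j ∧ Set.range (sch j) = connectedComponent x := by
  let U : X.scheme.Opens := ⟨_, isOpen_connectedComponent_of_locallyNoetherian X.scheme x⟩
  have hU : Set.range U.ι = connectedComponent x := Scheme.Opens.range_ι U
  have : IsClosedImmersion U.ι :=
    isClosedImmersion_of_isOpenImmersion _ (by rw [hU]; exact isClosed_connectedComponent)
  exact ⟨X.ofAffineHom U.ι, X.ofAffineHomMap U.ι,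
    ⟨inferInstanceAs (IsOpenImmersion U.ι), x, hU⟩, hU⟩

theorem IsComponent.compactSpace {T X : SchC} {j : T ⟶ X} (hj : IsComponent j) :
    CompactSpace T.scheme := by
  have := hj.isOpenImmersion
  obtain ⟨x, hx⟩ := hj.range_eq
  have h1 : IsCompact (Set.range (sch j)) := hx ▸ X.property.isCompact_connectedComponent x
  exact ⟨by rwa [(sch j).isOpenEmbedding.isInducing.isCompact_iff, Set.image_univ]⟩

/-- A disjoint cover by connected components, in the form used by the axioms. -/
theorem exists_components (X : SchC) : ∃ (I : Type) (T : I → SchC) (j : ∀ i, T i ⟶ X),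
    (∀ i, IsComponent (j i)) ∧ ∀ x : X.scheme, ∃! i, x ∈ Set.range (sch (j i)) := by
  choose T j hj hr using fun x : X.scheme => exists_isComponent x
  refine ⟨_root_.ConnectedComponents X.scheme, fun i => T (Quotient.out i),
    fun i => j (Quotient.out i),
    fun i => hj _, fun x => ⟨_root_.ConnectedComponents.mk x, ?_, fun i hi => ?_⟩⟩
  · change x ∈ Set.range (sch (j (Quotient.out (_root_.ConnectedComponents.mk x))))
    rw [hr]
    have : _root_.ConnectedComponents.mk (Quotient.out (_root_.ConnectedComponents.mk x)) =
      _root_.ConnectedComponents.mk x := Quotient.out_eq _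
    rw [_root_.ConnectedComponents.coe_eq_coe'] at this
    exact (connectedComponent_eq this) ▸ mem_connectedComponent
  · change x ∈ Set.range (sch (j (Quotient.out i))) at hi
    rw [hr] at hi
    have h1 : _root_.ConnectedComponents.mk x = _root_.ConnectedComponents.mk (Quotient.out i) :=
      _root_.ConnectedComponents.coe_eq_coe'.2 hi
    rw [h1]
    exact (Quotient.out_eq i).symm

theorem isAffine_fiberProd {X Y Z : SchC} (f : X ⟶ Z) (g : Y ⟶ Z) [IsAffine X.scheme]
    [IsAffine Y.scheme] : IsAffine (fiberProd f g).scheme := by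
  have := isAffineHom_of_isAffine_source (sch f) Z.obj.hom
  exact inferInstanceAs (IsAffine (pullback (sch f) (sch g)))

/-! ### Calculus in a motivic theory -/

namespace MotivicTheory

variable (R : MotivicTheory.{v})

theorem push_congr {X Y : SchC} {u u' : X ⟶ Y} (h : u = u') (hu : IsFiniteType u)
    (hu' : IsFiniteType u') (a : R.obj X) : R.push u hu a = R.push u' hu' a := by
  subst h; rfl

theorem base_change' {P X Y Z : SchC} {v' : P ⟶ X} {u' : P ⟶ Y} {u : X ⟶ Z} {v : Y ⟶ Z}
    (h : IsPullback v' u' u v) (hu : IsFiniteType u) (hu' : IsFiniteType u') (a : R.obj X) :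
    R.push u' hu' (R.pull v' a) = R.pull v (R.push u hu a) :=
  R.base_change v' u' u v h.sch hu hu' a

/-- Base change along the cartesian square that expresses that `j` is a monomorphism. -/
theorem pull_push_of_mono {X Y : SchC} (j : X ⟶ Y) [Mono j] (hj : IsFiniteType j) (a : R.obj X) :
    R.pull j (R.push j hj a) = a := by
  rw [← R.base_change' (IsKernelPair.id_of_mono j) hj (.id X), R.pull_id, R.push_id]

theorem push_pull_of_isIso {X Y : SchC} (e : X ⟶ Y) [IsIso e] (he : IsFiniteType e)
    (a : R.obj Y) : R.push e he (R.pull e a) = a := by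
  have h : IsPullback e e (𝟙 Y) (𝟙 Y) := .of_vert_isIso ⟨rfl⟩
  rw [R.base_change' h (.id Y), R.pull_id, R.push_id]

/-- Pulling back along an isomorphism is pushing forward along the inverse. -/
theorem pull_eq_push {X Y : SchC} (e : X ⟶ Y) (e' : Y ⟶ X) (h : e ≫ e' = 𝟙 X) (h' : e' ≫ e = 𝟙 Y)
    (he' : IsFiniteType e') (a : R.obj Y) : R.pull e a = R.push e' he' a := by
  have : IsIso e' := ⟨e, h', h⟩
  rw [← R.push_pull_of_isIso e' he' (R.pull e a), ← R.pull_comp, h', R.pull_id]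

/-- The group of the empty scheme is the product over the empty set of components. -/
theorem subsingleton_of_isEmpty (X : SchC) [IsEmpty X.scheme] : Subsingleton (R.obj X) := by
  have h := R.bijective_components (X := X) (I := Empty) (fun i => i.elim) (fun i => i.elim)
    (fun i => i.elim) fun x => isEmptyElim x
  exact h.1.subsingleton

theorem box_push_left {X X' Y : SchC} (u : X ⟶ X') (hu : IsFiniteType u) (a : R.obj X)
    (b : R.obj Y) : R.box (R.push u hu a) b = R.push (u ▷ Y) (hu.whiskerRight Y) (R.box a b) := by
  have h := R.push_box u (𝟙 Y) hu (.id Y) a b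
  rw [R.push_id] at h
  rw [← h]
  exact R.push_congr (MonoidalCategory.tensorHom_id u Y) _ _ _

theorem _root_.MotivicTheories.IsFiniteType.whiskerLeft {X Y : SchC} {u : X ⟶ Y}
    (hu : IsFiniteType u) (Z : SchC) : IsFiniteType (Z ◁ u) := by
  rw [← MonoidalCategory.id_tensorHom]
  exact (IsFiniteType.id Z).tensorHom hu

theorem box_push_right {X Y Y' : SchC} (u : Y ⟶ Y') (hu : IsFiniteType u) (a : R.obj X)
    (b : R.obj Y) : R.box a (R.push u hu b) = R.push (X ◁ u) (hu.whiskerLeft X) (R.box a b) := by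
  have h := R.push_box (𝟙 X) u (.id X) hu a b
  rw [R.push_id] at h
  rw [← h]
  exact R.push_congr (MonoidalCategory.id_tensorHom X u) _ _ _

theorem box_pull_left {X X' Y : SchC} (u : X ⟶ X') (a : R.obj X') (b : R.obj Y) :
    R.box (R.pull u a) b = R.pull (u ▷ Y) (R.box a b) := by
  rw [← MonoidalCategory.tensorHom_id, R.pull_box, R.pull_id]

theorem box_pull_right {X Y Y' : SchC} (u : Y ⟶ Y') (a : R.obj X) (b : R.obj Y') :
    R.box a (R.pull u b) = R.pull (X ◁ u) (R.box a b) := by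
  rw [← MonoidalCategory.id_tensorHom, R.pull_box, R.pull_id]

/-- The unit of the ring `R(X)`. -/
def unit (X : SchC) : R.obj X := R.pull (toUnit X) R.one

theorem pull_unit {X Y : SchC} (u : X ⟶ Y) : R.pull u (R.unit Y) = R.unit X := by
  rw [unit, ← R.pull_comp, toUnit_unique (u ≫ toUnit Y) (toUnit X)]
  rfl

theorem unit_box {X Y : SchC} (b : R.obj Y) : R.box (R.unit X) b = R.pull (snd X Y) b := by
  rw [unit, R.box_pull_left, R.one_box, ← R.pull_comp]
  congr 2
  simp

theorem box_unit {X Y : SchC} (a : R.obj X) : R.box a (R.unit Y) = R.pull (fst X Y) a := by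
  rw [unit, R.box_pull_right, R.box_one, ← R.pull_comp]
  congr 2
  simp

theorem unit_box_unit (X Y : SchC) : R.box (R.unit X) (R.unit Y) = R.unit (X ⊗ Y) := by
  rw [unit_box, pull_unit]

theorem cls_eq {V X : SchC} (f : V ⟶ X) (hf : IsFiniteType f) :
    R.cls f hf = R.push f hf (R.unit V) := rfl

theorem push_cls {V X Y : SchC} (f : V ⟶ X) (hf : IsFiniteType f) (u : X ⟶ Y)
    (hu : IsFiniteType u) : R.push u hu (R.cls f hf) = R.cls (f ≫ u) (hf.comp hu) :=
  (R.push_comp f u hf hu _).symm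

theorem pull_cls {V X W P : SchC} {f : V ⟶ X} (hf : IsFiniteType f) {w : W ⟶ X} {p : P ⟶ V}
    {f' : P ⟶ W} (h : IsPullback p f' f w) (hf' : IsFiniteType f') :
    R.pull w (R.cls f hf) = R.cls f' hf' := by
  rw [cls_eq, ← R.base_change' h hf hf', pull_unit, cls_eq]

theorem cls_box_cls {V X W Y : SchC} (f : V ⟶ X) (hf : IsFiniteType f) (g : W ⟶ Y)
    (hg : IsFiniteType g) : R.box (R.cls f hf) (R.cls g hg) = R.cls (f ⊗ₘ g) (hf.tensorHom hg) := by
  rw [cls_eq, cls_eq, ← R.push_box, unit_box_unit, cls_eq]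

theorem sigma_cls {V X : SchC} (f : V ⟶ X) (hf : IsFiniteType f) {n : ℕ} (S : SymPower V n)
    (S' : SymPower X n) (m : S.obj ⟶ S'.obj) (h : S.π ≫ m = powerMap f n ≫ S'.π)
    (hm : IsFiniteType m) : R.sigma S' (R.cls f hf) = R.cls m hm := by
  rw [cls_eq, ← R.push_sigma f hf S S' m hm h, unit, R.sigma_unit, cls_eq]
  rfl

/-- A pull-back of a push-forward vanishes if the fibre product is empty. -/
theorem pull_push_eq_zero {X Y Z : SchC} (u : X ⟶ Z) (hu : IsFiniteType u) (w : Y ⟶ Z)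
    (h : Disjoint (Set.range (sch u)) (Set.range (sch w))) (a : R.obj X) :
    R.pull w (R.push u hu a) = 0 := by
  have hP := isPullback_fiberProd u w
  have : IsEmpty (fiberProd u w).scheme := ⟨fun p => by
    refine Set.disjoint_left.1 h ⟨sch (fiberFst u w) p, rfl⟩ ⟨sch (fiberSnd u w) p, ?_⟩
    rw [← sch_comp_apply, ← hP.w, sch_comp_apply]⟩
  have := R.subsingleton_of_isEmpty (fiberProd u w)
  rw [← R.base_change' hP hu (hP.isFiniteType hu), Subsingleton.elim (R.pull _ a) 0, map_zero]

/-! ### Localisation on affine schemes -/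

/-- A family of subgroups that is stable under push-forwards contains an element if it does so
locally: by `closed_open`, the element is a sum of push-forwards from an open subset of the
cover and from its closed complement, which is covered by fewer open subsets. -/
theorem mem_of_list_cover (N : ∀ X, AddSubgroup (R.obj X))
    (hN : ∀ {X Y : SchC} (u : X ⟶ Y) (hu : IsFiniteType u) (a), a ∈ N X → R.push u hu a ∈ N Y)
    (n : ℕ) : ∀ {X : SchC} (L : List X.scheme.Opens), L.length = n → (∀ U ∈ L, IsAffineOpen U) →
    (∀ x, ∃ U ∈ L, x ∈ U) → ∀ a : R.obj X, (∀ U ∈ L, ∀ (W : SchC) (w : W ⟶ X),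
      IsAffine W.scheme → Set.range (sch w) ⊆ U → R.pull w a ∈ N W) → a ∈ N X := by
  induction n with
  | zero =>
    intro X L hL hLa hcov a ha
    have : IsEmpty X.scheme := ⟨fun x => by
      obtain ⟨U, hU, -⟩ := hcov x
      rw [List.length_eq_zero_iff.1 hL] at hU
      exact List.not_mem_nil hU⟩
    have := R.subsingleton_of_isEmpty X
    rw [Subsingleton.elim a 0]
    exact zero_mem _
  | succ n ih =>
    rintro X (_ | ⟨U, L⟩) hL hLa hcov a ha
    · simp at hL
    have hU : IsAffineOpen U := hLa U List.mem_cons_self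
    obtain ⟨Z, i, hi, hir⟩ := exists_closedComplement U
    have hj := isOpenImmersion_affineOpenι U hU
    have hi' := isFiniteType_of_isClosedImmersion hi
    have hj' := isFiniteType_affineOpenι U hU
    obtain ⟨-, -, -, -, h⟩ := R.closed_open i (affineOpenι U hU) hi hj
      (by rw [hir, compl_compl, range_affineOpenι]) hi' hj'
    rw [h a]
    refine add_mem (hN _ _ _ ?_) (hN _ _ _ ?_)
    · refine ih (L.map fun V => sch i ⁻¹ᵁ V) (by simpa using hL) ?_ (fun z => ?_) _ ?_
      · simp only [List.mem_map]
        rintro _ ⟨V, hV, rfl⟩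
        exact (hLa V (List.mem_cons_of_mem _ hV)).preimage _
      · obtain ⟨V, hV, hzV⟩ := hcov (sch i z)
        rcases List.mem_cons.1 hV with rfl | hV
        · exact absurd hzV (hir ▸ ⟨z, rfl⟩ : sch i z ∈ (V : Set X.scheme)ᶜ)
        · exact ⟨_, List.mem_map.2 ⟨V, hV, rfl⟩, hzV⟩
      · simp only [List.mem_map]
        rintro _ ⟨V, hV, rfl⟩ W w hW hw
        rw [← R.pull_comp]
        refine ha V (List.mem_cons_of_mem _ hV) W _ hW ?_
        rintro _ ⟨y, rfl⟩
        exact hw ⟨y, rfl⟩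
    · exact ha U List.mem_cons_self _ _ (isAffine_affineOpen U hU) (range_affineOpenι U hU).subset

/-- A version of `mem_of_list_cover` for quasi-compact schemes, where the condition is imposed near
every point. -/
theorem mem_of_locally (N : ∀ X, AddSubgroup (R.obj X))
    (hN : ∀ {X Y : SchC} (u : X ⟶ Y) (hu : IsFiniteType u) (a), a ∈ N X → R.push u hu a ∈ N Y)
    {X : SchC} [CompactSpace X.scheme] (a : R.obj X) (h : ∀ x : X.scheme, ∃ U : X.scheme.Opens,
      x ∈ U ∧ ∀ (W : SchC) (w : W ⟶ X), IsAffine W.scheme → Set.range (sch w) ⊆ U →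
        R.pull w a ∈ N W) : a ∈ N X := by
  have h' : ∀ x : X.scheme, ∃ U : X.scheme.Opens, x ∈ U ∧ IsAffineOpen U ∧
      ∀ (W : SchC) (w : W ⟶ X), IsAffine W.scheme → Set.range (sch w) ⊆ U →
        R.pull w a ∈ N W := fun x => by
    obtain ⟨U, hxU, hU⟩ := h x
    obtain ⟨V, hV, hxV, hVU⟩ := exists_isAffineOpen_mem_and_subset hxU
    exact ⟨V, hxV, hV, fun W w hW hw => hU W w hW (hw.trans hVU)⟩
  choose U hxU hU hUa using h'
  obtain ⟨t, ht⟩ := isCompact_univ.elim_finite_subcover (fun x => (U x : Set X.scheme))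
    (fun x => (U x).isOpen) (fun x _ => Set.mem_iUnion.2 ⟨x, hxU x⟩)
  refine R.mem_of_list_cover N hN _ (t.toList.map U) rfl (fun V hV => ?_) (fun x => ?_) a
    fun V hV => ?_
  · obtain ⟨x, -, rfl⟩ := List.mem_map.1 hV
    exact hU x
  · obtain ⟨y, hy, hxy⟩ := Set.mem_iUnion₂.1 (ht (Set.mem_univ x))
    exact ⟨U y, List.mem_map.2 ⟨y, Finset.mem_toList.2 hy, rfl⟩, hxy⟩
  · obtain ⟨x, -, rfl⟩ := List.mem_map.1 hV
    exact hUa x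

/-- Elements are determined by their pull-backs to affine schemes, locally. -/
theorem eq_zero_of_locally {X : SchC} (a : R.obj X) (h : ∀ x : X.scheme, ∃ U : X.scheme.Opens,
      x ∈ U ∧ ∀ (W : SchC) (w : W ⟶ X), IsAffine W.scheme → Set.range (sch w) ⊆ U →
        R.pull w a = 0) : a = 0 := by
  obtain ⟨I, T, j, hj, hX⟩ := exists_components X
  refine (R.bijective_components T j hj hX).1 (funext fun i => ?_)
  change R.pull (j i) a = R.pull (j i) 0
  rw [map_zero]
  have := (hj i).compactSpace
  refine R.mem_of_locally (fun _ => ⊥) (fun u hu a ha => ?_) _ fun x => ?_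
  · rw [AddSubgroup.mem_bot] at ha ⊢
    rw [ha, map_zero]
  · obtain ⟨U, hxU, hU⟩ := h (sch (j i) x)
    refine ⟨sch (j i) ⁻¹ᵁ U, hxU, fun W w hW hw => ?_⟩
    rw [AddSubgroup.mem_bot, ← R.pull_comp]
    refine hU W _ hW ?_
    rintro _ ⟨y, rfl⟩
    exact hw ⟨y, rfl⟩

/-- Elements are determined by their pull-backs to all affine schemes. -/
theorem eq_of_affine {X : SchC} {a b : R.obj X}
    (h : ∀ (W : SchC) (w : W ⟶ X), IsAffine W.scheme → R.pull w a = R.pull w b) : a = b := by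
  rw [← sub_eq_zero]
  refine R.eq_zero_of_locally _ fun x => ⟨⊤, trivial, fun W w hW _ => ?_⟩
  rw [map_sub, h W w hW, sub_self]

/-- Gluing along an arbitrary disjoint open cover. -/
theorem bijective_of_disjoint_cover {X : SchC} {I : Type} (T : I → SchC) (j : ∀ i, T i ⟶ X)
    (hj : ∀ i, IsOpenImmersion (sch (j i))) (hX : ∀ x : X.scheme, ∃! i, x ∈ Set.range (sch (j i))) :
    Function.Bijective fun (a : R.obj X) (i : I) => R.pull (j i) a := by
  constructor
  · intro a b hab
    change (fun i => R.pull (j i) a) = fun i => R.pull (j i) b at hab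
    rw [← sub_eq_zero]
    refine R.eq_zero_of_locally _ fun x => ?_
    obtain ⟨i, hi, -⟩ := hX x
    have := hj i
    refine ⟨(sch (j i)).opensRange, hi, fun W w hW hw => ?_⟩
    obtain ⟨l, rfl⟩ := exists_lift_of_range_subset (j i) (hj i) w hw
    rw [map_sub, R.pull_comp, R.pull_comp, congr_fun hab i, sub_self]
  · intro b
    obtain ⟨K, C, c, hc, hcX⟩ := exists_components X
    -- every connected component lies in one member of the cover
    have hfac : ∀ k, ∃ (i : I) (l : C k ⟶ T i), l ≫ j i = c k := fun k => by
      obtain ⟨x, hx⟩ := (hc k).range_eq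
      obtain ⟨i, hi, -⟩ := hX x
      refine ⟨i, exists_lift_of_range_subset (j i) (hj i) (c k) ?_⟩
      rw [hx]
      refine IsClopen.connectedComponent_subset ⟨?_, (sch (j i)).isOpenEmbedding.isOpen_range⟩ hi
      have : (Set.range (sch (j i)))ᶜ = ⋃ i' : {i' // i' ≠ i}, Set.range (sch (j i')) := by
        ext y
        simp only [Set.mem_compl_iff, Set.mem_iUnion]
        obtain ⟨i', hi', hu⟩ := hX y
        constructor
        · intro hy
          exact ⟨⟨i', fun h => hy (h ▸ hi')⟩, hi'⟩
        · rintro ⟨⟨i'', hne⟩, hi''⟩ hy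
          exact hne ((hu _ hi'').trans (hu _ hy).symm)
      rw [← isOpen_compl_iff, this]
      exact isOpen_iUnion fun i' => (sch (j i')).isOpenEmbedding.isOpen_range
    choose i l hl using hfac
    obtain ⟨a, ha⟩ := (R.bijective_components C c hc hcX).2 fun k => R.pull (l k) (b (i k))
    have ha' : ∀ k, R.pull (c k) a = R.pull (l k) (b (i k)) := fun k => congr_fun ha k
    refine ⟨a, funext fun i₀ => ?_⟩
    change R.pull (j i₀) a = b i₀
    rw [← sub_eq_zero]
    refine R.eq_zero_of_locally _ fun x => ?_
    obtain ⟨k, hk, -⟩ := hcX (sch (j i₀) x)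
    have := (hc k).isOpenImmersion
    refine ⟨sch (j i₀) ⁻¹ᵁ (sch (c k)).opensRange, hk, fun W w hW hw => ?_⟩
    obtain ⟨m, hm⟩ := exists_lift_of_range_subset (c k) (hc k).isOpenImmersion (w ≫ j i₀) (by
      rintro _ ⟨y, rfl⟩
      exact hw ⟨y, rfl⟩)
    rcases isEmpty_or_nonempty W.scheme with hWe | ⟨⟨y⟩⟩
    · have := R.subsingleton_of_isEmpty W
      exact Subsingleton.elim _ _
    · rw [map_sub, ← R.pull_comp, ← hm, R.pull_comp, ha', ← R.pull_comp]
      have hik : i k = i₀ := by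
        obtain ⟨_, -, hu⟩ := hX (sch (w ≫ j i₀) y)
        refine (hu _ ⟨sch (m ≫ l k) y, ?_⟩).trans (hu _ ⟨sch w y, rfl⟩).symm
        rw [← sch_comp_apply, Category.assoc, hl, hm]
      have hlk := hl k
      generalize l k = l' at hlk ⊢
      revert l'
      rw [hik]
      intro l' hlk
      have := mono_of_isOpenImmersion _ (hj i₀)
      have e : m ≫ l' = w := by rw [← cancel_mono (j i₀), Category.assoc, hlk, hm]
      rw [e, sub_self]

end MotivicTheory

/-! ### Local classes -/

/-- Intersections of affine open subsets are fibre products. -/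
theorem exists_isPullback_inf {X : SchC} {U V : X.scheme.Opens} (hU : IsAffineOpen U)
    (hV : IsAffineOpen V) (hUV : IsAffineOpen (U ⊓ V)) :
    ∃ (p : affineOpen (U ⊓ V) hUV ⟶ affineOpen U hU) (q : affineOpen (U ⊓ V) hUV ⟶ affineOpen V hV),
      p ≫ affineOpenι U hU = affineOpenι (U ⊓ V) hUV ∧
      IsPullback p q (affineOpenι U hU) (affineOpenι V hV) := by
  have jU := isOpenImmersion_affineOpenι U hU
  have jV := isOpenImmersion_affineOpenι V hV
  have jUV := isOpenImmersion_affineOpenι (U ⊓ V) hUV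
  have := mono_of_isOpenImmersion _ jU
  have := mono_of_isOpenImmersion _ jV
  obtain ⟨p, hp⟩ := exists_lift_of_range_subset _ jU (affineOpenι (U ⊓ V) hUV) (by
    rw [range_affineOpenι, range_affineOpenι]; exact Set.inter_subset_left)
  obtain ⟨q, hq⟩ := exists_lift_of_range_subset _ jV (affineOpenι (U ⊓ V) hUV) (by
    rw [range_affineOpenι, range_affineOpenι]; exact Set.inter_subset_right)
  refine ⟨p, q, hp, isPullback_of_points (hp.trans hq.symm) (fun {T} a b hab => ?_)
    fun {T} l m h1 h2 => ?_⟩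
  · obtain ⟨l, hl⟩ := exists_lift_of_range_subset _ jUV (a ≫ affineOpenι U hU) (by
      rw [range_affineOpenι]
      rintro _ ⟨t, rfl⟩
      have h1 : sch (a ≫ affineOpenι U hU) t ∈ Set.range (sch (affineOpenι U hU)) :=
        ⟨sch a t, rfl⟩
      have h2 : sch (a ≫ affineOpenι U hU) t ∈ Set.range (sch (affineOpenι V hV)) := by
        rw [hab]; exact ⟨sch b t, rfl⟩
      rw [range_affineOpenι] at h1 h2
      exact ⟨h1, h2⟩)
    refine ⟨l, ?_, ?_⟩
    · rw [← cancel_mono (affineOpenι U hU), Category.assoc, hp, hl]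
    · rw [← cancel_mono (affineOpenι V hV), Category.assoc, hq, hl, hab]
  · have := mono_of_isOpenImmersion _ jUV
    rw [← cancel_mono (affineOpenι (U ⊓ V) hUV), ← hp, reassoc_of% h1]

theorem concat_proj_natAdd (X : SchC) {k l n : ℕ} (h : k + l = n) (j : Fin l) :
    concat X h ≫ proj X (Fin.cast h (Fin.natAdd k j)) = snd _ _ ≫ proj X j := by
  subst h
  have : Fin.cast rfl.symm (Fin.cast rfl (Fin.natAdd k j)) = Fin.natAdd k j := rfl
  simp only [limit.lift_π, Fan.mk_π_app, this, Fin.addCases_right]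

theorem concat_proj_castAdd (X : SchC) {k l n : ℕ} (h : k + l = n) (j : Fin k) :
    concat X h ≫ proj X (Fin.cast h (Fin.castAdd l j)) = fst _ _ ≫ proj X j := by
  subst h
  have : Fin.cast rfl.symm (Fin.cast rfl (Fin.castAdd l j)) = Fin.castAdd l j := rfl
  simp only [limit.lift_π, Fan.mk_π_app, this, Fin.addCases_left]

theorem concat_zero_left (X : SchC) {n : ℕ} (h : 0 + n = n) : concat X h = snd _ _ :=
  power_hom_ext fun i => by
    have : Fin.cast h.symm i = Fin.natAdd 0 i := by ext; simp
    simp only [limit.lift_π, Fan.mk_π_app, this, Fin.addCases_right]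

theorem concat_zero_right (X : SchC) {n : ℕ} (h : n + 0 = n) : concat X h = fst _ _ :=
  power_hom_ext fun i => by
    have : Fin.cast h.symm i = Fin.castAdd 0 i := by ext; simp
    simp only [limit.lift_π, Fan.mk_π_app, this, Fin.addCases_left]

namespace MotivicTheory

variable (R : MotivicTheory.{v})

/-- The operation `j_! j^*` for an affine open subset. -/
def restrictExtend {X : SchC} (U : X.scheme.Opens) (hU : IsAffineOpen U) : R.obj X →+ R.obj X :=
  (R.push (affineOpenι U hU) (isFiniteType_affineOpenι U hU)).comp (R.pull (affineOpenι U hU))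

theorem pull_restrictExtend {X : SchC} {U V : X.scheme.Opens} (hU : IsAffineOpen U)
    (hV : IsAffineOpen V) (a : R.obj X) (h : R.pull (affineOpenι V hV) a = 0) :
    R.pull (affineOpenι V hV) (R.restrictExtend U hU a) = 0 := by
  obtain ⟨p, q, hp, hpq⟩ := exists_isPullback_inf hU hV (hU.inf hV)
  change R.pull _ (R.push _ _ _) = 0
  rw [← R.base_change' hpq (isFiniteType_affineOpenι U hU)
    (hpq.isFiniteType (isFiniteType_affineOpenι U hU)), ← R.pull_comp, hpq.w, R.pull_comp, h,
    map_zero, map_zero]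

theorem restrictExtend_restrictExtend {X : SchC} {U V : X.scheme.Opens} (hU : IsAffineOpen U)
    (hV : IsAffineOpen V) (hUV : IsAffineOpen (U ⊓ V)) (a : R.obj X) :
    R.restrictExtend V hV (R.restrictExtend U hU a) = R.restrictExtend (U ⊓ V) hUV a := by
  obtain ⟨p, q, hp, hpq⟩ := exists_isPullback_inf hU hV hUV
  have hq := hpq.isFiniteType (isFiniteType_affineOpenι U hU)
  change R.push _ _ (R.pull _ (R.push _ _ _)) = R.push _ _ (R.pull _ a)
  rw [← R.base_change' hpq (isFiniteType_affineOpenι U hU) hq, ← R.pull_comp, hp,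
    ← R.push_comp q _ hq]
  exact R.push_congr (by rw [← hpq.w, hp]) _ _ _

theorem pull_restrictExtend_self {X : SchC} {U : X.scheme.Opens} (hU : IsAffineOpen U)
    (a : R.obj X) :
    R.pull (affineOpenι U hU) (R.restrictExtend U hU a) = R.pull (affineOpenι U hU) a := by
  have := mono_of_isOpenImmersion _ (isOpenImmersion_affineOpenι U hU)
  exact R.pull_push_of_mono _ _ _

/-- Inclusion-exclusion: an element is a combination of extensions by zero of its restrictions to
the members of a cover by affine open subsets that is closed under intersections. -/
theorem mem_closure_restrictExtend {X : SchC} [CompactSpace X.scheme] (C : Set X.scheme.Opens)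
    (hC : ∀ U ∈ C, IsAffineOpen U) (hinf : ∀ U ∈ C, ∀ V ∈ C, U ⊓ V ∈ C)
    (hcov : ∀ x, ∃ U ∈ C, x ∈ U) (a : R.obj X) :
    a ∈ AddSubgroup.closure {b | ∃ (U : X.scheme.Opens) (hU : U ∈ C),
      b = R.restrictExtend U (hC U hU) a} := by
  set N := AddSubgroup.closure {b | ∃ (U : X.scheme.Opens) (hU : U ∈ C),
      b = R.restrictExtend U (hC U hU) a} with hN
  have hNe : ∀ U (hU : U ∈ C), ∀ b ∈ N, R.restrictExtend U (hC U hU) b ∈ N := by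
    intro U hU b hb
    induction hb using AddSubgroup.closure_induction with
    | mem b hb =>
      obtain ⟨V, hV, rfl⟩ := hb
      rw [R.restrictExtend_restrictExtend _ _ (hC _ (hinf V hV U hU))]
      exact AddSubgroup.subset_closure ⟨_, hinf V hV U hU, rfl⟩
    | zero => rw [map_zero]; exact zero_mem _
    | add b c _ _ hb hc => rw [map_add]; exact add_mem hb hc
    | neg b _ hb => rw [map_neg]; exact neg_mem hb
  -- subtracting the restrictions to the members of the cover one after the other
  have key : ∀ L : List X.scheme.Opens, (∀ U ∈ L, U ∈ C) →
      ∃ b : R.obj X, a - b ∈ N ∧ ∀ U ∈ L, ∀ hU : U ∈ C, R.pull (affineOpenι U (hC U hU)) b = 0 := by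
    intro L
    induction L with
    | nil => exact fun _ => ⟨a, by rw [sub_self]; exact zero_mem _, by simp⟩
    | cons V L ih =>
      intro hL
      obtain ⟨b, hb, hb'⟩ := ih fun U hU => hL U (List.mem_cons_of_mem _ hU)
      have hV := hL V List.mem_cons_self
      refine ⟨b - R.restrictExtend V (hC V hV) b, ?_, fun U hU hUC => ?_⟩
      · have h1 : a - (b - R.restrictExtend V (hC V hV) b) =
            (a - b) + (R.restrictExtend V (hC V hV) a - R.restrictExtend V (hC V hV) (a - b)) := by
          rw [map_sub]; abel
        rw [h1]
        exact add_mem hb (sub_mem (AddSubgroup.subset_closure ⟨V, hV, rfl⟩) (hNe V hV _ hb))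
      · rcases List.mem_cons.1 hU with rfl | hU
        · rw [map_sub, pull_restrictExtend_self, sub_self]
        · rw [map_sub, hb' U hU hUC, R.pull_restrictExtend _ _ _ (hb' U hU hUC), sub_zero]
  choose U hUC hxU using hcov
  obtain ⟨t, ht⟩ := isCompact_univ.elim_finite_subcover (fun x => (U x : Set X.scheme))
    (fun x => (U x).isOpen) (fun x _ => Set.mem_iUnion.2 ⟨x, hxU x⟩)
  obtain ⟨b, hb, hb'⟩ := key (t.toList.map U) fun V hV => by
    obtain ⟨x, -, rfl⟩ := List.mem_map.1 hV
    exact hUC x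
  have hb0 : b = 0 := R.eq_zero_of_locally b fun x => by
    obtain ⟨y, hy, hxy⟩ := Set.mem_iUnion₂.1 (ht (Set.mem_univ x))
    refine ⟨U y, hxy, fun W w hW hw => ?_⟩
    obtain ⟨l, rfl⟩ := exists_lift_of_range_subset (affineOpenι (U y) (hC _ (hUC y)))
      (isOpenImmersion_affineOpenι _ _) w (by rw [range_affineOpenι]; exact hw)
    rw [R.pull_comp, hb' (U y) (List.mem_map.2 ⟨y, Finset.mem_toList.2 hy, rfl⟩) (hUC y), map_zero]
  rwa [hb0, sub_zero] at hb

/-! ### The operations `σⁿ` -/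

theorem powerMap_id (X : SchC) (n : ℕ) : powerMap (𝟙 X) n = 𝟙 _ :=
  power_hom_ext fun i => by simp

/-- The operation `σⁿ` does not depend on the choice of the symmetric power. -/
theorem push_sigma_id {X : SchC} {n : ℕ} (S S' : SymPower X n) (m : S.obj ⟶ S'.obj)
    (h : S.π ≫ m = S'.π) (hm : IsFiniteType m) (a : R.obj X) :
    R.push m hm (R.sigma S a) = R.sigma S' a := by
  rw [R.push_sigma (𝟙 X) (.id X) S S' m hm (by rw [h, powerMap_id, Category.id_comp]), R.push_id]

theorem push_sigma_map_id {X : SchC} {n : ℕ} (S S' : SymPower X n) (a : R.obj X) :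
    R.push (SymPower.map (𝟙 X) S S') (SymPower.isFiniteType_map (.id X) S S') (R.sigma S a) =
      R.sigma S' a :=
  R.push_sigma_id S S' _ (by rw [SymPower.π_map, powerMap_id, Category.id_comp]) _ a

theorem sigma_add' {X : SchC} (n : ℕ) (a b : R.obj X) (S : ∀ k, SymPower X k) :
    R.sigma (S n) (a + b) = ∑ l : Fin (n + 1),
      R.push (SymPower.add (Nat.add_sub_of_le l.is_le) (S l) (S (n - l)) (S n))
        (SymPower.isFiniteType_add _ _ _ _) (R.box (R.sigma (S l) a) (R.sigma (S (n - l)) b)) :=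
  R.sigma_add S (fun k l n h => SymPower.add h (S k) (S l) (S n))
    (fun _ _ _ _ => SymPower.isFiniteType_add _ _ _ _) (fun _ _ _ _ => SymPower.π_add _ _ _ _)
    n a b

theorem sigma_zero' {X : SchC} (S : SymPower X 0) (a : R.obj X) : R.sigma S a = R.unit S.obj :=
  R.sigma_zero S a

/-- The contribution `σ⁰(a) ⊞ σⁿ(b)` to `σⁿ(a + b)` is `σⁿ(b)`, because `Sym⁰(X)` is a point. -/
theorem push_add_zero_left {X : SchC} {k l n : ℕ} (h : k + l = n) (hk : k = 0)
    (S : SymPower X k) (S' : SymPower X l) (S'' : SymPower X n) (a b : R.obj X) :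
    R.push (SymPower.add h S S' S'') (SymPower.isFiniteType_add _ _ _ _)
      (R.box (R.sigma S a) (R.sigma S' b)) = R.sigma S'' b := by
  subst hk
  obtain rfl : l = n := by omega
  have : IsIso (toUnit S.obj) := by
    have : IsIso (toUnit (power X 0)) :=
      ⟨Pi.lift fun i => i.elim0, power_hom_ext fun i => i.elim0, toUnit_unique _ _⟩
    rw [toUnit_unique (toUnit S.obj) (inv S.π ≫ toUnit _)]
    infer_instance
  have : IsIso (snd S.obj S'.obj) := by
    have : snd S.obj S'.obj = toUnit S.obj ▷ S'.obj ≫ snd (𝟙_ SchC) S'.obj := by simp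
    rw [this, ← leftUnitor_hom]
    infer_instance
  have h1 : SymPower.add h S S' S'' = snd S.obj S'.obj ≫ SymPower.map (𝟙 X) S' S'' := by
    rw [← cancel_epi (S.π ⊗ₘ S'.π), SymPower.π_add, concat_zero_left, tensorHom_snd_assoc,
      SymPower.π_map, powerMap_id, Category.id_comp]
  rw [sigma_zero', unit_box, R.push_congr h1 _ ((IsFiniteType.of_isIso _).comp
    (SymPower.isFiniteType_map (.id X) _ _)), R.push_comp _ _ (IsFiniteType.of_isIso _)
      (SymPower.isFiniteType_map (.id X) _ _),
    R.push_pull_of_isIso, R.push_sigma_map_id]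

/-- The contribution `σⁿ(a) ⊞ σ⁰(b)` to `σⁿ(a + b)` is `σⁿ(a)`. -/
theorem push_add_zero_right {X : SchC} {k l n : ℕ} (h : k + l = n) (hl : l = 0)
    (S : SymPower X k) (S' : SymPower X l) (S'' : SymPower X n) (a b : R.obj X) :
    R.push (SymPower.add h S S' S'') (SymPower.isFiniteType_add _ _ _ _)
      (R.box (R.sigma S a) (R.sigma S' b)) = R.sigma S'' a := by
  subst hl
  obtain rfl : k = n := by omega
  have : IsIso (toUnit S'.obj) := by
    have : IsIso (toUnit (power X 0)) :=
      ⟨Pi.lift fun i => i.elim0, power_hom_ext fun i => i.elim0, toUnit_unique _ _⟩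
    rw [toUnit_unique (toUnit S'.obj) (inv S'.π ≫ toUnit _)]
    infer_instance
  have : IsIso (fst S.obj S'.obj) := by
    have : fst S.obj S'.obj = S.obj ◁ toUnit S'.obj ≫ fst S.obj (𝟙_ SchC) := by simp
    rw [this, ← rightUnitor_hom]
    infer_instance
  have h1 : SymPower.add h S S' S'' = fst S.obj S'.obj ≫ SymPower.map (𝟙 X) S S'' := by
    rw [← cancel_epi (S.π ⊗ₘ S'.π), SymPower.π_add, concat_zero_right, tensorHom_fst_assoc,
      SymPower.π_map, powerMap_id, Category.id_comp]
  rw [sigma_zero', box_unit, R.push_congr h1 _ ((IsFiniteType.of_isIso _).comp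
    (SymPower.isFiniteType_map (.id X) _ _)), R.push_comp _ _ (IsFiniteType.of_isIso _)
      (SymPower.isFiniteType_map (.id X) _ _),
    R.push_pull_of_isIso, R.push_sigma_map_id]

/-- The zero element comes from the empty subscheme, and `Symⁿ` of the empty scheme is empty for
`n > 0`. -/
theorem sigma_apply_zero {X : SchC} {n : ℕ} (hn : 0 < n) (S : SymPower X n) :
    R.sigma S 0 = 0 := by
  let E := affineOpen (X := X) ⊥ (isAffineOpen_bot _)
  let u : E ⟶ X := affineOpenι ⊥ (isAffineOpen_bot _)
  have hE : IsEmpty E.scheme := ⟨fun x => by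
    have : sch u x ∈ Set.range (sch u) := ⟨x, rfl⟩
    rw [range_affineOpenι] at this
    exact this⟩
  have hu := isFiniteType_affineOpenι (X := X) ⊥ (isAffineOpen_bot _)
  let S' := symPower E n
  have : IsEmpty S'.obj.scheme := ⟨fun s => by
    obtain ⟨x, -⟩ := S'.surjective_π s
    exact hE.false (sch (proj E ⟨0, hn⟩) x)⟩
  have := R.subsingleton_of_isEmpty S'.obj
  have h := R.push_sigma u hu S' S _ (SymPower.isFiniteType_map hu _ _) (SymPower.π_map u S' S) 0
  rw [map_zero] at h
  rw [← h, Subsingleton.elim (R.sigma S' 0) 0, map_zero]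

/-- The contribution to `σᵏ⁺ˡ` of elements supported on a closed subset `Z` vanishes on `Symⁿ(U)`
for `U` disjoint from `Z`. -/
theorem pull_push_add_eq_zero {X U Z : SchC} {j : U ⟶ X} {i : Z ⟶ X} (hi : IsFiniteType i)
    (hd : Disjoint (Set.range (sch i)) (Set.range (sch j))) {k l n : ℕ} (h : k + l = n) (hl : 0 < l)
    (S : SymPower X k) (S' : SymPower X l) (S'' : SymPower X n) (S₀ : SymPower U n)
    (m : S₀.obj ⟶ S''.obj) (hm : S₀.π ≫ m = powerMap j n ≫ S''.π) (c : R.obj S.obj)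
    (b : R.obj Z) :
    R.pull m (R.push (SymPower.add h S S' S'') (SymPower.isFiniteType_add _ _ _ _)
      (R.box c (R.sigma S' (R.push i hi b)))) = 0 := by
  let T := symPower Z l
  have h1 := R.push_sigma i hi T S' _ (SymPower.isFiniteType_map hi _ _) (SymPower.π_map i T S') b
  rw [← h1, box_push_right, ← R.push_comp]
  refine R.pull_push_eq_zero _ _ _ (Set.disjoint_left.2 ?_) _
  rintro _ ⟨y, rfl⟩ hy
  obtain ⟨z, rfl⟩ := surjective_tensorHom S.surjective_π T.surjective_π y
  rw [← sch_comp_apply] at hy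
  have h2 : (S.π ⊗ₘ T.π) ≫ S.obj ◁ SymPower.map i T S' ≫ SymPower.add h S S' S'' =
      (power X k ◁ powerMap i l ≫ concat X h) ≫ S''.π := by
    rw [Category.assoc, ← SymPower.π_add h S S' S'', ← Category.assoc, ← Category.assoc]
    congr 1
    rw [← MonoidalCategory.id_tensorHom, ← MonoidalCategory.id_tensorHom,
      MonoidalCategory.tensorHom_comp_tensorHom, MonoidalCategory.tensorHom_comp_tensorHom,
      SymPower.π_map, Category.comp_id, Category.id_comp]
  rw [h2] at hy
  have h3 := SymPower.mem_range_of_mem_range_map S₀ S'' m hm hy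
    (Fin.cast h (Fin.natAdd k ⟨0, hl⟩))
  refine Set.disjoint_left.1 hd ⟨sch (snd _ _ ≫ proj Z ⟨0, hl⟩) z, ?_⟩ h3
  change sch ((snd _ _ ≫ proj Z ⟨0, hl⟩) ≫ i) z =
    sch ((power X k ◁ powerMap i l ≫ concat X h) ≫ proj X (Fin.cast h (Fin.natAdd k ⟨0, hl⟩))) z
  rw [Category.assoc _ (concat X h), concat_proj_natAdd]
  congr 2
  simp

/-- The operations `σⁿ` commute with restriction to open subschemes. -/
theorem pull_sigma_of_isOpenImmersion {X U : SchC} {j : U ⟶ X} (hj : IsOpenImmersion (sch j))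
    (hj' : IsFiniteType j) {n : ℕ} (S : SymPower U n) (S' : SymPower X n) (m : S.obj ⟶ S'.obj)
    (hm : S.π ≫ m = powerMap j n ≫ S'.π) (a : R.obj X) :
    R.pull m (R.sigma S' a) = R.sigma S (R.pull j a) := by
  obtain ⟨Z, i, hi, hir⟩ := exists_closedComplement (sch j).opensRange
  have hi' := isFiniteType_of_isClosedImmersion hi
  obtain ⟨-, -, -, -, h⟩ := R.closed_open i j hi hj (by rw [hir, compl_compl]; rfl) hi' hj'
  have hmf : IsFiniteType m := by
    refine IsFiniteType.of_surjective_comp (u := S.π) ?_ S.surjective_π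
    rw [hm]
    exact (hj'.powerMap n).comp S'.isFiniteType_π
  have := mono_of_isOpenImmersion m (SymPower.isOpenImmersion_map hj S S' m hm)
  conv_lhs => rw [h a, add_comm]
  -- `S'` is completed to a family of symmetric powers
  classical
  let T : ∀ k, SymPower X k := Function.update (fun k => symPower X k) n S'
  have hT : T n = S' := Function.update_self ..
  clear_value T
  subst hT
  -- with `a = j_! j^* a + i_! i^* a`, only the summand without a contribution of `i_!` survives
  rw [R.sigma_add', map_sum, Finset.sum_eq_single (Fin.last n)]
  · rw [R.push_add_zero_right _ (by simp), ← R.push_sigma j hj' S (T n) m hmf hm,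
      R.pull_push_of_mono]
  · intro l _ hl
    refine R.pull_push_add_eq_zero hi' (Set.disjoint_left.2 fun x hx hx' => ?_) _ ?_ _ _ _ S m hm
      _ _
    · rw [hir] at hx
      exact hx hx'
    · have := Fin.val_lt_last hl
      omega
  · simp

/-! ### Families of generators -/

/-- Families of elements that are stable under the operations. -/
structure IsStableFamily (gen : ∀ X, Set (R.obj X)) : Prop where
  push {X Y : SchC} (u : X ⟶ Y) (hu : IsFiniteType u) {b : R.obj X} :
    b ∈ gen X → R.push u hu b ∈ gen Y
  pull {W X : SchC} (hW : IsAffine W.scheme) (w : W ⟶ X) {b : R.obj X} :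
    b ∈ gen X → R.pull w b ∈ gen W
  box {X Y : SchC} {b : R.obj X} {c : R.obj Y} : b ∈ gen X → c ∈ gen Y → R.box b c ∈ gen (X ⊗ Y)
  sigma {X : SchC} {n : ℕ} (hn : 0 < n) (S : SymPower X n) {b : R.obj X} :
    b ∈ gen X → R.sigma S b ∈ gen S.obj

/-- The elements that are combinations of generators on affine schemes. -/
def localSpan (gen : ∀ X, Set (R.obj X)) (X : SchC) : AddSubgroup (R.obj X) where
  carrier := {a | ∀ (W : SchC) (w : W ⟶ X), IsAffine W.scheme →
    R.pull w a ∈ AddSubgroup.closure (gen W)}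
  zero_mem' W w _ := by rw [map_zero]; exact zero_mem _
  add_mem' ha hb W w hW := by rw [map_add]; exact add_mem (ha W w hW) (hb W w hW)
  neg_mem' ha W w hW := by rw [map_neg]; exact neg_mem (ha W w hW)

namespace IsStableFamily

variable {R} {gen : ∀ X, Set (R.obj X)} (hgen : R.IsStableFamily gen)

include hgen

theorem push_mem_closure {X Y : SchC} (u : X ⟶ Y) (hu : IsFiniteType u) (a : R.obj X)
    (ha : a ∈ AddSubgroup.closure (gen X)) : R.push u hu a ∈ AddSubgroup.closure (gen Y) := by
  have : AddSubgroup.closure (gen X) ≤ (AddSubgroup.closure (gen Y)).comap (R.push u hu) :=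
    (AddSubgroup.closure_le _).2 fun b hb => AddSubgroup.subset_closure (hgen.push u hu hb)
  exact this ha

theorem pull_mem_closure {W X : SchC} (hW : IsAffine W.scheme) (w : W ⟶ X) (a : R.obj X)
    (ha : a ∈ AddSubgroup.closure (gen X)) : R.pull w a ∈ AddSubgroup.closure (gen W) := by
  have : AddSubgroup.closure (gen X) ≤ (AddSubgroup.closure (gen W)).comap (R.pull w) :=
    (AddSubgroup.closure_le _).2 fun b hb => AddSubgroup.subset_closure (hgen.pull hW w hb)
  exact this ha

theorem closure_le_localSpan (X : SchC) : AddSubgroup.closure (gen X) ≤ R.localSpan gen X :=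
  fun a ha _ w hW => hgen.pull_mem_closure hW w a ha

theorem mem_closure_of_locally {X : SchC} [CompactSpace X.scheme] (a : R.obj X)
    (h : ∀ x : X.scheme, ∃ U : X.scheme.Opens, x ∈ U ∧ ∀ (W : SchC) (w : W ⟶ X),
      IsAffine W.scheme → Set.range (sch w) ⊆ U → R.pull w a ∈ AddSubgroup.closure (gen W)) :
    a ∈ AddSubgroup.closure (gen X) :=
  R.mem_of_locally (fun X => AddSubgroup.closure (gen X)) hgen.push_mem_closure a h

theorem mem_closure_of_mem_localSpan {X : SchC} [CompactSpace X.scheme] {a : R.obj X}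
    (ha : a ∈ R.localSpan gen X) : a ∈ AddSubgroup.closure (gen X) :=
  hgen.mem_closure_of_locally a fun _ => ⟨⊤, trivial, fun W w hW _ => ha W w hW⟩

omit hgen in
theorem pull_mem_localSpan {X Y : SchC} (u : X ⟶ Y) {a : R.obj Y} (ha : a ∈ R.localSpan gen Y) :
    R.pull u a ∈ R.localSpan gen X := fun W w hW => by
  rw [← R.pull_comp]
  exact ha W _ hW

theorem push_mem_localSpan {X Y : SchC} (u : X ⟶ Y) (hu : IsFiniteType u) {a : R.obj X}
    (ha : a ∈ R.localSpan gen X) : R.push u hu a ∈ R.localSpan gen Y := fun W w hW => by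
  have hP := isPullback_fiberProd u w
  have hs := hP.isFiniteType hu
  rw [← R.base_change' hP hu hs]
  refine hgen.push_mem_closure _ _ _ ?_
  have : CompactSpace (fiberProd u w).scheme := by
    have := hs.quasiCompact
    exact QuasiCompact.compactSpace_of_compactSpace (sch (fiberSnd u w))
  exact hgen.mem_closure_of_mem_localSpan (pull_mem_localSpan _ ha)

theorem box_mem_closure {X Y : SchC} {a : R.obj X} {b : R.obj Y}
    (ha : a ∈ AddSubgroup.closure (gen X)) (hb : b ∈ AddSubgroup.closure (gen Y)) :
    R.box a b ∈ AddSubgroup.closure (gen (X ⊗ Y)) := by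
  have h1 : ∀ a ∈ gen X, AddSubgroup.closure (gen Y) ≤
      (AddSubgroup.closure (gen (X ⊗ Y))).comap (R.box a) := fun a ha =>
    (AddSubgroup.closure_le _).2 fun b hb => AddSubgroup.subset_closure (hgen.box ha hb)
  have h2 : AddSubgroup.closure (gen X) ≤
      (AddSubgroup.closure (gen (X ⊗ Y))).comap (R.box.flip b) :=
    (AddSubgroup.closure_le _).2 fun a ha => h1 a ha hb
  exact h2 ha

theorem box_mem_localSpan {X Y : SchC} {a : R.obj X} {b : R.obj Y} (ha : a ∈ R.localSpan gen X)
    (hb : b ∈ R.localSpan gen Y) : R.box a b ∈ R.localSpan gen (X ⊗ Y) := fun W w hW => by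
  have hw : w = lift (𝟙 W) (𝟙 W) ≫ ((w ≫ fst X Y) ⊗ₘ (w ≫ snd X Y)) := by
    apply CartesianMonoidalCategory.hom_ext <;> simp
  rw [hw, R.pull_comp, R.pull_box]
  exact hgen.pull_mem_closure hW _ _ (hgen.box_mem_closure (ha W _ hW) (hb W _ hW))

/-- The summands of `σⁿ(a + b)` are combinations of generators. The summands for `k = 0` and `l = 0`
are treated separately, as `σ⁰ = 1` need not be such a combination. -/
theorem push_add_mem_closure {X : SchC} {k l n : ℕ} (h : k + l = n) (hn : 0 < n)
    (S : SymPower X k) (S' : SymPower X l) (S'' : SymPower X n) {a b : R.obj X}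
    (ha : 0 < k → R.sigma S a ∈ AddSubgroup.closure (gen S.obj))
    (hb : 0 < l → R.sigma S' b ∈ AddSubgroup.closure (gen S'.obj)) :
    R.push (SymPower.add h S S' S'') (SymPower.isFiniteType_add _ _ _ _)
      (R.box (R.sigma S a) (R.sigma S' b)) ∈ AddSubgroup.closure (gen S''.obj) := by
  rcases Nat.eq_zero_or_pos k with hk | hk
  · rw [R.push_add_zero_left h hk]
    obtain rfl : l = n := by omega
    rw [← R.push_sigma_map_id S' S'']
    exact hgen.push_mem_closure _ _ _ (hb hn)
  · rcases Nat.eq_zero_or_pos l with hl | hl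
    · rw [R.push_add_zero_right h hl]
      obtain rfl : k = n := by omega
      rw [← R.push_sigma_map_id S S'']
      exact hgen.push_mem_closure _ _ _ (ha hn)
    · exact hgen.push_mem_closure _ _ _ (hgen.box_mem_closure (ha hk) (hb hl))

/-- For negatives, `0 = σⁿ(b + (-b))` expresses `σⁿ(-b)` by the values of `σᵏ` at `b` and by those of
`σˡ` at `-b` for `l < n`. -/
theorem sigma_mem_closure {X : SchC} {a : R.obj X} (ha : a ∈ AddSubgroup.closure (gen X)) {n : ℕ}
    (hn : 0 < n) (S : SymPower X n) : R.sigma S a ∈ AddSubgroup.closure (gen S.obj) := by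
  suffices h : ∀ n, 0 < n → R.sigma (symPower X n) a ∈
      AddSubgroup.closure (gen (symPower X n).obj) by
    rw [← R.push_sigma_map_id (symPower X n) S]
    exact hgen.push_mem_closure _ _ _ (h n hn)
  clear hn S n
  induction ha using AddSubgroup.closure_induction with
  | mem b hb => exact fun n hn => AddSubgroup.subset_closure (hgen.sigma hn _ hb)
  | zero =>
    intro n hn
    rw [R.sigma_apply_zero hn]
    exact zero_mem _
  | add b c _ _ hb hc =>
    intro n hn
    rw [R.sigma_add' n b c (symPower X)]
    exact sum_mem fun l _ => hgen.push_add_mem_closure _ hn _ _ _ (hb _) (hc _)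
  | neg b _ hb =>
    intro n
    induction n using Nat.strong_induction_on with
    | _ n ih =>
      intro hn
      have h1 := R.sigma_add' n b (-b) (symPower X)
      rw [add_neg_cancel, R.sigma_apply_zero hn, Fin.sum_univ_succ,
        R.push_add_zero_left _ (by simp)] at h1
      rw [eq_neg_of_add_eq_zero_left h1.symm]
      refine neg_mem (sum_mem fun l _ => hgen.push_add_mem_closure _ hn _ _ _ (hb _) (ih _ ?_))
      simp only [Fin.val_succ]
      omega

/-- As a finite set of points lies in an affine open subset `U` of `X`, the subsets `Symⁿ(U)` cover
`Symⁿ(X)`; on them, `σⁿ` can be computed on the affine scheme `U`. -/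
theorem sigma_mem_localSpan {X : SchC} {a : R.obj X} (ha : a ∈ R.localSpan gen X) {n : ℕ}
    (hn : 0 < n) (S : SymPower X n) : R.sigma S a ∈ R.localSpan gen S.obj := fun W w hW => by
  refine hgen.mem_closure_of_locally _ fun y => ?_
  obtain ⟨z, hz⟩ := S.surjective_π (sch w y)
  obtain ⟨U, hU, hzU⟩ := X.property.exists_affine (Set.range fun i => sch (proj X i) z)
    (Set.finite_range _)
  have hj := isOpenImmersion_affineOpenι U hU
  have hj' := isFiniteType_affineOpenι U hU
  let S₀ := symPower (affineOpen U hU) n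
  let m := SymPower.map (affineOpenι U hU) S₀ S
  have hm : S₀.π ≫ m = powerMap _ n ≫ S.π := SymPower.π_map _ _ _
  have hmo : IsOpenImmersion (sch m) := SymPower.isOpenImmersion_map hj S₀ S m hm
  refine ⟨sch w ⁻¹ᵁ (sch m).opensRange, ?_, fun W' w' hW' hw' => ?_⟩
  · obtain ⟨x, rfl⟩ := (mem_range_powerMap (affineOpenι U hU) n z).2 fun i => by
      rw [range_affineOpenι]; exact hzU ⟨i, rfl⟩
    change sch w y ∈ Set.range (sch m)
    rw [← hz, ← sch_comp_apply, ← hm]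
    exact ⟨_, rfl⟩
  · obtain ⟨l, hl⟩ := exists_lift_of_range_subset m hmo (w' ≫ w) (by
      rintro _ ⟨t, rfl⟩
      exact hw' ⟨t, rfl⟩)
    rw [← R.pull_comp, ← hl, R.pull_comp, R.pull_sigma_of_isOpenImmersion hj hj' S₀ S m hm]
    exact hgen.pull_mem_closure hW' _ _
      (hgen.sigma_mem_closure (ha _ _ (isAffine_affineOpen U hU)) hn S₀)

/-- Membership in the local span can be checked on an open cover. -/
theorem mem_localSpan_of_cover {X : SchC} {I : Type} (T : I → SchC) (j : ∀ i, T i ⟶ X)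
    (hj : ∀ i, IsOpenImmersion (sch (j i))) (hX : ∀ x : X.scheme, ∃ i, x ∈ Set.range (sch (j i)))
    {a : R.obj X} (h : ∀ i, R.pull (j i) a ∈ R.localSpan gen (T i)) : a ∈ R.localSpan gen X :=
  fun W w hW => by
  refine hgen.mem_closure_of_locally _ fun y => ?_
  obtain ⟨i, hi⟩ := hX (sch w y)
  have := hj i
  refine ⟨sch w ⁻¹ᵁ (sch (j i)).opensRange, hi, fun W' w' hW' hw' => ?_⟩
  obtain ⟨l, hl⟩ := exists_lift_of_range_subset (j i) (hj i) (w' ≫ w) (by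
    rintro _ ⟨t, rfl⟩
    exact hw' ⟨t, rfl⟩)
  rw [← R.pull_comp, ← hl, R.pull_comp]
  exact h i W' l hW'

/-- The local span in terms of connected components. -/
theorem mem_localSpan_iff {X : SchC} {a : R.obj X} : a ∈ R.localSpan gen X ↔
    ∀ (T : SchC) (j : T ⟶ X), IsComponent j → R.pull j a ∈ AddSubgroup.closure (gen T) := by
  refine ⟨fun h T j hj => ?_, fun h => ?_⟩
  · have := hj.compactSpace
    exact hgen.mem_closure_of_mem_localSpan (pull_mem_localSpan j h)
  · obtain ⟨I, T, j, hj, hX⟩ := exists_components X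
    exact hgen.mem_localSpan_of_cover T j (fun i => (hj i).isOpenImmersion)
      (fun x => (hX x).exists) fun i => hgen.closure_le_localSpan _ (h _ _ (hj i))

end IsStableFamily

end MotivicTheory

/-! ### Sums along the affine line -/

theorem line_hom_ext {T X : SchC} {f g : T ⟶ X ⊗ A1} (h : f ≫ fst X A1 = g ≫ fst X A1)
    (h' : coord (f ≫ snd X A1) = coord (g ≫ snd X A1)) : f = g :=
  CartesianMonoidalCategory.hom_ext _ _ h (coord_injective h')

theorem zeroSection_fst (X : SchC) : zeroSection X ≫ fst X A1 = 𝟙 X := lift_fst _ _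

theorem coord_zeroSection {T X : SchC} (h : T ⟶ X) : coord (h ≫ zeroSection X ≫ snd X A1) = 0 := by
  rw [zeroSection, lift_snd, coord_comp, coord_ofSection, map_zero]

theorem fiberAdd_fst (X Y : SchC) : fiberAdd X Y ≫ fst _ _ = (fst X A1 ⊗ₘ fst Y A1) :=
  lift_fst _ _

theorem coord_fiberAdd {T X Y : SchC} (h : T ⟶ (X ⊗ A1) ⊗ (Y ⊗ A1)) :
    coord (h ≫ fiberAdd X Y ≫ snd _ _) =
      coord (h ≫ fst _ _ ≫ snd X A1) + coord (h ≫ snd _ _ ≫ snd Y A1) := by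
  rw [fiberAdd, lift_snd, coord_comp, coord_ofSection, map_add, ← coord_comp, ← coord_comp]

theorem coord_comp_fiberAdd {T T' X Y : SchC} (g : T ⟶ T') (h : T' ⟶ (X ⊗ A1) ⊗ (Y ⊗ A1)) :
    coord (g ≫ h ≫ fiberAdd X Y ≫ snd _ _) =
      coord (g ≫ h ≫ fst _ _ ≫ snd X A1) + coord (g ≫ h ≫ snd _ _ ≫ snd Y A1) := by
  simpa using coord_fiberAdd (g ≫ h)

section

variable {X : SchC} {n : ℕ} {S : SymPower X n} {S' : SymPower (X ⊗ A1) n} {m : S'.obj ⟶ S.obj ⊗ A1}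

theorem IsFiberSum.π_fst (h : IsFiberSum S S' m) :
    S'.π ≫ m ≫ fst _ _ = powerMap (fst X A1) n ≫ S.π := by
  rw [← Category.assoc, h, lift_fst]

theorem IsFiberSum.coord_π (h : IsFiberSum S S' m) {T : SchC} (t : T ⟶ power (X ⊗ A1) n) :
    coord (t ≫ S'.π ≫ m ≫ snd _ _) = ∑ i, coord (t ≫ proj _ i ≫ snd X A1) := by
  rw [← Category.assoc S'.π, h, lift_snd, coord_comp, coord_ofSection, map_sum]
  simp only [← coord_comp]

theorem IsFiberSum.isFiniteType (h : IsFiberSum S S' m) : IsFiniteType m := by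
  refine .of_comp m (fst _ _) (IsFiniteType.of_surjective_comp (u := S'.π) ?_ S'.surjective_π)
  rw [h.π_fst]
  exact ((isFiniteType_fst_A1 X).powerMap n).comp S.isFiniteType_π

/-- The sum of the coordinates is compatible with the identifications of symmetric powers. -/
theorem IsFiberSum.congr (h : IsFiberSum S S' m) {T : SymPower (X ⊗ A1) n} {p : S'.obj ⟶ T.obj}
    {m' : T.obj ⟶ S.obj ⊗ A1} (hm' : IsFiberSum S T m') (hp : S'.π ≫ p = T.π) : p ≫ m' = m := by
  rw [← cancel_epi S'.π, reassoc_of% hp, hm', h]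

end

theorem exists_isFiberSum {X : SchC} {n : ℕ} (S : SymPower X n) (S' : SymPower (X ⊗ A1) n) :
    ∃ m, IsFiberSum S S' m := by
  refine S'.exists_desc _ fun e => line_hom_ext ?_ ?_
  · rw [Category.assoc, lift_fst, ← Category.assoc, SymPower.permute_powerMap, Category.assoc,
      S.permute_π]
  · rw [Category.assoc, lift_snd, coord_comp, coord_ofSection, map_sum]
    simp only [← coord_comp]
    simp only [← Category.assoc, permute_proj]
    exact Equiv.sum_comp e fun i => coord (proj (X ⊗ A1) i ≫ snd X A1)

/-- The morphism `Symⁿ(X × 𝔸¹) ⟶ Symⁿ(X) × 𝔸¹` that adds the coordinates. -/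
def fiberSum {X : SchC} {n : ℕ} (S : SymPower X n) (S' : SymPower (X ⊗ A1) n) :
    S'.obj ⟶ S.obj ⊗ A1 := (exists_isFiberSum S S').choose

theorem isFiberSum_fiberSum {X : SchC} {n : ℕ} (S : SymPower X n) (S' : SymPower (X ⊗ A1) n) :
    IsFiberSum S S' (fiberSum S S') := (exists_isFiberSum S S').choose_spec

theorem isFiniteType_fiberSum {X : SchC} {n : ℕ} (S : SymPower X n) (S' : SymPower (X ⊗ A1) n) :
    IsFiniteType (fiberSum S S') := (isFiberSum_fiberSum S S').isFiniteType

theorem fiberSum_map {X Y : SchC} {n : ℕ} (u : X ⟶ Y) (S : SymPower X n) (S' : SymPower Y n)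
    (T : SymPower (X ⊗ A1) n) (T' : SymPower (Y ⊗ A1) n) (m : S.obj ⟶ S'.obj)
    (hm : S.π ≫ m = powerMap u n ≫ S'.π) :
    fiberSum S T ≫ m ▷ A1 = SymPower.map (u ▷ A1) T T' ≫ fiberSum S' T' := by
  have h := isFiberSum_fiberSum S T
  have h' := isFiberSum_fiberSum S' T'
  rw [← cancel_epi T.π, ← Category.assoc T.π (SymPower.map _ _ _), SymPower.π_map]
  refine line_hom_ext ?_ ?_
  · simp only [Category.assoc, whiskerRight_fst]
    rw [h'.π_fst, reassoc_of% h.π_fst, hm, ← Category.assoc, ← Category.assoc]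
    congr 1
    exact power_hom_ext fun i => by simp
  · simp only [Category.assoc, whiskerRight_snd]
    have h1 := h.coord_π (𝟙 _)
    simp only [Category.id_comp] at h1
    rw [h1, h'.coord_π]
    simp

theorem zeroSection_fiberSum {X : SchC} {n : ℕ} (S : SymPower X n) (T : SymPower (X ⊗ A1) n) :
    SymPower.map (zeroSection X) S T ≫ fiberSum S T = zeroSection S.obj := by
  have h := isFiberSum_fiberSum S T
  rw [← cancel_epi S.π, ← Category.assoc S.π (SymPower.map _ _ _), SymPower.π_map]
  refine line_hom_ext ?_ ?_
  · simp only [Category.assoc, zeroSection_fst]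
    rw [h.π_fst, ← Category.assoc, Category.comp_id]
    have : powerMap (zeroSection X) n ≫ powerMap (fst X A1) n = 𝟙 _ :=
      power_hom_ext fun i => by simp [zeroSection_fst]
    rw [this, Category.id_comp]
  · simp only [Category.assoc]
    rw [h.coord_π, coord_zeroSection]
    simp [coord_zeroSection]

theorem tensorHom_powerMap_concat {X Y : SchC} (u : X ⟶ Y) {k l n : ℕ} (h : k + l = n) :
    (powerMap u k ⊗ₘ powerMap u l) ≫ concat Y h = concat X h ≫ powerMap u n := by
  subst h
  refine power_hom_ext fun i => ?_
  refine Fin.addCases (fun j => ?_) (fun j => ?_) i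
  · have h1 := concat_proj_castAdd X (rfl : k + l = k + l) j
    have h2 := concat_proj_castAdd Y (rfl : k + l = k + l) j
    simp only [Fin.cast_eq_self] at h1 h2
    rw [Category.assoc, h2, Category.assoc, limit.lift_π, Fan.mk_π_app, reassoc_of% h1,
      tensorHom_fst_assoc, limit.lift_π, Fan.mk_π_app]
  · have h1 := concat_proj_natAdd X (rfl : k + l = k + l) j
    have h2 := concat_proj_natAdd Y (rfl : k + l = k + l) j
    simp only [Fin.cast_eq_self] at h1 h2
    rw [Category.assoc, h2, Category.assoc, limit.lift_π, Fan.mk_π_app, reassoc_of% h1,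
      tensorHom_snd_assoc, limit.lift_π, Fan.mk_π_app]

/-- The sum of the coordinates of a concatenation is the sum of the two sums. -/
theorem fiberSum_add {X : SchC} {k l n : ℕ} (h : k + l = n) (S : SymPower X k) (S' : SymPower X l)
    (S'' : SymPower X n) (T : SymPower (X ⊗ A1) k) (T' : SymPower (X ⊗ A1) l)
    (T'' : SymPower (X ⊗ A1) n) (m : S.obj ⊗ S'.obj ⟶ S''.obj)
    (hm : (S.π ⊗ₘ S'.π) ≫ m = concat X h ≫ S''.π) :
    SymPower.add h T T' T'' ≫ fiberSum S'' T'' =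
      (fiberSum S T ⊗ₘ fiberSum S' T') ≫ fiberAdd S.obj S'.obj ≫ m ▷ A1 := by
  have h1 := isFiberSum_fiberSum S T
  have h2 := isFiberSum_fiberSum S' T'
  have h3 := isFiberSum_fiberSum S'' T''
  have h0 := congr_arg (· ≫ fiberSum S'' T'') (SymPower.π_add h T T' T'')
  simp only [Category.assoc] at h0
  rw [← cancel_epi (T.π ⊗ₘ T'.π), h0]
  refine line_hom_ext ?_ ?_
  · have e : (T.π ⊗ₘ T'.π) ≫ (fiberSum S T ⊗ₘ fiberSum S' T') ≫ (fst _ A1 ⊗ₘ fst _ A1) =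
        (powerMap (fst X A1) k ⊗ₘ powerMap (fst X A1) l) ≫ (S.π ⊗ₘ S'.π) := by
      apply CartesianMonoidalCategory.hom_ext
      · simp only [Category.assoc, tensorHom_fst, tensorHom_fst_assoc]
        rw [h1.π_fst]
      · simp only [Category.assoc, tensorHom_snd, tensorHom_snd_assoc]
        rw [h2.π_fst]
    have e' := congr_arg (· ≫ m) e
    simp only [Category.assoc] at e'
    simp only [Category.assoc, whiskerRight_fst]
    rw [h3.π_fst, ← Category.assoc (fiberAdd _ _), fiberAdd_fst, e', hm, ← Category.assoc,
      ← Category.assoc]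
    exact congr_arg (· ≫ S''.π) (tensorHom_powerMap_concat _ h).symm
  · simp only [Category.assoc, whiskerRight_snd]
    have h4 := coord_fiberAdd ((T.π ⊗ₘ T'.π) ≫ (fiberSum S T ⊗ₘ fiberSum S' T'))
    simp only [Category.assoc, tensorHom_fst_assoc, tensorHom_snd_assoc] at h4
    rw [h3.coord_π, h4, h1.coord_π, h2.coord_π]
    subst h
    rw [Fin.sum_univ_add]
    congr 1
    · refine Finset.sum_congr rfl fun j _ => ?_
      have h5 := concat_proj_castAdd (X ⊗ A1) (rfl : k + l = k + l) j
      rw [Fin.cast_eq_self] at h5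
      rw [reassoc_of% h5]
    · refine Finset.sum_congr rfl fun j _ => ?_
      have h5 := concat_proj_natAdd (X ⊗ A1) (rfl : k + l = k + l) j
      rw [Fin.cast_eq_self] at h5
      rw [reassoc_of% h5]

/-! ### The affine line over a cartesian square -/

theorem isPullback_whiskerRight {P X Y Z : SchC} {p : P ⟶ X} {q : P ⟶ Y} {f : X ⟶ Z} {g : Y ⟶ Z}
    (h : IsPullback p q f g) (A : SchC) : IsPullback (p ▷ A) (q ▷ A) (f ▷ A) (g ▷ A) := by
  refine isPullback_of_points ?_ (fun {T} a b hab => ?_) fun {T} l m h1 h2 => ?_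
  · rw [← MonoidalCategory.comp_whiskerRight, h.w, MonoidalCategory.comp_whiskerRight]
  · have e1 := congr_arg (· ≫ fst _ _) hab
    have e2 := congr_arg (· ≫ snd _ _) hab
    simp only [Category.assoc, whiskerRight_fst, whiskerRight_snd] at e1 e2
    refine ⟨lift (h.lift (a ≫ fst _ _) (b ≫ fst _ _) (by simpa using e1)) (a ≫ snd _ _), ?_, ?_⟩
    · apply CartesianMonoidalCategory.hom_ext <;> simp
    · apply CartesianMonoidalCategory.hom_ext
      · simp
      · simpa using e2
  · have e1 := congr_arg (· ≫ fst _ _) h1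
    have e2 := congr_arg (· ≫ fst _ _) h2
    have e3 := congr_arg (· ≫ snd _ _) h1
    simp only [Category.assoc, whiskerRight_fst, whiskerRight_snd] at e1 e2 e3
    apply CartesianMonoidalCategory.hom_ext
    · apply h.hom_ext <;> simpa
    · exact e3

theorem isPullback_zeroSection {X Y : SchC} (u : X ⟶ Y) :
    IsPullback u (zeroSection X) (zeroSection Y) (u ▷ A1) := by
  refine isPullback_of_points ?_ (fun {T} a b hab => ⟨b ≫ fst _ _, ?_, ?_⟩) fun {T} l m _ h2 => ?_
  · refine line_hom_ext ?_ ?_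
    · simp [zeroSection_fst, reassoc_of% zeroSection_fst]
    · have := coord_zeroSection (𝟙 X)
      rw [Category.id_comp] at this
      rw [Category.assoc, Category.assoc, coord_zeroSection, whiskerRight_snd, this]
  · have e1 := congr_arg (· ≫ fst _ _) hab
    simp only [Category.assoc, whiskerRight_fst, zeroSection_fst, Category.comp_id] at e1 ⊢
    exact e1.symm
  · have e2 := congr_arg (fun t => coord (t ≫ snd _ _)) hab
    simp only [Category.assoc, whiskerRight_snd, coord_zeroSection] at e2
    refine line_hom_ext ?_ ?_
    · simp [zeroSection_fst]
    · rw [Category.assoc, ← e2]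
      exact coord_zeroSection _
  · have e2 := congr_arg (· ≫ fst _ _) h2
    simpa [zeroSection_fst] using e2

/-- The square for two morphisms `u` and `v` expresses that adding the coordinates commutes with base
change of the remaining factors. Points of the fibre product are pairs of points of the two factors,
whose coordinates are those of the given point. -/
theorem isPullback_fiberAdd {X Y X' Y' : SchC} (u : X ⟶ X') (v : Y ⟶ Y') :
    IsPullback (u ▷ A1 ⊗ₘ v ▷ A1) (fiberAdd X Y) (fiberAdd X' Y') ((u ⊗ₘ v) ▷ A1) := by
  have w : (u ▷ A1 ⊗ₘ v ▷ A1) ≫ fiberAdd X' Y' = fiberAdd X Y ≫ ((u ⊗ₘ v) ▷ A1) := by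
    refine line_hom_ext ?_ ?_
    · simp only [Category.assoc, whiskerRight_fst, fiberAdd_fst]
      rw [← Category.assoc, fiberAdd_fst]
      simp
    · have := coord_fiberAdd (𝟙 ((X ⊗ A1) ⊗ (Y ⊗ A1)))
      simp only [Category.id_comp] at this
      rw [Category.assoc, coord_fiberAdd, Category.assoc, whiskerRight_snd, this]
      simp
  refine isPullback_of_points w (fun {T} a b hab => ?_) fun {T} l m h1 h2 => ?_
  · have e1 := congr_arg (· ≫ fst _ _) hab
    have e2 := congr_arg (fun t => coord (t ≫ snd _ _)) hab
    simp only [Category.assoc, whiskerRight_snd, coord_fiberAdd, whiskerRight_fst,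
      fiberAdd_fst] at e1 e2
    have e3 := congr_arg (· ≫ fst _ _) e1
    have e4 := congr_arg (· ≫ snd _ _) e1
    simp only [Category.assoc, tensorHom_fst, tensorHom_snd] at e3 e4
    refine ⟨lift (lift (b ≫ fst _ _ ≫ fst _ _) (a ≫ fst _ _ ≫ snd _ _))
      (lift (b ≫ fst _ _ ≫ snd _ _) (a ≫ snd _ _ ≫ snd _ _)), ?_, ?_⟩
    · apply CartesianMonoidalCategory.hom_ext <;> apply CartesianMonoidalCategory.hom_ext
      · simpa using e3.symm
      · simp
      · simpa using e4.symm
      · simp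
    · refine line_hom_ext ?_ ?_
      · rw [Category.assoc, fiberAdd_fst]
        apply CartesianMonoidalCategory.hom_ext <;> simp
      · rw [Category.assoc, coord_fiberAdd, ← e2]
        simp
  · have e1 := congr_arg (· ≫ fst _ _ ≫ snd _ _) h1
    have e2 := congr_arg (· ≫ snd _ _ ≫ snd _ _) h1
    have e3 := congr_arg (· ≫ fst _ _ ≫ fst _ _) h2
    have e4 := congr_arg (· ≫ fst _ _ ≫ snd _ _) h2
    simp only [Category.assoc, ← Category.assoc (fiberAdd _ _), fiberAdd_fst] at e3 e4
    simp only [Category.assoc, tensorHom_fst_assoc, tensorHom_snd_assoc, whiskerRight_snd,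
      tensorHom_fst, tensorHom_snd] at e1 e2 e3 e4
    apply CartesianMonoidalCategory.hom_ext <;> apply CartesianMonoidalCategory.hom_ext <;>
      simpa

theorem mem_range_whiskerRight {X Y : SchC} (u : X ⟶ Y) (A : SchC) (z : (Y ⊗ A).scheme) :
    z ∈ Set.range (sch (u ▷ A)) ↔ sch (fst Y A) z ∈ Set.range (sch u) := by
  rw [← MonoidalCategory.tensorHom_id, mem_range_tensorHom]
  exact and_iff_left ⟨sch (snd Y A) z, rfl⟩

theorem isOpenImmersion_whiskerRight {X Y : SchC} {u : X ⟶ Y} (hu : IsOpenImmersion (sch u))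
    (A : SchC) : IsOpenImmersion (sch (u ▷ A)) := by
  rw [← MonoidalCategory.tensorHom_id]
  exact isOpenImmersion_tensorHom hu (inferInstanceAs (IsOpenImmersion (𝟙 A.scheme)))

theorem isClosedImmersion_whiskerRight {X Y : SchC} {u : X ⟶ Y} (hu : IsClosedImmersion (sch u))
    (A : SchC) : IsClosedImmersion (sch (u ▷ A)) :=
  MorphismProperty.of_isPullback (isPullback_fst_whiskerRight u A).sch hu

namespace MotivicTheory

variable (R : MotivicTheory.{v})

/-! ### The convolution theory on the affine line -/

/-- The exterior product of the convolution theory as a biadditive map. -/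
def lineBoxHom (X Y : SchC) : R.obj (X ⊗ A1) →+ R.obj (Y ⊗ A1) →+ R.obj ((X ⊗ Y) ⊗ A1) :=
  (AddMonoidHom.compHom (R.push (fiberAdd X Y) (isFiniteType_fiberAdd X Y))).comp R.box

theorem pull_whiskerRight_zeroSection {X Y : SchC} (u : X ⟶ Y) (a : R.obj Y) :
    R.pull (u ▷ A1) (R.push (zeroSection Y) (isFiniteType_zeroSection Y) a) =
      R.push (zeroSection X) (isFiniteType_zeroSection X) (R.pull u a) :=
  (R.base_change' (isPullback_zeroSection u) _ _ a).symm

theorem pull_lineOne (X : SchC) : R.pull (toUnit X ▷ A1) R.lineOne =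
    R.push (zeroSection X) (isFiniteType_zeroSection X) (R.unit X) :=
  R.pull_whiskerRight_zeroSection _ _

/-- Pull-backs along isomorphisms are push-forwards along their inverses. Both sides are therefore
push-forwards of the same exterior product, along morphisms that agree by associativity of
addition. -/
theorem lineBox_assoc {X Y Z : SchC} (a : R.obj (X ⊗ A1)) (b : R.obj (Y ⊗ A1))
    (c : R.obj (Z ⊗ A1)) : R.linePull (α_ X Y Z).inv (R.lineBox (R.lineBox a b) c) =
      R.lineBox a (R.lineBox b c) := by
  have h1 : R.linePull (α_ X Y Z).inv (R.lineBox (R.lineBox a b) c) =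
      R.push ((α_ X Y Z).hom ▷ A1) (IsFiniteType.of_isIso _) (R.lineBox (R.lineBox a b) c) :=
    R.pull_eq_push _ _ (by rw [← MonoidalCategory.comp_whiskerRight]; simp)
      (by rw [← MonoidalCategory.comp_whiskerRight]; simp) _ _
  have h2 : R.box a (R.box b c) = R.push (α_ _ _ _).hom (IsFiniteType.of_isIso _)
      (R.box (R.box a b) c) := by
    rw [← R.box_assoc]
    exact R.pull_eq_push _ _ (by simp) (by simp) _ _
  rw [h1]
  change R.push _ _ (R.push _ _ (R.box (R.push _ _ (R.box a b)) c)) =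
    R.push _ _ (R.box a (R.push _ _ (R.box b c)))
  rw [box_push_left, box_push_right, h2, ← R.push_comp, ← R.push_comp, ← R.push_comp,
    ← R.push_comp]
  refine R.push_congr (line_hom_ext ?_ ?_) _ _ _
  · simp only [Category.assoc, whiskerRight_fst, fiberAdd_fst]
    rw [← Category.assoc (fiberAdd _ _) (fst _ _), fiberAdd_fst]
    apply CartesianMonoidalCategory.hom_ext
    · simp only [Category.assoc, associator_hom_fst, tensorHom_fst, tensorHom_fst_assoc,
        whiskerRight_fst_assoc, whiskerLeft_fst_assoc, associator_hom_fst_assoc]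
      rw [← Category.assoc (fiberAdd _ _), fiberAdd_fst, tensorHom_fst]
    · apply CartesianMonoidalCategory.hom_ext
      · simp only [Category.assoc, associator_hom_snd_fst, tensorHom_fst_assoc, tensorHom_snd,
          whiskerRight_fst_assoc, whiskerLeft_snd_assoc]
        rw [← Category.assoc (fiberAdd _ _), fiberAdd_fst,
          ← Category.assoc (fiberAdd _ _) (fst _ _), fiberAdd_fst]
        simp
      · simp only [Category.assoc, associator_hom_snd_snd, tensorHom_snd,
          whiskerRight_snd_assoc, whiskerLeft_snd_assoc]
        rw [← Category.assoc (fiberAdd _ _) (fst _ _), fiberAdd_fst]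
        simp
  · simp only [Category.assoc, whiskerRight_snd, coord_fiberAdd, coord_comp_fiberAdd,
      whiskerRight_fst_assoc, whiskerLeft_fst_assoc, whiskerLeft_snd_assoc, whiskerRight_snd_assoc]
    simp [add_assoc]

/-- Symmetry is obtained in the same way as associativity, from commutativity of addition. -/
theorem lineBox_symm {X Y : SchC} (a : R.obj (X ⊗ A1)) (b : R.obj (Y ⊗ A1)) :
    R.linePull (lift (snd X Y) (fst X Y)) (R.lineBox b a) = R.lineBox a b := by
  have e (X Y : SchC) : lift (snd X Y) (fst X Y) ≫ lift (snd Y X) (fst Y X) = 𝟙 _ := by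
    apply CartesianMonoidalCategory.hom_ext <;> simp
  have i (X Y : SchC) : IsIso (lift (snd X Y) (fst X Y)) := ⟨_, e _ _, e _ _⟩
  have h1 : R.linePull (lift (snd X Y) (fst X Y)) (R.lineBox b a) =
      R.push (lift (snd Y X) (fst Y X) ▷ A1) (IsFiniteType.of_isIso _) (R.lineBox b a) :=
    R.pull_eq_push _ _ (by rw [← MonoidalCategory.comp_whiskerRight, e]; simp)
      (by rw [← MonoidalCategory.comp_whiskerRight, e]; simp) _ _
  have h2 : R.box a b =
      R.push (lift (snd _ _) (fst _ _)) (IsFiniteType.of_isIso _) (R.box b a) := by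
    rw [← R.box_symm a b]
    exact R.pull_eq_push _ _ (e _ _) (e _ _) _ _
  rw [h1, lineBox, lineBox, h2, ← R.push_comp, ← R.push_comp]
  refine R.push_congr (line_hom_ext ?_ ?_) _ _ _
  · simp only [Category.assoc, whiskerRight_fst, fiberAdd_fst]
    rw [← Category.assoc (fiberAdd _ _), fiberAdd_fst]
    apply CartesianMonoidalCategory.hom_ext <;> simp
  · have h3 := coord_fiberAdd (𝟙 ((Y ⊗ A1) ⊗ (X ⊗ A1)))
    simp only [Category.id_comp] at h3
    simp only [Category.assoc, whiskerRight_snd, coord_fiberAdd, h3, lift_fst_assoc,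
      lift_snd_assoc]
    exact add_comm _ _

theorem lineBox_one {X : SchC} (a : R.obj (X ⊗ A1)) :
    R.lineBox a R.lineOne = R.linePull (fst X (𝟙_ SchC)) a := by
  have e (X : SchC) : lift (𝟙 X) (toUnit X) ≫ fst X (𝟙_ SchC) = 𝟙 _ := by simp
  have e' (X : SchC) : fst X (𝟙_ SchC) ≫ lift (𝟙 X) (toUnit X) = 𝟙 _ := by
    apply CartesianMonoidalCategory.hom_ext
    · simp
    · exact toUnit_unique _ _
  have i (X : SchC) : IsIso (lift (𝟙 X) (toUnit X)) := ⟨_, e _, e' _⟩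
  have h1 : R.linePull (fst X (𝟙_ SchC)) a =
      R.push (lift (𝟙 X) (toUnit X) ▷ A1) (IsFiniteType.of_isIso _) a :=
    R.pull_eq_push _ _ (by rw [← MonoidalCategory.comp_whiskerRight, e']; simp)
      (by rw [← MonoidalCategory.comp_whiskerRight, e]; simp) _ _
  have h2 : R.box a R.one = R.push (lift (𝟙 _) (toUnit _)) (IsFiniteType.of_isIso _) a := by
    rw [R.box_one]
    exact R.pull_eq_push _ _ (e' _) (e _) _ _
  rw [h1, lineBox, lineOne, box_push_right, h2, ← R.push_comp, ← R.push_comp]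
  refine R.push_congr (line_hom_ext ?_ ?_) _ _ _
  · simp only [Category.assoc, whiskerRight_fst, fiberAdd_fst]
    apply CartesianMonoidalCategory.hom_ext
    · simp
    · exact toUnit_unique _ _
  · simp only [Category.assoc, whiskerRight_snd, coord_comp_fiberAdd, whiskerLeft_fst_assoc,
      whiskerLeft_snd_assoc, lift_fst_assoc, lift_snd_assoc]
    rw [coord_zeroSection, add_zero, Category.id_comp]

theorem one_lineBox {X : SchC} (a : R.obj (X ⊗ A1)) :
    R.lineBox R.lineOne a = R.linePull (snd (𝟙_ SchC) X) a := by
  rw [← R.lineBox_symm, lineBox_one, linePull, linePull, linePull, ← R.pull_comp,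
    ← MonoidalCategory.comp_whiskerRight, lift_fst]

theorem linePull_lineBox {X Y X' Y' : SchC} (u : X ⟶ X') (v : Y ⟶ Y') (a : R.obj (X' ⊗ A1))
    (b : R.obj (Y' ⊗ A1)) :
    R.linePull (u ⊗ₘ v) (R.lineBox a b) = R.lineBox (R.linePull u a) (R.linePull v b) := by
  rw [linePull, lineBox, lineBox, linePull, linePull, ← R.pull_box]
  exact (R.base_change' (isPullback_fiberAdd u v) _ _ _).symm

theorem linePush_lineBox {X Y X' Y' : SchC} (u : X ⟶ X') (v : Y ⟶ Y') (hu : IsFiniteType u)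
    (hv : IsFiniteType v) (a : R.obj (X ⊗ A1)) (b : R.obj (Y ⊗ A1)) :
    R.linePush (u ⊗ₘ v) (hu.tensorHom hv) (R.lineBox a b) =
      R.lineBox (R.linePush u hu a) (R.linePush v hv b) := by
  rw [linePush, lineBox, lineBox, linePush, linePush, ← R.push_box, ← R.push_comp, ← R.push_comp]
  exact R.push_congr (isPullback_fiberAdd u v).w.symm _ _ _

/-- The operation `σⁿ` of the convolution theory. -/
def sigmaLine {X : SchC} {n : ℕ} (S : SymPower X n) (a : R.obj (X ⊗ A1)) : R.obj (S.obj ⊗ A1) :=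
  R.lineSigma S (symPower (X ⊗ A1) n) (fiberSum S _) (isFiniteType_fiberSum _ _) a

/-- The operation `σⁿ` on `R(X × 𝔸¹)` does not depend on the choice of `Symⁿ(X × 𝔸¹)`. -/
theorem lineSigma_eq {X : SchC} {n : ℕ} (S : SymPower X n) (S' T : SymPower (X ⊗ A1) n)
    (m : S'.obj ⟶ S.obj ⊗ A1) (hm : IsFiniteType m) (h : IsFiberSum S S' m)
    (m' : T.obj ⟶ S.obj ⊗ A1) (hm' : IsFiniteType m') (h' : IsFiberSum S T m')
    (a : R.obj (X ⊗ A1)) : R.lineSigma S S' m hm a = R.lineSigma S T m' hm' a := by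
  have hp : S'.π ≫ SymPower.map (𝟙 (X ⊗ A1)) S' T = T.π := by
    rw [SymPower.π_map, powerMap_id, Category.id_comp]
  rw [lineSigma, lineSigma, ← R.push_sigma_map_id S' T, ← R.push_comp]
  exact R.push_congr (h.congr h' hp).symm _ _ _

theorem linePush_sigmaLine {X Y : SchC} {n : ℕ} (u : X ⟶ Y) (hu : IsFiniteType u)
    (S : SymPower X n) (S' : SymPower Y n) (m : S.obj ⟶ S'.obj) (hm : IsFiniteType m)
    (h : S.π ≫ m = powerMap u n ≫ S'.π) (a : R.obj (X ⊗ A1)) :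
    R.linePush m hm (R.sigmaLine S a) = R.sigmaLine S' (R.linePush u hu a) := by
  rw [sigmaLine, sigmaLine, lineSigma, lineSigma, linePush, linePush,
    ← R.push_sigma (u ▷ A1) (hu.whiskerRight A1) (symPower (X ⊗ A1) n) _ _
      (SymPower.isFiniteType_map (hu.whiskerRight A1) _ _) (SymPower.π_map _ _ _),
    ← R.push_comp, ← R.push_comp]
  exact R.push_congr (fiberSum_map u S S' _ _ m h) _ _ _

theorem sigmaLine_add {X : SchC} (S : ∀ k, SymPower X k)
    (m : ∀ k l n, k + l = n → ((S k).obj ⊗ (S l).obj ⟶ (S n).obj))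
    (hm : ∀ k l n h, IsFiniteType (m k l n h))
    (hS : ∀ k l n h, ((S k).π ⊗ₘ (S l).π) ≫ m k l n h = concat X h ≫ (S n).π)
    (n : ℕ) (a b : R.obj (X ⊗ A1)) :
    R.sigmaLine (S n) (a + b) = ∑ l : Fin (n + 1),
      R.linePush (m l (n - l) n (Nat.add_sub_of_le l.is_le)) (hm _ _ _ _)
        (R.lineBox (R.sigmaLine (S l) a) (R.sigmaLine (S (n - l)) b)) := by
  rw [sigmaLine, lineSigma, R.sigma_add' n a b (symPower (X ⊗ A1)), map_sum]
  refine Finset.sum_congr rfl fun l _ => ?_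
  rw [sigmaLine, sigmaLine, linePush, lineBox, lineSigma, lineSigma, ← R.push_box, ← R.push_comp,
    ← R.push_comp, ← R.push_comp]
  refine R.push_congr ?_ _ _ _
  rw [fiberSum_add _ (S l) (S (n - l)) (S n) _ _ _ _ (hS _ _ _ _)]

theorem sigmaLine_one {X : SchC} (S : SymPower X 1) (a : R.obj (X ⊗ A1)) :
    R.linePull S.π (R.sigmaLine S a) = R.linePull (proj X 0) a := by
  let T := symPower (X ⊗ A1) 1
  have i (X : SchC) : IsIso (proj X (0 : Fin 1)) := ⟨Pi.lift fun _ => 𝟙 X,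
    power_hom_ext fun i => by rw [Subsingleton.elim i 0]; simp, by simp⟩
  have h1 : R.sigma T a = R.push (inv (proj _ 0) ≫ T.π) (IsFiniteType.of_isIso _) a := by
    rw [← R.push_pull_of_isIso T.π (IsFiniteType.of_isIso _) (R.sigma T a), R.sigma_one,
      R.pull_eq_push (proj _ 0) (inv (proj _ 0)) (by simp) (by simp) (IsFiniteType.of_isIso _),
      R.push_comp _ _ (IsFiniteType.of_isIso _) (IsFiniteType.of_isIso _)]
  have h2 : R.sigmaLine S a = R.push (S.π ▷ A1) (IsFiniteType.of_isIso _)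
      (R.pull (proj X 0 ▷ A1) a) := by
    rw [R.pull_eq_push (proj X 0 ▷ A1) (inv (proj X 0) ▷ A1)
      (by rw [← MonoidalCategory.comp_whiskerRight]; simp)
      (by rw [← MonoidalCategory.comp_whiskerRight]; simp) (IsFiniteType.of_isIso _),
      sigmaLine, lineSigma, h1, ← R.push_comp, ← R.push_comp]
    refine R.push_congr ?_ _ _ _
    have h := isFiberSum_fiberSum S T
    change (inv (proj _ 0) ≫ T.π) ≫ fiberSum S T = _
    rw [Category.assoc, IsIso.inv_comp_eq]
    refine line_hom_ext ?_ ?_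
    · simp only [Category.assoc, whiskerRight_fst, whiskerRight_fst_assoc]
      rw [h.π_fst, ← Category.assoc _ (inv (proj X 0)), ← Category.assoc _ (fst X A1 ≫ _)]
      congr 1
      rw [← cancel_mono (proj X (0 : Fin 1))]
      simp
    · have h3 := h.coord_π (𝟙 _)
      simp only [Category.id_comp] at h3
      simp only [Category.assoc, whiskerRight_snd]
      rw [h3]
      simp
  rw [h2]
  exact R.pull_push_of_mono _ _ _

/-- The zero section is compatible with symmetric powers, so that `σⁿ(0_! 1) = 0_! σⁿ(1)`. -/
theorem sigmaLine_unit {X : SchC} {n : ℕ} (S : SymPower X n) :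
    R.sigmaLine S (R.pull (toUnit X ▷ A1) R.lineOne) = R.pull (toUnit S.obj ▷ A1) R.lineOne := by
  rw [pull_lineOne, pull_lineOne, sigmaLine, lineSigma,
    ← R.push_sigma (zeroSection X) (isFiniteType_zeroSection X) S _ _
      (SymPower.isFiniteType_map (isFiniteType_zeroSection X) _ _) (SymPower.π_map _ _ _),
    ← R.push_comp, unit, R.sigma_unit]
  exact R.push_congr (zeroSection_fiberSum S _) _ _ _

theorem sigmaLine_zero {X : SchC} (S : SymPower X 0) (a : R.obj (X ⊗ A1)) :
    R.sigmaLine S a = R.pull (toUnit S.obj ▷ A1) R.lineOne := by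
  rw [← sigmaLine_unit, sigmaLine, sigmaLine, lineSigma, lineSigma, R.sigma_zero, R.sigma_zero]

/-- The convolution theory `X ↦ R(X × 𝔸¹)`. -/
abbrev lineTheory : MotivicTheory.{v} where
  obj X := R.obj (X ⊗ A1)
  pull u := R.linePull u
  push u hu := R.linePush u hu
  box := R.lineBoxHom _ _
  one := R.lineOne
  sigma S := R.sigmaLine S
  pull_id {X} a := by
    rw [linePull, MonoidalCategory.id_whiskerRight, R.pull_id]
  pull_comp u v a := by
    rw [linePull, MonoidalCategory.comp_whiskerRight, R.pull_comp]; rfl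
  push_id {X} a :=
    (R.push_congr (MonoidalCategory.id_whiskerRight X A1) _ _ a).trans (R.push_id a)
  push_comp u v hu hv a := by
    refine .trans ?_ (R.push_comp _ _ _ _ _)
    exact R.push_congr (MonoidalCategory.comp_whiskerRight u v A1) _ _ _
  box_assoc := R.lineBox_assoc
  box_symm := R.lineBox_symm
  box_one := R.lineBox_one
  one_box := R.one_lineBox
  bijective_components T j hj hX :=
    R.bijective_of_disjoint_cover (fun i => T i ⊗ A1) (fun i => j i ▷ A1)
      (fun i => isOpenImmersion_whiskerRight (hj i).isOpenImmersion A1) fun x => by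
        simp only [mem_range_whiskerRight]
        exact hX _
  base_change v' u' u v h hu hu' a :=
    R.base_change' (isPullback_whiskerRight (isPullback_of_sch h) A1) _ _ a
  pull_box := R.linePull_lineBox
  push_box := R.linePush_lineBox
  push_sigma := R.linePush_sigmaLine
  sigma_add := R.sigmaLine_add
  sigma_one := R.sigmaLine_one
  sigma_zero := R.sigmaLine_zero
  closed_open i j hi hj hij hi' hj' :=
    R.closed_open (i ▷ A1) (j ▷ A1) (isClosedImmersion_whiskerRight hi A1)
      (isOpenImmersion_whiskerRight hj A1) (by
        ext z
        rw [mem_range_whiskerRight, Set.mem_compl_iff, mem_range_whiskerRight, hij,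
          Set.mem_compl_iff]) _ _
  sigma_unit := R.sigmaLine_unit

end MotivicTheory

/-! ### Points of the multiplicative group and actions -/

/-- The coordinate of a point of `𝔾_m`. -/
abbrev unitCoord {T : SchC} (g : T ⟶ Gm) : Γ(T.scheme, ⊤) := coord (g ≫ GmToA1)

theorem unitCoord_comp {S T : SchC} (u : S ⟶ T) (g : T ⟶ Gm) :
    unitCoord (u ≫ g) = (sch u).appTop (unitCoord g) := by
  rw [unitCoord, Category.assoc, coord_comp]

theorem isOpenImmersion_GmToA1 : IsOpenImmersion (sch GmToA1) :=
  inferInstanceAs (IsOpenImmersion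
    (A1.scheme.basicOpen (AffineSpace.coord SpecC PUnit.unit)).ι)

theorem range_GmToA1 : Set.range (sch GmToA1) =
    (A1.scheme.basicOpen (AffineSpace.coord SpecC PUnit.unit) : Set A1.scheme) :=
  (A1.scheme.basicOpen (AffineSpace.coord SpecC PUnit.unit)).range_ι

theorem isUnit_unitCoord {T : SchC} (g : T ⟶ Gm) : IsUnit (unitCoord g) := by
  have h : IsUnit (unitCoord (𝟙 Gm)) := by
    rw [unitCoord, Category.id_comp]
    have h1 := Scheme.Opens.ι_preimage_self
      (A1.scheme.basicOpen (AffineSpace.coord SpecC PUnit.unit))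
    have h2 := Scheme.preimage_basicOpen_top (sch GmToA1) (AffineSpace.coord SpecC PUnit.unit)
    have h3 : Gm.scheme.basicOpen (coord GmToA1) = ⊤ := h2.symm.trans h1
    refine RingedSpace.isUnit_of_isUnit_germ Gm.scheme.toRingedSpace ⊤ _ fun x hx => ?_
    have h4 : x ∈ Gm.scheme.basicOpen (coord GmToA1) := by rw [h3]; trivial
    exact (Scheme.mem_basicOpen _ _ _ hx).1 h4
  have := unitCoord_comp g (𝟙 Gm)
  rw [Category.comp_id] at this
  rw [this]
  exact h.map _

theorem exists_unitCoord_eq {T : SchC} {s : Γ(T.scheme, ⊤)} (hs : IsUnit s) :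
    ∃ g : T ⟶ Gm, unitCoord g = s := by
  obtain ⟨g, hg⟩ := exists_lift_of_range_subset GmToA1 isOpenImmersion_GmToA1 (ofSection s) (by
    rw [range_GmToA1]
    rintro _ ⟨t, rfl⟩
    have h2 := Scheme.preimage_basicOpen_top (sch (ofSection s))
      (AffineSpace.coord SpecC PUnit.unit)
    have h3 : sch (ofSection s) ⁻¹ᵁ (A1.scheme.basicOpen (AffineSpace.coord SpecC PUnit.unit)) =
        T.scheme.basicOpen s := h2.trans (congr_arg _ (coord_ofSection s))
    have h4 : t ∈ T.scheme.basicOpen s := by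
      rw [Scheme.basicOpen_of_isUnit _ hs]; trivial
    rw [← h3] at h4
    exact h4)
  exact ⟨g, by rw [unitCoord, hg, coord_ofSection]⟩

theorem exists_unitCoord_eq_pow {T : SchC} (g : T ⟶ Gm) (d : ℕ) :
    ∃ h : T ⟶ Gm, unitCoord h = unitCoord g ^ d :=
  exists_unitCoord_eq ((isUnit_unitCoord g).pow d)

theorem unitCoord_injective {T : SchC} {g h : T ⟶ Gm} (e : unitCoord g = unitCoord h) : g = h := by
  have := mono_of_isOpenImmersion GmToA1 isOpenImmersion_GmToA1
  rw [← cancel_mono GmToA1]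
  exact coord_injective e

/-- The `d`-th power of a point of `𝔾_m`. -/
def unitPow {T : SchC} (g : T ⟶ Gm) (d : ℕ) : T ⟶ Gm := (exists_unitCoord_eq_pow g d).choose

theorem unitCoord_unitPow {T : SchC} (g : T ⟶ Gm) (d : ℕ) :
    unitCoord (unitPow g d) = unitCoord g ^ d := (exists_unitCoord_eq_pow g d).choose_spec

theorem comp_unitPow {S T : SchC} (u : S ⟶ T) (g : T ⟶ Gm) (d : ℕ) :
    u ≫ unitPow g d = unitPow (u ≫ g) d :=
  unitCoord_injective (by
    rw [unitCoord_comp, unitCoord_unitPow, unitCoord_unitPow, unitCoord_comp, map_pow])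

namespace GmAction

/-- The action of a point of `𝔾_m` on a point. -/
def smul {V : SchC} (ρ : GmAction V) {T : SchC} (g : T ⟶ Gm) (y : T ⟶ V) : T ⟶ V :=
  lift g y ≫ ρ.act

theorem comp_smul {V : SchC} (ρ : GmAction V) {S T : SchC} (u : S ⟶ T) (g : T ⟶ Gm) (y : T ⟶ V) :
    u ≫ ρ.smul g y = ρ.smul (u ≫ g) (u ≫ y) := by
  rw [smul, smul, ← Category.assoc, comp_lift]

theorem act_eq_smul {V : SchC} (ρ : GmAction V) : ρ.act = ρ.smul (fst _ _) (snd _ _) := by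
  rw [smul, lift_fst_snd, Category.id_comp]

theorem one_smul {V : SchC} (ρ : GmAction V) {T : SchC} {e : T ⟶ Gm} (he : unitCoord e = 1)
    (y : T ⟶ V) : ρ.smul e y = y := ρ.one_act e y he

theorem mul_smul {V : SchC} (ρ : GmAction V) {T : SchC} {g h k : T ⟶ Gm}
    (hk : unitCoord k = unitCoord g * unitCoord h) (y : T ⟶ V) :
    ρ.smul k y = ρ.smul g (ρ.smul h y) := ρ.mul_act g h k y hk

/-- An action that is given on points. -/
def ofPoints {V : SchC} (m : ∀ {T : SchC}, (T ⟶ Gm) → (T ⟶ V) → (T ⟶ V))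
    (nat : ∀ {S T : SchC} (u : S ⟶ T) (g : T ⟶ Gm) (y : T ⟶ V), u ≫ m g y = m (u ≫ g) (u ≫ y))
    (one : ∀ {T : SchC} (e : T ⟶ Gm) (y : T ⟶ V), unitCoord e = 1 → m e y = y)
    (mul : ∀ {T : SchC} (g h k : T ⟶ Gm) (y : T ⟶ V), unitCoord k = unitCoord g * unitCoord h →
      m k y = m g (m h y)) : GmAction V where
  act := m (fst _ _) (snd _ _)
  one_act e y he := by rw [nat, lift_fst, lift_snd, one e y he]
  mul_act g h k y hk := by
    rw [nat, nat, nat, lift_fst, lift_snd, lift_fst, lift_snd, lift_fst, lift_snd, mul g h k y hk]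

theorem smul_ofPoints {V : SchC} (m : ∀ {T : SchC}, (T ⟶ Gm) → (T ⟶ V) → (T ⟶ V))
    (nat : ∀ {S T : SchC} (u : S ⟶ T) (g : T ⟶ Gm) (y : T ⟶ V), u ≫ m g y = m (u ≫ g) (u ≫ y))
    (one : ∀ {T : SchC} (e : T ⟶ Gm) (y : T ⟶ V), unitCoord e = 1 → m e y = y)
    (mul : ∀ {T : SchC} (g h k : T ⟶ Gm) (y : T ⟶ V), unitCoord k = unitCoord g * unitCoord h →
      m k y = m g (m h y)) {T : SchC} (g : T ⟶ Gm) (y : T ⟶ V) :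
    (ofPoints m nat one mul).smul g y = m g y := by
  change lift g y ≫ m (fst _ _) (snd _ _) = _
  rw [nat, lift_fst, lift_snd]

theorem IsHomogeneous.smul_fst {V X : SchC} {ρ : GmAction V} {f : V ⟶ X ⊗ A1} {d : ℕ}
    (h : ρ.IsHomogeneous f d) {T : SchC} (g : T ⟶ Gm) (y : T ⟶ V) :
    ρ.smul g y ≫ f ≫ fst X A1 = y ≫ f ≫ fst X A1 := by
  rw [smul, Category.assoc, h.fst_eq, lift_snd_assoc]

theorem IsHomogeneous.coord_smul {V X : SchC} {ρ : GmAction V} {f : V ⟶ X ⊗ A1} {d : ℕ}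
    (h : ρ.IsHomogeneous f d) {T : SchC} (g : T ⟶ Gm) (y : T ⟶ V) :
    coord (ρ.smul g y ≫ f ≫ snd X A1) = unitCoord g ^ d * coord (y ≫ f ≫ snd X A1) := by
  rw [smul, Category.assoc, coord_comp, h.coord_eq, map_mul, map_pow, ← coord_comp, ← coord_comp,
    lift_fst_assoc, lift_snd_assoc]

theorem IsHomogeneous.of_points {V X : SchC} {ρ : GmAction V} {f : V ⟶ X ⊗ A1} {d : ℕ}
    (h1 : ∀ {T : SchC} (g : T ⟶ Gm) (y : T ⟶ V), ρ.smul g y ≫ f ≫ fst X A1 = y ≫ f ≫ fst X A1)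
    (h2 : ∀ {T : SchC} (g : T ⟶ Gm) (y : T ⟶ V),
      coord (ρ.smul g y ≫ f ≫ snd X A1) = unitCoord g ^ d * coord (y ≫ f ≫ snd X A1)) :
    ρ.IsHomogeneous f d :=
  ⟨by rw [act_eq_smul, h1], by rw [act_eq_smul, h2]⟩

theorem isGood_of_isAffine {V : SchC} [IsAffine V.scheme] (ρ : GmAction V) : ρ.IsGood :=
  fun _ => ⟨⊤, isAffineOpen_top _, trivial, fun _ _ => trivial⟩

theorem isHomogeneous_comp_whiskerRight {V X Y : SchC} {ρ : GmAction V} {f : V ⟶ X ⊗ A1} {d : ℕ}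
    (h : ρ.IsHomogeneous f d) (u : X ⟶ Y) : ρ.IsHomogeneous (f ≫ u ▷ A1) d := by
  refine .of_points (fun g y => ?_) fun g y => ?_
  · have := congr_arg (· ≫ u) (h.smul_fst g y)
    simpa using this
  · simpa using h.coord_smul g y

/-- The restriction of an action to an invariant open subscheme. -/
theorem exists_restrict {V U : SchC} (ρ : GmAction V) {j : U ⟶ V} (hj : IsOpenImmersion (sch j))
    (h : ∀ p : (Gm ⊗ V).scheme, sch (snd Gm V) p ∈ Set.range (sch j) →
      sch ρ.act p ∈ Set.range (sch j)) :
    ∃ ρ' : GmAction U, ∀ {T : SchC} (g : T ⟶ Gm) (y : T ⟶ U),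
      ρ'.smul g y ≫ j = ρ.smul g (y ≫ j) := by
  have := mono_of_isOpenImmersion j hj
  obtain ⟨a, ha⟩ := exists_lift_of_range_subset j hj (Gm ◁ j ≫ ρ.act) (by
    rintro _ ⟨p, rfl⟩
    refine h _ ⟨sch (snd Gm U) p, ?_⟩
    change sch (snd Gm U ≫ j) p = sch (Gm ◁ j ≫ snd Gm V) p
    rw [whiskerLeft_snd])
  have hs {T : SchC} (g : T ⟶ Gm) (y : T ⟶ U) : (lift g y ≫ a) ≫ j = ρ.smul g (y ≫ j) := by
    rw [Category.assoc, ha, lift_whiskerLeft_assoc]; rfl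
  refine ⟨⟨a, fun e y he => ?_, fun g h k y hk => ?_⟩, hs⟩
  · rw [← cancel_mono j, hs, ρ.one_smul he]
  · rw [← cancel_mono j, hs, hs, hs, ρ.mul_smul hk]

/-- The action on the fibre product along `w × id` for a homogeneous morphism. -/
theorem exists_pullback {V X W P : SchC} (ρ : GmAction V) {f : V ⟶ X ⊗ A1} {d : ℕ}
    (hf : ρ.IsHomogeneous f d) {w : W ⟶ X} {p : P ⟶ V} {q : P ⟶ W ⊗ A1}
    (h : IsPullback p q f (w ▷ A1)) : ∃ ρ' : GmAction P, ρ'.IsHomogeneous q d := by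
  let b {T : SchC} (g : T ⟶ Gm) (y : T ⟶ P) : T ⟶ W ⊗ A1 :=
    lift (y ≫ q ≫ fst _ _) (ofSection (unitCoord g ^ d * coord (y ≫ q ≫ snd _ _)))
  have hb {T : SchC} (g : T ⟶ Gm) (y : T ⟶ P) : ρ.smul g (y ≫ p) ≫ f = b g y ≫ w ▷ A1 := by
    have e1 := congr_arg (y ≫ · ≫ fst _ _) h.w
    have e2 := congr_arg (fun t => coord (y ≫ t ≫ snd _ _)) h.w
    simp only [Category.assoc, whiskerRight_fst, whiskerRight_snd] at e1 e2
    refine line_hom_ext ?_ ?_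
    · rw [Category.assoc, hf.smul_fst]
      simpa [b] using e1
    · rw [Category.assoc, hf.coord_smul, Category.assoc, e2, Category.assoc, whiskerRight_snd,
        lift_snd, coord_ofSection]
  let m {T : SchC} (g : T ⟶ Gm) (y : T ⟶ P) : T ⟶ P := h.lift _ _ (hb g y)
  have mp {T : SchC} (g : T ⟶ Gm) (y : T ⟶ P) : m g y ≫ p = ρ.smul g (y ≫ p) := h.lift_fst _ _ _
  have mq {T : SchC} (g : T ⟶ Gm) (y : T ⟶ P) : m g y ≫ q = b g y := h.lift_snd _ _ _
  have mqf {T : SchC} (g : T ⟶ Gm) (y : T ⟶ P) : m g y ≫ q ≫ fst _ _ = y ≫ q ≫ fst _ _ := by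
    rw [← Category.assoc, mq, lift_fst]
  have mqs {T : SchC} (g : T ⟶ Gm) (y : T ⟶ P) : coord (m g y ≫ q ≫ snd _ _) =
      unitCoord g ^ d * coord (y ≫ q ≫ snd _ _) := by
    rw [← Category.assoc, mq, lift_snd, coord_ofSection]
  refine ⟨ofPoints m (fun u g y => h.hom_ext ?_ (line_hom_ext ?_ ?_))
    (fun e y he => h.hom_ext ?_ (line_hom_ext ?_ ?_))
    (fun g k l y hl => h.hom_ext ?_ (line_hom_ext ?_ ?_)),
    .of_points (fun g y => ?_) fun g y => ?_⟩
  · rw [Category.assoc, mp, mp, ρ.comp_smul, Category.assoc]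
  · simp only [Category.assoc, mqf]
  · simp only [Category.assoc, mqs, coord_comp u, unitCoord_comp u, map_mul, map_pow]
  · rw [mp, ρ.one_smul he]
  · simp only [Category.assoc, mqf]
  · simp only [Category.assoc, mqs, he, one_pow, one_mul]
  · rw [mp, mp, mp, ρ.mul_smul hl]
  · simp only [Category.assoc, mqf]
  · simp only [Category.assoc, mqs, hl, mul_pow, mul_assoc]
  · rw [smul_ofPoints, mqf]
  · rw [smul_ofPoints, mqs]

/-- The action `g (v, w) = (gᵉ v, gᵈ w)` makes the product of morphisms that are homogeneous of
degrees `d` and `e` homogeneous of degree `d e`. -/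
theorem exists_tensor {V W X Y : SchC} (ρ : GmAction V) (ρ' : GmAction W) {f : V ⟶ X ⊗ A1}
    {f' : W ⟶ Y ⊗ A1} {d e : ℕ} (h : ρ.IsHomogeneous f d) (h' : ρ'.IsHomogeneous f' e) :
    ∃ ρ'' : GmAction (V ⊗ W), ρ''.IsHomogeneous ((f ⊗ₘ f') ≫ fiberAdd X Y) (d * e) := by
  have one {T : SchC} (g : T ⟶ Gm) (n : ℕ) (hg : unitCoord g = 1) :
      unitCoord (unitPow g n) = 1 := by
    rw [unitCoord_unitPow, hg, one_pow]
  have mul {T : SchC} (g k l : T ⟶ Gm) (n : ℕ) (hl : unitCoord l = unitCoord g * unitCoord k) :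
      unitCoord (unitPow l n) = unitCoord (unitPow g n) * unitCoord (unitPow k n) := by
    rw [unitCoord_unitPow, unitCoord_unitPow, unitCoord_unitPow, hl, mul_pow]
  refine ⟨ofPoints (fun g y => lift (ρ.smul (unitPow g e) (y ≫ fst _ _))
    (ρ'.smul (unitPow g d) (y ≫ snd _ _))) (fun u g y => ?_) (fun g y hg => ?_)
    (fun g k l y hl => ?_), .of_points (fun g y => ?_) fun g y => ?_⟩
  · rw [comp_lift, comp_smul, comp_smul, comp_unitPow, comp_unitPow, Category.assoc,
      Category.assoc]
  · rw [ρ.one_smul (one _ _ hg), ρ'.one_smul (one _ _ hg)]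
    apply CartesianMonoidalCategory.hom_ext <;> simp
  · rw [lift_fst, lift_snd, ← ρ.mul_smul (mul g k l _ hl), ← ρ'.mul_smul (mul g k l _ hl)]
  · rw [smul_ofPoints, Category.assoc, fiberAdd_fst]
    have e1 := h.smul_fst (unitPow g e) (y ≫ fst _ _)
    have e2 := h'.smul_fst (unitPow g d) (y ≫ snd _ _)
    apply CartesianMonoidalCategory.hom_ext
    · simpa using e1
    · simpa using e2
  · rw [smul_ofPoints, Category.assoc, coord_comp_fiberAdd, coord_comp_fiberAdd]
    have e1 := h.coord_smul (unitPow g e) (y ≫ fst _ _)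
    have e2 := h'.coord_smul (unitPow g d) (y ≫ snd _ _)
    rw [unitCoord_unitPow, ← pow_mul, Category.assoc] at e1 e2
    simp only [tensorHom_fst_assoc, tensorHom_snd_assoc, lift_fst_assoc, lift_snd_assoc]
    rw [e1, e2, mul_comm e d, mul_add]

/-- Actions descend to quotients. -/
theorem exists_desc {V Q : SchC} (ρ : GmAction V) (π : V ⟶ Q) (hπ : ∀ Z : SchC, Epi (Z ◁ π))
    (a : Gm ⊗ Q ⟶ Q) (ha : Gm ◁ π ≫ a = ρ.act ≫ π) : ∃ ρ' : GmAction Q,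
      ∀ {T : SchC} (g : T ⟶ Gm) (y : T ⟶ V), ρ'.smul g (y ≫ π) = ρ.smul g y ≫ π := by
  have hs {T : SchC} (g : T ⟶ Gm) (y : T ⟶ V) : lift g (y ≫ π) ≫ a = ρ.smul g y ≫ π := by
    rw [smul, Category.assoc, ← ha, lift_whiskerLeft_assoc]
  refine ⟨⟨a, fun {T} e y he => ?_, fun {T} g h k y hk => ?_⟩, hs⟩
  -- both axioms are checked for the projection of `T ⊗ Q`, where they can be tested on `T ⊗ V`
  · have h1 : lift (fst T Q ≫ e) (snd T Q) ≫ a = snd T Q := by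
      rw [← cancel_epi (T ◁ π), whiskerLeft_snd, ← Category.assoc, comp_lift, whiskerLeft_snd, hs,
        ρ.one_smul]
      rw [← Category.assoc, unitCoord_comp, show unitCoord e = 1 from he, map_one]
    have h2 := congr_arg (lift (𝟙 T) y ≫ ·) h1
    simp only [← Category.assoc, comp_lift] at h2
    simpa using h2
  · have h1 : lift (fst T Q ≫ k) (snd T Q) ≫ a =
        lift (fst T Q ≫ g) (lift (fst T Q ≫ h) (snd T Q) ≫ a) ≫ a := by
      rw [← cancel_epi (T ◁ π)]
      simp only [← Category.assoc, comp_lift, whiskerLeft_snd, hs, whiskerLeft_fst]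
      rw [ρ.mul_smul]
      rw [unitCoord_comp, unitCoord_comp, unitCoord_comp, ← map_mul]
      exact congr_arg _ hk
    have h2 := congr_arg (lift (𝟙 T) y ≫ ·) h1
    simp only [← Category.assoc, comp_lift] at h2
    simpa using h2

/-- The diagonal action on `Symⁿ(V)` makes the sum of a homogeneous morphism homogeneous. -/
theorem exists_sym {V X : SchC} (ρ : GmAction V) {f : V ⟶ X ⊗ A1} {d : ℕ}
    (h : ρ.IsHomogeneous f d) {n : ℕ} (T : SymPower V n) (S : SymPower X n)
    (S' : SymPower (X ⊗ A1) n) {m : S'.obj ⟶ S.obj ⊗ A1} (hm : IsFiberSum S S' m) :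
    ∃ ρ' : GmAction T.obj, ρ'.IsHomogeneous (SymPower.map f T S' ≫ m) d := by
  let a {Z : SchC} (g : Z ⟶ Gm) (y : Z ⟶ power V n) : Z ⟶ power V n :=
    Pi.lift fun i => ρ.smul g (y ≫ proj V i)
  have ap {Z : SchC} (g : Z ⟶ Gm) (y : Z ⟶ power V n) (i : Fin n) :
      a g y ≫ proj V i = ρ.smul g (y ≫ proj V i) := limit.lift_π _ _
  let ρ₁ : GmAction (power V n) := ofPoints a
    (fun u g y => power_hom_ext fun i => by
      rw [Category.assoc, ap, ap, comp_smul, Category.assoc])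
    (fun e y he => power_hom_ext fun i => by rw [ap, ρ.one_smul he])
    (fun g k l y hl => power_hom_ext fun i => by rw [ap, ap, ap, ρ.mul_smul hl])
  have hρ₁ {Z : SchC} (g : Z ⟶ Gm) (y : Z ⟶ power V n) : ρ₁.smul g y = a g y := smul_ofPoints ..
  obtain ⟨b, hb⟩ := T.exists_desc_whiskerLeft Gm (ρ₁.act ≫ T.π) fun e => by
    rw [← Category.assoc]
    have : Gm ◁ permute V e ≫ ρ₁.act = ρ₁.act ≫ permute V e := power_hom_ext fun i => by
      rw [act_eq_smul, comp_smul, hρ₁, hρ₁, ap, Category.assoc, Category.assoc, permute_proj, ap,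
        whiskerLeft_fst, whiskerLeft_snd_assoc, permute_proj]
    rw [this, Category.assoc, T.permute_π]
  obtain ⟨ρ₂, hρ₂⟩ := ρ₁.exists_desc T.π (fun Z => inferInstance) b hb
  have key {Z : SchC} (z : Z ⟶ power V n) : z ≫ T.π ≫ SymPower.map f T S' ≫ m =
      lift ((z ≫ powerMap (f ≫ fst X A1) n) ≫ S.π)
        (ofSection (∑ i, coord (z ≫ proj V i ≫ f ≫ snd X A1))) := by
    rw [← Category.assoc T.π, SymPower.π_map]
    refine line_hom_ext ?_ ?_
    · simp only [Category.assoc, lift_fst]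
      rw [hm.π_fst, ← Category.assoc (powerMap f n)]
      congr 2
      exact power_hom_ext fun i => by simp
    · rw [Category.assoc, Category.assoc, Category.assoc, ← Category.assoc z, hm.coord_π, lift_snd,
        coord_ofSection]
      simp
  refine ⟨ρ₂, ?_, ?_⟩
  · rw [← cancel_epi (Gm ◁ T.π), act_eq_smul, ← Category.assoc, comp_smul, whiskerLeft_snd, hρ₂,
      hρ₁, whiskerLeft_snd_assoc, whiskerLeft_fst]
    have e1 := congr_arg (· ≫ fst _ _) (key (a (fst Gm _) (snd Gm _)))
    have e2 := congr_arg (· ≫ fst _ _) (key (snd Gm _))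
    simp only [Category.assoc, lift_fst] at e1 e2
    rw [Category.assoc, Category.assoc, e1, e2, ← Category.assoc, ← Category.assoc]
    congr 1
    refine power_hom_ext fun i => ?_
    simp only [Category.assoc, limit.lift_π, Fan.mk_π_app]
    rw [← Category.assoc, ap, h.smul_fst, Category.assoc]
  · suffices h1 : ρ₂.act ≫ (SymPower.map f T S' ≫ m) ≫ snd _ _ =
        ofSection (coord (fst Gm T.obj ≫ GmToA1) ^ d *
          coord (snd Gm T.obj ≫ (SymPower.map f T S' ≫ m) ≫ snd _ _)) by
      rw [h1, coord_ofSection]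
    have e1 := congr_arg (fun t => coord (t ≫ snd _ _)) (key (a (fst Gm _) (snd Gm _)))
    have e2 := congr_arg (fun t => coord (t ≫ snd _ _)) (key (snd Gm _))
    simp only [Category.assoc, lift_snd, coord_ofSection] at e1 e2
    rw [← cancel_epi (Gm ◁ T.π), comp_ofSection, map_mul, map_pow, ← coord_comp, ← coord_comp,
      act_eq_smul, ← Category.assoc, comp_smul, whiskerLeft_snd, hρ₂, hρ₁, whiskerLeft_snd_assoc,
      whiskerLeft_fst, whiskerLeft_fst_assoc]
    refine coord_injective ?_
    rw [coord_ofSection]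
    simp only [Category.assoc]
    rw [e1, e2, Finset.mul_sum]
    refine Finset.sum_congr rfl fun i _ => ?_
    rw [← Category.assoc, ap, h.coord_smul, Category.assoc]

end GmAction

/-! ### Translations of the symmetric powers of `V × 𝔸¹` -/

/-- Functions `1 / n` that are compatible with pull-backs. -/
theorem exists_inverse_natCast {n : ℕ} (hn : 0 < n) : ∃ c : ∀ T : SchC, Γ(T.scheme, ⊤),
    (∀ {S T : SchC} (u : S ⟶ T), (sch u).appTop (c T) = c S) ∧ ∀ T, n * c T = 1 := by
  have h1 : IsUnit ((n : ℕ) : Γ(SpecC, ⊤)) := by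
    have h2 : IsUnit ((n : ℕ) : ℂ) := IsUnit.mk0 _ (by exact_mod_cast hn.ne')
    have := h2.map (Scheme.ΓSpecIso (.of ℂ)).inv.hom
    rwa [map_natCast] at this
  obtain ⟨c₀, hc₀⟩ := h1.exists_right_inv
  refine ⟨fun T => (sch (toUnit T)).appTop c₀, fun {S T} u => ?_, fun T => ?_⟩
  · change (sch u).appTop ((sch (toUnit T)).appTop c₀) = (sch (toUnit S)).appTop c₀
    rw [← toUnit_unique (u ≫ toUnit T) (toUnit S), sch_comp, Scheme.Hom.comp_appTop]
    rfl
  · have h3 : (n : Γ(T.scheme, ⊤)) = (sch (toUnit T)).appTop ((n : ℕ) : Γ(SpecC, ⊤)) :=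
      (map_natCast _ n).symm
    rw [h3]
    refine (map_mul (sch (toUnit T)).appTop.hom _ _).symm.trans ?_
    rw [hc₀]
    exact map_one _

/-- The affine line acts on `Symⁿ(V × 𝔸¹)` by translations, which are normalised here such that
they translate the sum of the coordinates by the given amount. -/
theorem exists_translation {V : SchC} {n : ℕ} (hn : 0 < n) (S : SymPower V n)
    (T : SymPower (V ⊗ A1) n) : ∃ τ : T.obj ⊗ A1 ⟶ T.obj,
      (∀ {Z : SchC} (q : Z ⟶ T.obj) (t t' t'' : Z ⟶ A1), coord t'' = coord t + coord t' →
        lift (lift q t ≫ τ) t' ≫ τ = lift q t'' ≫ τ) ∧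
      (∀ {Z : SchC} (q : Z ⟶ T.obj) (t : Z ⟶ A1), coord t = 0 → lift q t ≫ τ = q) ∧
      (∀ {Z : SchC} (q : Z ⟶ T.obj) (t : Z ⟶ A1),
        lift q t ≫ τ ≫ fiberSum S T ≫ fst _ _ = q ≫ fiberSum S T ≫ fst _ _) ∧
      ∀ {Z : SchC} (q : Z ⟶ T.obj) (t : Z ⟶ A1), coord (lift q t ≫ τ ≫ fiberSum S T ≫ snd _ _) =
        coord (q ≫ fiberSum S T ≫ snd _ _) + coord t := by
  obtain ⟨c, hc, hnc⟩ := exists_inverse_natCast hn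
  have hs := isFiberSum_fiberSum S T
  -- the translation of points of `(V × 𝔸¹)ⁿ`
  let a {Z : SchC} (x : Z ⟶ power (V ⊗ A1) n) (t : Z ⟶ A1) : Z ⟶ power (V ⊗ A1) n :=
    Pi.lift fun i => lift (x ≫ proj _ i ≫ fst _ _)
      (ofSection (coord (x ≫ proj _ i ≫ snd _ _) + c Z * coord t))
  have ap {Z : SchC} (x : Z ⟶ power (V ⊗ A1) n) (t : Z ⟶ A1) (i : Fin n) : a x t ≫ proj _ i =
      lift (x ≫ proj _ i ≫ fst _ _) (ofSection (coord (x ≫ proj _ i ≫ snd _ _) + c Z * coord t)) :=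
    limit.lift_π _ _
  have af {Z : SchC} (x : Z ⟶ power (V ⊗ A1) n) (t : Z ⟶ A1) (i : Fin n) :
      a x t ≫ proj _ i ≫ fst _ _ = x ≫ proj _ i ≫ fst _ _ := by
    rw [← Category.assoc, ap, lift_fst]
  have as {Z : SchC} (x : Z ⟶ power (V ⊗ A1) n) (t : Z ⟶ A1) (i : Fin n) :
      coord (a x t ≫ proj _ i ≫ snd _ _) = coord (x ≫ proj _ i ≫ snd _ _) + c Z * coord t := by
    rw [← Category.assoc, ap, lift_snd, coord_ofSection]
  have ha {Y Z : SchC} (u : Y ⟶ Z) (x : Z ⟶ power (V ⊗ A1) n) (t : Z ⟶ A1) :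
      u ≫ a x t = a (u ≫ x) (u ≫ t) := power_hom_ext fun i => line_hom_ext
    (by simp only [Category.assoc, af])
    (by simp only [Category.assoc, as, coord_comp u, map_add, map_mul, hc])
  obtain ⟨τ, hτ⟩ := T.exists_desc_whiskerRight A1 (a (fst _ _) (snd _ _) ≫ T.π) fun e => by
    rw [← Category.assoc, ha]
    have : a (permute (V ⊗ A1) e ▷ A1 ≫ fst _ _) (permute (V ⊗ A1) e ▷ A1 ≫ snd _ _) =
        a (fst _ _) (snd _ _) ≫ permute (V ⊗ A1) e := by
      refine power_hom_ext fun i => ?_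
      rw [Category.assoc, permute_proj]
      refine line_hom_ext ?_ ?_
      · simp only [Category.assoc, af, whiskerRight_fst_assoc]
        rw [← Category.assoc (permute _ _), permute_proj]
      · simp only [Category.assoc, as, whiskerRight_fst_assoc, whiskerRight_snd]
        rw [← Category.assoc (permute _ _), permute_proj]
    rw [this, Category.assoc, T.permute_π]
  have hτ' {Z : SchC} (x : Z ⟶ power (V ⊗ A1) n) (t : Z ⟶ A1) :
      lift (x ≫ T.π) t ≫ τ = a x t ≫ T.π := by
    rw [← lift_whiskerRight_assoc, hτ, ← Category.assoc, ha, lift_fst, lift_snd]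
  -- identities between morphisms from `Z ⊗ Symⁿ` are tested on `Z ⊗ (V × 𝔸¹)ⁿ`
  have key {Z W : SchC} (q : Z ⟶ T.obj) (φ γ : Z ⊗ T.obj ⟶ W) (h : Z ◁ T.π ≫ φ = Z ◁ T.π ≫ γ) :
      lift (𝟙 Z) q ≫ φ = lift (𝟙 Z) q ≫ γ := by
    rw [(cancel_epi (Z ◁ T.π)).1 h]
  refine ⟨τ, fun {Z} q t t' t'' h => ?_, fun {Z} q t h => ?_, fun {Z} q t => ?_,
    fun {Z} q t => ?_⟩
  · have h1 := key q (lift (lift (snd _ _) (fst _ _ ≫ t) ≫ τ) (fst _ _ ≫ t') ≫ τ)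
      (lift (snd _ _) (fst _ _ ≫ t'') ≫ τ) (by
        simp only [← Category.assoc, comp_lift, whiskerLeft_snd, whiskerLeft_fst, hτ']
        congr 1
        refine power_hom_ext fun i => line_hom_ext ?_ ?_
        · simp only [Category.assoc, af]
        · simp only [Category.assoc, as, coord_comp (fst _ _), h, map_add]
          ring)
    simpa only [← Category.assoc, comp_lift, lift_fst, lift_snd, Category.id_comp] using h1
  · have h1 := key q (lift (snd _ _) (fst _ _ ≫ t) ≫ τ) (snd _ _) (by
        simp only [← Category.assoc, comp_lift, whiskerLeft_snd, whiskerLeft_fst, hτ']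
        congr 1
        refine power_hom_ext fun i => line_hom_ext ?_ ?_
        · simp only [Category.assoc, af]
        · simp only [Category.assoc, as, coord_comp (fst _ _), h, map_zero, mul_zero, add_zero])
    simpa only [← Category.assoc, comp_lift, lift_fst, lift_snd, Category.id_comp] using h1
  · have h1 := key q (lift (snd _ _) (fst _ _ ≫ t) ≫ τ ≫ fiberSum S T ≫ fst _ _)
      (snd _ _ ≫ fiberSum S T ≫ fst _ _) (by
        rw [← Category.assoc, comp_lift, whiskerLeft_snd, ← Category.assoc _ (fst _ _),
          whiskerLeft_fst, ← Category.assoc _ τ, hτ', whiskerLeft_snd_assoc, Category.assoc,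
          hs.π_fst, ← Category.assoc, ← Category.assoc]
        congr 1
        refine power_hom_ext fun i => ?_
        simp only [Category.assoc, limit.lift_π, Fan.mk_π_app, af])
    rw [← Category.assoc, comp_lift, lift_snd, lift_fst_assoc, lift_snd_assoc,
      Category.id_comp] at h1
    exact h1
  · have h1 := key q (lift (snd _ _) (fst _ _ ≫ t) ≫ τ ≫ fiberSum S T ≫ snd _ _)
      (ofSection (coord (snd _ _ ≫ fiberSum S T ≫ snd _ _) + coord (fst _ _ ≫ t))) (by
        refine coord_injective ?_
        rw [← Category.assoc, comp_lift, whiskerLeft_snd, ← Category.assoc _ (fst _ _),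
          whiskerLeft_fst, ← Category.assoc _ τ, hτ', comp_ofSection, coord_ofSection, map_add,
          ← coord_comp, ← coord_comp, whiskerLeft_snd_assoc, whiskerLeft_fst_assoc, Category.assoc,
          hs.coord_π, hs.coord_π]
        simp only [as]
        rw [Finset.sum_add_distrib, Finset.sum_const, Finset.card_univ, Fintype.card_fin,
          nsmul_eq_mul, ← mul_assoc, hnc, one_mul])
    have h2 := congr_arg coord h1
    rw [← Category.assoc, comp_lift, lift_snd, lift_fst_assoc, Category.id_comp, comp_ofSection,
      coord_ofSection, map_add, ← coord_comp, ← coord_comp, lift_fst_assoc, lift_snd_assoc,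
      Category.id_comp] at h2
    exact h2

/-- `Symⁿ(V × 𝔸¹)` is the product of `𝔸¹` and the subscheme `K` of the tuples with sum zero. -/
theorem exists_fiberSum_eq {V : SchC} [IsAffine V.scheme] {n : ℕ} (hn : 0 < n) (S : SymPower V n)
    (T : SymPower (V ⊗ A1) n) : ∃ (K : SchC) (κ : K ⟶ S.obj) (φ : K ⊗ A1 ⟶ T.obj),
      IsAffine K.scheme ∧ IsFiniteType κ ∧ IsIso φ ∧ φ ≫ fiberSum S T = κ ▷ A1 := by
  obtain ⟨τ, hA, hB, hC, hD⟩ := exists_translation hn S T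
  have hK := isPullback_fiberProd (fiberSum S T) (zeroSection S.obj)
  have : IsAffine (V ⊗ A1).scheme := isAffine_tensor V A1
  let s : T.obj ⟶ A1 := fiberSum S T ≫ snd _ _
  let k := fiberFst (fiberSum S T) (zeroSection S.obj)
  let κ := fiberSnd (fiberSum S T) (zeroSection S.obj)
  have hk1 : k ≫ fiberSum S T ≫ fst _ _ = κ := by
    have := congr_arg (· ≫ fst _ _) hK.w
    simpa only [Category.assoc, zeroSection_fst, Category.comp_id] using this
  have hk2 {Z : SchC} (z : Z ⟶ _) : coord ((z ≫ k) ≫ fiberSum S T ≫ snd _ _) = 0 := by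
    have := congr_arg (fun t => coord (z ≫ t ≫ snd _ _)) hK.w
    simp only [Category.assoc] at this ⊢
    rw [this, ← Category.assoc, coord_zeroSection]
  let φ : fiberProd (fiberSum S T) (zeroSection S.obj) ⊗ A1 ⟶ T.obj :=
    lift (fst _ _ ≫ k) (snd _ _) ≫ τ
  have h1 : (lift (𝟙 _) (ofSection (-coord s)) ≫ τ) ≫ fiberSum S T =
      (fiberSum S T ≫ fst _ _) ≫ zeroSection S.obj := by
    refine line_hom_ext ?_ ?_
    · rw [Category.assoc, Category.assoc, hC, Category.id_comp, Category.assoc, zeroSection_fst,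
        Category.comp_id]
    · rw [Category.assoc, Category.assoc, hD, Category.id_comp, coord_ofSection, add_neg_cancel,
        Category.assoc, coord_zeroSection]
  -- the inverse translates a tuple to sum zero and remembers the sum
  let ψ : T.obj ⟶ fiberProd (fiberSum S T) (zeroSection S.obj) ⊗ A1 := lift (hK.lift _ _ h1) s
  have hφ : φ ≫ fiberSum S T = κ ▷ A1 := by
    refine line_hom_ext ?_ ?_
    · rw [whiskerRight_fst, Category.assoc, Category.assoc, hC, Category.assoc, hk1]
    · rw [whiskerRight_snd, Category.assoc, Category.assoc, hD, hk2, zero_add]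
  refine ⟨_, κ, φ, isAffine_fiberProd _ _, hK.isFiniteType (isFiniteType_fiberSum _ _),
    ⟨ψ, ?_, ?_⟩, hφ⟩
  · apply CartesianMonoidalCategory.hom_ext
    · rw [Category.assoc, lift_fst, Category.id_comp]
      apply hK.hom_ext
      · rw [Category.assoc, hK.lift_fst, ← Category.assoc, comp_lift, Category.comp_id,
          hA _ _ _ (ofSection 0), hB _ _ (coord_ofSection _)]
        rw [coord_ofSection, coord_comp, coord_ofSection, map_neg, ← coord_comp, add_comm,
          eq_comm, neg_add_eq_zero, Category.assoc, hD, hk2, zero_add]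
      · rw [Category.assoc, hK.lift_snd, Category.assoc, hC, Category.assoc, hk1]
    · rw [Category.assoc, lift_snd, Category.id_comp]
      refine coord_injective ?_
      rw [Category.assoc, hD, hk2, zero_add]
  · have h2 : ψ ≫ φ = lift (lift (𝟙 _) (ofSection (-coord s)) ≫ τ) s ≫ τ := by
      rw [← Category.assoc, comp_lift, lift_fst_assoc, hK.lift_fst, lift_snd]
    rw [h2, hA _ _ _ (ofSection 0) (by rw [coord_ofSection, coord_ofSection, neg_add_cancel]),
      hB _ _ (coord_ofSection _)]

namespace MotivicTheory

variable (R : MotivicTheory.{v})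

/-! ### Geometric classes -/

/-- The classes of affine schemes over `X`. -/
def affineClasses (X : SchC) : Set (R.obj X) :=
  {b | ∃ (V : SchC) (f : V ⟶ X) (hf : IsFiniteType f), IsAffine V.scheme ∧ b = R.cls f hf}

/-- Affine schemes are stable under fibre products over separated schemes and under `Symⁿ`. -/
theorem isStableFamily_affineClasses : R.IsStableFamily R.affineClasses where
  push u hu b := by
    rintro ⟨V, f, hf, hV, rfl⟩
    exact ⟨V, _, _, hV, R.push_cls f hf u hu⟩
  pull hW w b := by
    rintro ⟨V, f, hf, hV, rfl⟩
    have h := isPullback_fiberProd f w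
    exact ⟨_, _, h.isFiniteType hf, isAffine_fiberProd f w, R.pull_cls hf h _⟩
  box := by
    rintro X Y _ _ ⟨V, f, hf, hV, rfl⟩ ⟨W, g, hg, hW, rfl⟩
    exact ⟨_, _, _, isAffine_tensor V W, R.cls_box_cls f hf g hg⟩
  sigma {X n} _ S b := by
    rintro ⟨V, f, hf, hV, rfl⟩
    exact ⟨_, _, _, inferInstance, R.sigma_cls f hf (symPower V n) S _ (SymPower.π_map _ _ _)
      (SymPower.isFiniteType_map hf _ _)⟩

theorem _root_.MotivicTheories.IsFiniteType.compactSpace {V X : SchC} {f : V ⟶ X}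
    (hf : IsFiniteType f) [CompactSpace X.scheme] : CompactSpace V.scheme := by
  have := hf.quasiCompact
  exact QuasiCompact.compactSpace_of_compactSpace (sch f)

/-- The unit of a scheme is locally the class of an affine scheme, hence a combination of classes of
affine schemes over it. -/
theorem cls_mem_closure_affineClasses {V X : SchC} [CompactSpace X.scheme] (f : V ⟶ X)
    (hf : IsFiniteType f) : R.cls f hf ∈ AddSubgroup.closure (R.affineClasses X) := by
  have := hf.compactSpace
  refine R.isStableFamily_affineClasses.push_mem_closure f hf _ ?_
  refine R.isStableFamily_affineClasses.mem_closure_of_locally _ fun x =>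
    ⟨⊤, trivial, fun W w hW _ => AddSubgroup.subset_closure ⟨W, 𝟙 W, .id W, hW, ?_⟩⟩
  rw [cls_eq, R.push_id]
  exact R.pull_unit w

theorem geometric_eq_localSpan (X : SchC) : R.geometric X = R.localSpan R.affineClasses X := by
  ext a
  rw [R.isStableFamily_affineClasses.mem_localSpan_iff]
  refine forall_congr' fun T => forall_congr' fun j => forall_congr' fun hj => ?_
  have := hj.compactSpace
  have h : AddSubgroup.closure {b | ∃ (V : SchC) (f : V ⟶ T) (hf : IsFiniteType f),
      b = R.cls f hf} = AddSubgroup.closure (R.affineClasses T) := by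
    refine le_antisymm ((AddSubgroup.closure_le _).2 ?_) (AddSubgroup.closure_mono ?_)
    · rintro _ ⟨V, f, hf, rfl⟩
      exact R.cls_mem_closure_affineClasses f hf
    · rintro _ ⟨V, f, hf, -, rfl⟩
      exact ⟨V, f, hf, rfl⟩
  rw [h]

/-! ### Homogeneous classes -/

/-- The classes of homogeneous morphisms from affine schemes with an action of `𝔾_m`. -/
def homogeneousClasses (X : SchC) : Set (R.lineTheory.obj X) :=
  {b | ∃ (V : SchC) (f : V ⟶ X ⊗ A1) (hf : IsFiniteType f) (ρ : GmAction V) (d : ℕ),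
    IsAffine V.scheme ∧ 0 < d ∧ ρ.IsHomogeneous f d ∧ b = R.cls f hf}

theorem isStableFamily_homogeneousClasses : R.lineTheory.IsStableFamily R.homogeneousClasses where
  push u hu b := by
    rintro ⟨V, f, hf, ρ, d, hV, hd, h, rfl⟩
    exact ⟨V, _, _, ρ, d, hV, hd, GmAction.isHomogeneous_comp_whiskerRight h u,
      R.push_cls f hf (u ▷ A1) (hu.whiskerRight A1)⟩
  pull {W X} hW w b := by
    rintro ⟨V, f, hf, ρ, d, hV, hd, h, rfl⟩
    have hP := isPullback_fiberProd f (w ▷ A1)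
    obtain ⟨ρ', h'⟩ := ρ.exists_pullback h hP
    have : IsAffine (W ⊗ A1).scheme := isAffine_tensor W A1
    exact ⟨_, _, hP.isFiniteType hf, ρ', d, isAffine_fiberProd _ _, hd, h', R.pull_cls hf hP _⟩
  box := by
    rintro X Y _ _ ⟨V, f, hf, ρ, d, hV, hd, h, rfl⟩ ⟨W, g, hg, ρ', e, hW, he, h', rfl⟩
    obtain ⟨ρ'', h''⟩ := ρ.exists_tensor ρ' h h'
    refine ⟨_, _, (hf.tensorHom hg).comp (isFiniteType_fiberAdd X Y), ρ'', d * e,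
      isAffine_tensor V W, Nat.mul_pos hd he, h'', ?_⟩
    rw [← R.push_cls _ (hf.tensorHom hg), ← cls_box_cls]
    rfl
  sigma {X n} _ S b := by
    rintro ⟨V, f, hf, ρ, d, hV, hd, h, rfl⟩
    obtain ⟨ρ', h'⟩ := ρ.exists_sym h (symPower V n) S (symPower (X ⊗ A1) n)
      (isFiberSum_fiberSum _ _)
    refine ⟨_, _, (SymPower.isFiniteType_map hf _ _).comp (isFiniteType_fiberSum _ _), ρ', d,
      inferInstance, hd, h', ?_⟩
    rw [← R.push_cls _ (SymPower.isFiniteType_map hf _ _),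
      ← R.sigma_cls f hf _ _ _ (SymPower.π_map _ _ _)]
    rfl

/-- The invariant affine open subsets cover the source and are closed under intersections.
By inclusion-exclusion, the unit is a combination of their classes. -/
theorem cls_mem_closure_homogeneousClasses {V X : SchC} [CompactSpace X.scheme]
    (f : V ⟶ X ⊗ A1) (hf : IsFiniteType f) (ρ : GmAction V) (hρ : ρ.IsGood) {d : ℕ} (hd : 0 < d)
    (h : ρ.IsHomogeneous f d) : R.cls f hf ∈ AddSubgroup.closure (R.homogeneousClasses X) := by
  have := (isFiniteType_fst_A1 X).compactSpace
  have := hf.compactSpace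
  let C : Set V.scheme.Opens := {U | IsAffineOpen U ∧
    ∀ p : (Gm ⊗ V).scheme, sch (snd Gm V) p ∈ U → sch ρ.act p ∈ U}
  have h1 := R.mem_closure_restrictExtend C (fun U hU => hU.1)
    (fun U hU U' hU' => ⟨hU.1.inf hU'.1, fun p hp => ⟨hU.2 p hp.1, hU'.2 p hp.2⟩⟩)
    (fun x => by
      obtain ⟨U, hU, hx, hi⟩ := hρ x
      exact ⟨U, ⟨hU, hi⟩, hx⟩) (R.unit V)
  refine (AddSubgroup.closure_le ((AddSubgroup.closure (R.homogeneousClasses X)).comap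
    (R.push f hf))).2 ?_ h1
  rintro _ ⟨U, hU, rfl⟩
  refine AddSubgroup.subset_closure ?_
  have hj := isOpenImmersion_affineOpenι U hU.1
  obtain ⟨ρ', hρ'⟩ := ρ.exists_restrict hj fun p hp => by
    rw [range_affineOpenι] at hp ⊢
    exact hU.2 p hp
  refine ⟨_, affineOpenι U hU.1 ≫ f, (isFiniteType_affineOpenι U hU.1).comp hf, ρ', d,
    isAffine_affineOpen U hU.1, hd, .of_points (fun g y => ?_) (fun g y => ?_), ?_⟩
  · have := h.smul_fst g (y ≫ affineOpenι U hU.1)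
    rw [← hρ'] at this
    simpa using this
  · have := h.coord_smul g (y ≫ affineOpenι U hU.1)
    rw [← hρ'] at this
    simpa using this
  · rw [← push_cls, cls_eq, ← R.pull_unit (affineOpenι U hU.1)]
    rfl

/-- The defining subgroup is local on the base, which is not apparent from generators with non-affine
source. -/
theorem homogeneous_eq_localSpan (X : SchC) :
    R.homogeneous X = R.lineTheory.localSpan R.homogeneousClasses X := by
  ext a
  refine Iff.trans ?_ R.isStableFamily_homogeneousClasses.mem_localSpan_iff.symm
  refine forall_congr' fun T => forall_congr' fun j => forall_congr' fun hj => ?_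
  have := hj.compactSpace
  have h : AddSubgroup.closure {b | ∃ (V : SchC) (f : V ⟶ T ⊗ A1) (hf : IsFiniteType f)
      (ρ : GmAction V) (d : ℕ), ρ.IsGood ∧ 0 < d ∧ ρ.IsHomogeneous f d ∧ b = R.cls f hf} =
        AddSubgroup.closure (R.homogeneousClasses T) := by
    refine le_antisymm ((AddSubgroup.closure_le _).2 ?_) (AddSubgroup.closure_mono ?_)
    · rintro _ ⟨V, f, hf, ρ, d, hρ, hd, h, rfl⟩
      exact R.cls_mem_closure_homogeneousClasses f hf ρ hρ hd h
    · rintro _ ⟨V, f, hf, ρ, d, hV, hd, h, rfl⟩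
      exact ⟨V, f, hf, ρ, d, ρ.isGood_of_isAffine, hd, h, rfl⟩
  rw [h]
  rfl

/-! ### The ideal of classes that are pulled back along `X × 𝔸¹ ⟶ X` -/

/-- The pull-backs of the classes of affine schemes over `X`. -/
def pulledBackClasses (X : SchC) : Set (R.lineTheory.obj X) :=
  {b | ∃ a ∈ R.affineClasses X, b = R.pull (fst X A1) a}

theorem linePull_pull_fst {X Y : SchC} (u : X ⟶ Y) (a : R.obj Y) :
    R.linePull u (R.pull (fst Y A1) a) = R.pull (fst X A1) (R.pull u a) := by
  rw [linePull, ← R.pull_comp, ← R.pull_comp, whiskerRight_fst]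

theorem linePush_pull_fst {X Y : SchC} (u : X ⟶ Y) (hu : IsFiniteType u) (a : R.obj X) :
    R.linePush u hu (R.pull (fst X A1) a) = R.pull (fst Y A1) (R.push u hu a) :=
  R.base_change' (isPullback_fst_whiskerRight u A1) hu _ a

/-- The shear `(x, z, y, w) ↦ (x, z + w, y, w)` identifies the addition of coordinates with a
projection. -/
theorem isPullback_fst_fiberAdd (X Y : SchC) : IsPullback (fst X A1 ▷ (Y ⊗ A1)) (fiberAdd X Y)
    (X ◁ fst Y A1) (fst (X ⊗ Y) A1) := by
  refine isPullback_of_points ?_ (fun {T} a b hab => ?_) fun {T} l m h1 h2 => ?_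
  · rw [fiberAdd_fst, ← MonoidalCategory.tensorHom_def]
  · have e1 := congr_arg (· ≫ fst _ _) hab
    have e2 := congr_arg (· ≫ snd _ _) hab
    simp only [Category.assoc, whiskerLeft_fst, whiskerLeft_snd] at e1 e2
    refine ⟨lift (lift (a ≫ fst _ _) (ofSection
      (coord (b ≫ snd _ _) - coord (a ≫ snd _ _ ≫ snd _ _)))) (a ≫ snd _ _), ?_, ?_⟩
    · apply CartesianMonoidalCategory.hom_ext
      · rw [Category.assoc, whiskerRight_fst, lift_fst_assoc, lift_fst]
      · rw [Category.assoc, whiskerRight_snd, lift_snd]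
    · refine line_hom_ext ?_ ?_
      · rw [Category.assoc, fiberAdd_fst]
        apply CartesianMonoidalCategory.hom_ext
        · simpa using e1
        · simpa using e2
      · rw [Category.assoc, coord_fiberAdd, lift_fst_assoc, lift_snd, lift_snd_assoc,
          coord_ofSection, Category.assoc, sub_add_cancel]
  · have e1 := congr_arg (· ≫ fst _ _) h1
    have e2 := congr_arg (· ≫ snd _ _) h1
    have e3 := congr_arg (fun t => coord (t ≫ snd _ _)) h2
    simp only [Category.assoc, whiskerRight_fst, whiskerRight_snd, coord_fiberAdd] at e1 e2 e3
    refine CartesianMonoidalCategory.hom_ext _ _ (line_hom_ext ?_ ?_) e2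
    · simpa using e1
    · have e4 := congr_arg (fun t => coord (t ≫ snd _ _)) e2
      simp only [Category.assoc] at e4 ⊢
      rw [e4] at e3
      exact add_right_cancel e3

/-- The convolution with a class that is constant along `𝔸¹` only depends on the integral of
the other factor along `𝔸¹`. -/
theorem lineBox_pull_fst {X Y : SchC} (a : R.obj X) (b : R.obj (Y ⊗ A1)) :
    R.lineBox (R.pull (fst X A1) a) b =
      R.pull (fst (X ⊗ Y) A1) (R.box a (R.push (fst Y A1) (isFiniteType_fst_A1 Y) b)) := by
  rw [lineBox, box_pull_left, box_push_right]
  exact R.base_change' (isPullback_fst_fiberAdd X Y) _ _ _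

/-- Integration along `𝔸¹` maps classes of homogeneous morphisms to geometric classes. -/
theorem push_fst_mem_geometric {X : SchC} {b : R.obj (X ⊗ A1)} (hb : b ∈ R.homogeneous X) :
    R.push (fst X A1) (isFiniteType_fst_A1 X) b ∈ R.geometric X := by
  rw [geometric_eq_localSpan]
  rw [homogeneous_eq_localSpan] at hb
  intro W w hW
  have h1 := hb W w hW
  rw [← R.base_change' (isPullback_fst_whiskerRight w A1).flip (isFiniteType_fst_A1 X)
    (isFiniteType_fst_A1 W)]
  refine (AddSubgroup.closure_le ((AddSubgroup.closure (R.affineClasses W)).comap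
    (R.push (fst W A1) (isFiniteType_fst_A1 W)))).2 ?_ h1
  rintro _ ⟨V, f, hf, -, -, hV, -, -, rfl⟩
  exact AddSubgroup.subset_closure ⟨V, _, _, hV, R.push_cls f hf _ _⟩

theorem lineBox_mem_monodromyIdeal {X Y : SchC} {a : R.obj (X ⊗ A1)} {b : R.obj (Y ⊗ A1)}
    (ha : a ∈ R.monodromyIdeal X) (hb : b ∈ R.homogeneous Y) :
    R.lineBox a b ∈ R.monodromyIdeal (X ⊗ Y) := by
  obtain ⟨a, ha, rfl⟩ := ha
  refine ⟨_, ?_, (R.lineBox_pull_fst a b).symm⟩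
  have hb' := R.push_fst_mem_geometric hb
  change a ∈ R.geometric X at ha
  change R.box a _ ∈ R.geometric (X ⊗ Y)
  rw [geometric_eq_localSpan] at ha hb' ⊢
  exact R.isStableFamily_affineClasses.box_mem_localSpan ha hb'

theorem pull_fst_cls {V X : SchC} (f : V ⟶ X) (hf : IsFiniteType f) :
    R.pull (fst X A1) (R.cls f hf) = R.cls (f ▷ A1) (hf.whiskerRight A1) :=
  R.pull_cls hf (isPullback_fst_whiskerRight f A1) _

/-- `σⁿ` preserves classes that are constant along `𝔸¹`, as `Symⁿ(V × 𝔸¹)` is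
a product with `𝔸¹` by means of the sum of the coordinates. -/
theorem sigmaLine_mem_pulledBackClasses {X : SchC} {n : ℕ} (hn : 0 < n) (S : SymPower X n)
    {b : R.obj (X ⊗ A1)} (hb : b ∈ R.pulledBackClasses X) :
    R.sigmaLine S b ∈ R.pulledBackClasses S.obj := by
  obtain ⟨_, ⟨V, f, hf, hV, rfl⟩, rfl⟩ := hb
  let T := symPower V n
  have hm := SymPower.isFiniteType_map hf T S
  obtain ⟨K, κ, φ, hK, hκ, hφ, h⟩ := exists_fiberSum_eq hn T (symPower (V ⊗ A1) n)
  refine ⟨_, ⟨K, κ ≫ SymPower.map f T S, hκ.comp hm, hK, rfl⟩, ?_⟩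
  have h1 : R.sigmaLine T (R.unit (V ⊗ A1)) = R.cls (κ ▷ A1) (hκ.whiskerRight A1) := by
    have h2 := R.push_pull_of_isIso φ (.of_isIso φ) (R.unit _)
    rw [R.pull_unit] at h2
    rw [sigmaLine, lineSigma, unit, R.sigma_unit]
    change R.push _ _ (R.unit _) = _
    rw [← h2, ← R.push_comp, cls_eq]
    exact R.push_congr h _ _ _
  have h3 : R.pull (fst X A1) (R.cls f hf) = R.linePush f hf (R.unit (V ⊗ A1)) :=
    R.pull_fst_cls f hf
  rw [h3, ← R.linePush_sigmaLine f hf T S _ hm (SymPower.π_map _ _ _), h1, ← R.pull_fst_cls _ hκ,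
    linePush_pull_fst, R.push_cls _ hκ _ hm]

theorem push_fst_mem_affineClasses {X : SchC} {b : R.obj (X ⊗ A1)}
    (hb : b ∈ R.pulledBackClasses X) :
    R.push (fst X A1) (isFiniteType_fst_A1 X) b ∈ R.affineClasses X := by
  obtain ⟨_, ⟨V, f, hf, hV, rfl⟩, rfl⟩ := hb
  rw [pull_fst_cls]
  exact ⟨V ⊗ A1, _, _, isAffine_tensor V A1,
    R.push_cls _ (hf.whiskerRight A1) _ (isFiniteType_fst_A1 X)⟩

theorem isStableFamily_pulledBackClasses : R.lineTheory.IsStableFamily R.pulledBackClasses where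
  push u hu b := by
    rintro ⟨a, ha, rfl⟩
    exact ⟨_, R.isStableFamily_affineClasses.push u hu ha, R.linePush_pull_fst u hu a⟩
  pull hW w b := by
    rintro ⟨a, ha, rfl⟩
    exact ⟨_, R.isStableFamily_affineClasses.pull hW w ha, R.linePull_pull_fst w a⟩
  box := by
    rintro X Y _ b ⟨a, ha, rfl⟩ hb
    exact ⟨_, R.isStableFamily_affineClasses.box ha (R.push_fst_mem_affineClasses hb),
      R.lineBox_pull_fst a b⟩
  sigma hn S b hb := R.sigmaLine_mem_pulledBackClasses hn S hb

theorem pull_zeroSection_pull_fst {X : SchC} (a : R.obj X) :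
    R.pull (zeroSection X) (R.pull (fst X A1) a) = a := by
  rw [← R.pull_comp, zeroSection_fst, R.pull_id]

theorem pull_pull_zeroSection {W X : SchC} (w : W ⟶ X) (b : R.obj (X ⊗ A1)) :
    R.pull w (R.pull (zeroSection X) b) = R.pull (zeroSection W) (R.linePull w b) := by
  rw [linePull, ← R.pull_comp, ← R.pull_comp, (isPullback_zeroSection w).w]

theorem pull_fst_mem_closure_pulledBackClasses {X : SchC} {a : R.obj X}
    (ha : a ∈ AddSubgroup.closure (R.affineClasses X)) :
    R.pull (fst X A1) a ∈ AddSubgroup.closure (R.pulledBackClasses X) := by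
  induction ha using AddSubgroup.closure_induction with
  | mem a ha => exact AddSubgroup.subset_closure ⟨a, ha, rfl⟩
  | zero => rw [map_zero]; exact zero_mem _
  | add a b _ _ ha hb => rw [map_add]; exact add_mem ha hb
  | neg a _ ha => rw [map_neg]; exact neg_mem ha

theorem exists_of_mem_closure_pulledBackClasses {X : SchC} {b : R.obj (X ⊗ A1)}
    (hb : b ∈ AddSubgroup.closure (R.pulledBackClasses X)) :
    ∃ a ∈ AddSubgroup.closure (R.affineClasses X), b = R.pull (fst X A1) a := by
  induction hb using AddSubgroup.closure_induction with
  | mem b hb =>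
    obtain ⟨a, ha, rfl⟩ := hb
    exact ⟨a, AddSubgroup.subset_closure ha, rfl⟩
  | zero => exact ⟨0, zero_mem _, (map_zero _).symm⟩
  | add b c _ _ hb hc =>
    obtain ⟨a, ha, rfl⟩ := hb
    obtain ⟨a', ha', rfl⟩ := hc
    exact ⟨a + a', add_mem ha ha', (map_add _ _ _).symm⟩
  | neg b _ hb =>
    obtain ⟨a, ha, rfl⟩ := hb
    exact ⟨-a, neg_mem ha, (map_neg _ _).symm⟩

theorem monodromyIdeal_eq_localSpan (X : SchC) :
    R.monodromyIdeal X = R.lineTheory.localSpan R.pulledBackClasses X := by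
  refine le_antisymm ?_ fun b hb => ?_
  · rintro _ ⟨a, ha, rfl⟩ W w hW
    change a ∈ R.geometric X at ha
    rw [geometric_eq_localSpan] at ha
    change R.linePull w (R.pull (fst X A1) a) ∈ _
    rw [linePull_pull_fst]
    exact R.pull_fst_mem_closure_pulledBackClasses (ha W w hW)
  -- an element of the right hand side is the pull-back of its restriction to the zero section
  · refine ⟨R.pull (zeroSection X) b, ?_, ?_⟩
    · change _ ∈ R.geometric X
      rw [geometric_eq_localSpan]
      intro W w hW
      obtain ⟨a, ha, h⟩ := R.exists_of_mem_closure_pulledBackClasses (hb W w hW)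
      rw [pull_pull_zeroSection]
      change R.linePull w b = _ at h
      rwa [h, pull_zeroSection_pull_fst]
    · refine R.lineTheory.eq_of_affine fun W w hW => ?_
      change R.linePull w (R.pull (fst X A1) _) = R.linePull w b
      obtain ⟨a, ha, h⟩ := R.exists_of_mem_closure_pulledBackClasses (hb W w hW)
      change R.linePull w b = _ at h
      rw [linePull_pull_fst, pull_pull_zeroSection, h, pull_zeroSection_pull_fst]

/-- The classes that are constant along `𝔸¹` are homogeneous of degree one. -/
theorem pulledBackClasses_subset (X : SchC) : R.pulledBackClasses X ⊆ R.homogeneousClasses X := by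
  rintro _ ⟨_, ⟨V, f, hf, hV, rfl⟩, rfl⟩
  -- `𝔾_m` acts on `V × 𝔸¹` by scalar multiplication on the second factor
  let m {T : SchC} (g : T ⟶ Gm) (y : T ⟶ V ⊗ A1) : T ⟶ V ⊗ A1 :=
    lift (y ≫ fst _ _) (ofSection (unitCoord g * coord (y ≫ snd _ _)))
  have mf {T : SchC} (g : T ⟶ Gm) (y : T ⟶ V ⊗ A1) : m g y ≫ fst _ _ = y ≫ fst _ _ := lift_fst _ _
  have ms {T : SchC} (g : T ⟶ Gm) (y : T ⟶ V ⊗ A1) :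
      coord (m g y ≫ snd _ _) = unitCoord g * coord (y ≫ snd _ _) := by
    rw [lift_snd, coord_ofSection]
  let ρ : GmAction (V ⊗ A1) := .ofPoints m
    (fun u g y => line_hom_ext (by simp only [Category.assoc, mf])
      (by simp only [Category.assoc, ms, coord_comp u, unitCoord_comp u, map_mul]))
    (fun e y he => line_hom_ext (mf _ _) (by rw [ms, he, one_mul]))
    (fun g h k y hk => line_hom_ext (by simp only [mf]) (by simp only [ms, hk, mul_assoc]))
  have hρ {T : SchC} (g : T ⟶ Gm) (y : T ⟶ V ⊗ A1) : ρ.smul g y = m g y :=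
    GmAction.smul_ofPoints ..
  refine ⟨V ⊗ A1, f ▷ A1, hf.whiskerRight A1, ρ, 1, isAffine_tensor V A1, one_pos,
    .of_points (fun g y => ?_) (fun g y => ?_), R.pull_fst_cls f hf⟩
  · rw [whiskerRight_fst, hρ, ← Category.assoc, mf, Category.assoc]
  · rw [whiskerRight_snd, hρ, ms, pow_one]

theorem localSpan_mono {gen gen' : ∀ X, Set (R.obj X)} (h : ∀ X, gen X ⊆ gen' X) (X : SchC) :
    R.localSpan gen X ≤ R.localSpan gen' X :=
  fun _ ha W w hW => AddSubgroup.closure_mono (h W) (ha W w hW)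

theorem monodromyIdeal_le_homogeneous (X : SchC) : R.monodromyIdeal X ≤ R.homogeneous X := by
  rw [monodromyIdeal_eq_localSpan, homogeneous_eq_localSpan]
  exact R.lineTheory.localSpan_mono R.pulledBackClasses_subset X

/-- The unit `0_! 1` is homogeneous for the trivial action, because the coordinate vanishes on the
image of the zero section. -/
theorem lineOne_mem_homogeneousClasses : R.lineOne ∈ R.homogeneousClasses (𝟙_ SchC) := by
  let ρ : GmAction (𝟙_ SchC) := .ofPoints (fun _ y => y) (fun _ _ _ => rfl) (fun _ _ _ => rfl)
    (fun _ _ _ _ _ => rfl)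
  refine ⟨𝟙_ SchC, zeroSection _, isFiniteType_zeroSection _, ρ, 1, inferInstance, one_pos,
    .of_points (fun g y => ?_) (fun g y => ?_), ?_⟩
  · rw [GmAction.smul_ofPoints]
  · rw [GmAction.smul_ofPoints, coord_zeroSection, mul_zero]
  · rw [cls, toUnit_unique (toUnit (𝟙_ SchC)) (𝟙 _), R.pull_id]
    rfl

end MotivicTheory

namespace MotivicTheory

/-! ### Quotient theories -/

/-- `H` is a subtheory of the motivic theory `M`, and `I` is a `λ`-ideal of `H`. -/
structure IsLambdaIdeal (M : MotivicTheory.{v}) (H I : ∀ X, AddSubgroup (M.obj X)) : Prop where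
  pull_mem {X Y : SchC} (u : X ⟶ Y) {a : M.obj Y} : a ∈ H Y → M.pull u a ∈ H X
  push_mem {X Y : SchC} (u : X ⟶ Y) (hu : IsFiniteType u) {a : M.obj X} :
    a ∈ H X → M.push u hu a ∈ H Y
  box_mem {X Y : SchC} {a : M.obj X} {b : M.obj Y} : a ∈ H X → b ∈ H Y → M.box a b ∈ H (X ⊗ Y)
  one_mem : M.one ∈ H (𝟙_ SchC)
  sigma_mem {X : SchC} {n : ℕ} (S : SymPower X n) {a : M.obj X} : a ∈ H X → M.sigma S a ∈ H S.obj
  mem_of_cover {X : SchC} {I : Type} (T : I → SchC) (j : ∀ i, T i ⟶ X)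
    (hj : ∀ i, IsComponent (j i)) (hX : ∀ x : X.scheme, ∃! i, x ∈ Set.range (sch (j i)))
    {a : M.obj X} : (∀ i, M.pull (j i) a ∈ H (T i)) → a ∈ H X
  pull_mem_ideal {X Y : SchC} (u : X ⟶ Y) {a : M.obj Y} : a ∈ I Y → M.pull u a ∈ I X
  push_mem_ideal {X Y : SchC} (u : X ⟶ Y) (hu : IsFiniteType u) {a : M.obj X} :
    a ∈ I X → M.push u hu a ∈ I Y
  box_mem_ideal {X Y : SchC} {a : M.obj X} {b : M.obj Y} :
    a ∈ I X → b ∈ H Y → M.box a b ∈ I (X ⊗ Y)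
  sigma_mem_ideal {X : SchC} {n : ℕ} (hn : 0 < n) (S : SymPower X n) {a : M.obj X} :
    a ∈ I X → M.sigma S a ∈ I S.obj
  mem_ideal_of_cover {X : SchC} {K : Type} (T : K → SchC) (j : ∀ i, T i ⟶ X)
    (hj : ∀ i, IsComponent (j i)) (hX : ∀ x : X.scheme, ∃! i, x ∈ Set.range (sch (j i)))
    {a : M.obj X} : (∀ i, M.pull (j i) a ∈ I (T i)) → a ∈ I X

namespace IsLambdaIdeal

variable {M : MotivicTheory.{v}} {H I : ∀ X, AddSubgroup (M.obj X)} (h : M.IsLambdaIdeal H I)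

include h in
theorem box_mem_ideal' {X Y : SchC} {a : M.obj X} {b : M.obj Y} (ha : a ∈ H X) (hb : b ∈ I Y) :
    M.box a b ∈ I (X ⊗ Y) := by
  rw [← M.box_symm]
  exact h.pull_mem_ideal _ (h.box_mem_ideal hb ha)

include h in
/-- The operation `σⁿ` is well defined modulo the ideal: all terms but one of `σⁿ(a + c)` lie in
the ideal if `c` does. -/
theorem sigma_add_sub_mem {X : SchC} {n : ℕ} (S : SymPower X n) {a c : M.obj X} (ha : a ∈ H X)
    (hc : c ∈ I X) : M.sigma S (a + c) - M.sigma S a ∈ I S.obj := by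
  rcases Nat.eq_zero_or_pos n with rfl | hn
  · rw [M.sigma_zero, M.sigma_zero, sub_self]
    exact zero_mem _
  · have h1 := M.push_sigma_map_id (symPower X n) S
    have h2 : M.sigma (symPower X n) (a + c) - M.sigma (symPower X n) a ∈
        I (symPower X n).obj := by
      rw [M.sigma_add' n a c (symPower X), Fin.sum_univ_castSucc,
        M.push_add_zero_right _ (by simp), add_sub_cancel_right]
      refine sum_mem fun l _ => h.push_mem_ideal _ _ (h.box_mem_ideal' (h.sigma_mem _ ha)
        (h.sigma_mem_ideal ?_ _ hc))
      have := l.is_lt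
      simp only [Fin.val_castSucc]
      omega
    rw [← h1 (a + c), ← h1 a, ← map_sub]
    exact h.push_mem_ideal _ _ h2

/-- The groups `H(X) / I(X)`. -/
abbrev Quot (_ : M.IsLambdaIdeal H I) (X : SchC) : Type v := H X ⧸ (I X).addSubgroupOf (H X)

/-- The projection `H(X) ⟶ H(X) / I(X)`. -/
abbrev proj (X : SchC) : H X →+ h.Quot X := QuotientAddGroup.mk' _

theorem proj_surjective (X : SchC) : Function.Surjective (h.proj X) :=
  QuotientAddGroup.mk'_surjective _

theorem proj_eq_zero {X : SchC} (a : H X) : h.proj X a = 0 ↔ a.1 ∈ I X :=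
  (QuotientAddGroup.eq_zero_iff a).trans AddSubgroup.mem_addSubgroupOf

theorem proj_eq {X : SchC} (a b : H X) : h.proj X a = h.proj X b ↔ a.1 - b.1 ∈ I X := by
  rw [← sub_eq_zero, ← map_sub, h.proj_eq_zero]
  rfl

/-- The pull-back of the quotient theory. -/
def pull {X Y : SchC} (u : X ⟶ Y) : h.Quot Y →+ h.Quot X :=
  QuotientAddGroup.map _ _
    (((M.pull u).comp (H Y).subtype).codRestrict (H X) fun a => h.pull_mem u a.2)
    fun _ ha => h.pull_mem_ideal u ha

/-- The push-forward of the quotient theory. -/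
def push {X Y : SchC} (u : X ⟶ Y) (hu : IsFiniteType u) : h.Quot X →+ h.Quot Y :=
  QuotientAddGroup.map _ _
    (((M.push u hu).comp (H X).subtype).codRestrict (H Y) fun a => h.push_mem u hu a.2)
    fun _ ha => h.push_mem_ideal u hu ha

/-- The exterior product of the quotient theory. -/
def box {X Y : SchC} : h.Quot X →+ h.Quot Y →+ h.Quot (X ⊗ Y) :=
  QuotientAddGroup.lift _
    (AddMonoidHom.mk' (fun a : H X => QuotientAddGroup.lift _
      ((h.proj (X ⊗ Y)).comp (((M.box a.1).comp (H Y).subtype).codRestrict (H (X ⊗ Y))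
        fun b => h.box_mem a.2 b.2))
      fun b hb => (h.proj_eq_zero _).2 (h.box_mem_ideal' a.2 hb))
      fun a a' => QuotientAddGroup.addMonoidHom_ext _ (AddMonoidHom.ext fun b =>
        congr_arg (h.proj (X ⊗ Y)) (Subtype.ext (by
          change M.box (a.1 + a'.1) b.1 = M.box a.1 b.1 + M.box a'.1 b.1
          rw [map_add, AddMonoidHom.add_apply]))))
    fun a ha => QuotientAddGroup.addMonoidHom_ext _ (AddMonoidHom.ext fun b =>
      (h.proj_eq_zero _).2 (h.box_mem_ideal ha b.2))

/-- The operation `σⁿ` of the quotient theory. -/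
def sigma {X : SchC} {n : ℕ} (S : SymPower X n) (q : h.Quot X) : h.Quot S.obj :=
  Quotient.liftOn' q (fun a => h.proj S.obj ⟨M.sigma S a.1, h.sigma_mem S a.2⟩) fun a b hab => by
    have hab' : h.proj X b = h.proj X a := (Quotient.sound' hab).symm
    rw [h.proj_eq] at hab'
    have := h.sigma_add_sub_mem S a.2 hab'
    rw [add_sub_cancel] at this
    exact ((h.proj_eq _ _).2 this).symm

theorem pull_proj {X Y : SchC} (u : X ⟶ Y) (a : H Y) :
    h.pull u (h.proj Y a) = h.proj X ⟨M.pull u a.1, h.pull_mem u a.2⟩ := rfl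

theorem push_proj {X Y : SchC} (u : X ⟶ Y) (hu : IsFiniteType u) (a : H X) :
    h.push u hu (h.proj X a) = h.proj Y ⟨M.push u hu a.1, h.push_mem u hu a.2⟩ := rfl

theorem box_proj {X Y : SchC} (a : H X) (b : H Y) :
    h.box (h.proj X a) (h.proj Y b) = h.proj (X ⊗ Y) ⟨M.box a.1 b.1, h.box_mem a.2 b.2⟩ := rfl

theorem sigma_proj {X : SchC} {n : ℕ} (S : SymPower X n) (a : H X) :
    h.sigma S (h.proj X a) = h.proj S.obj ⟨M.sigma S a.1, h.sigma_mem S a.2⟩ := rfl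

theorem proj_congr {X : SchC} {a b : H X} (e : a.1 = b.1) : h.proj X a = h.proj X b :=
  congr_arg _ (Subtype.ext e)

theorem bijective_components {X : SchC} {K : Type} (T : K → SchC) (j : ∀ i, T i ⟶ X)
    (hj : ∀ i, IsComponent (j i)) (hX : ∀ x : X.scheme, ∃! i, x ∈ Set.range (sch (j i))) :
    Function.Bijective fun (a : h.Quot X) (i : K) => h.pull (j i) a := by
  constructor
  · intro q q' e
    obtain ⟨a, rfl⟩ := h.proj_surjective X q
    obtain ⟨b, rfl⟩ := h.proj_surjective X q'
    rw [h.proj_eq]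
    refine h.mem_ideal_of_cover T j hj hX fun i => ?_
    have := congr_fun e i
    dsimp only at this
    rw [pull_proj, pull_proj, h.proj_eq] at this
    rwa [map_sub]
  · intro q
    choose b hb using fun i => h.proj_surjective (T i) (q i)
    obtain ⟨a, ha⟩ := (M.bijective_components T j hj hX).2 fun i => (b i).1
    have ha' (i : K) : M.pull (j i) a = (b i).1 := congr_fun ha i
    refine ⟨h.proj X ⟨a, h.mem_of_cover T j hj hX fun i => by rw [ha']; exact (b i).2⟩,
      funext fun i => ?_⟩
    rw [← hb i]
    exact h.proj_congr (ha' i)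

theorem sigma_add {X : SchC} (S : ∀ k, SymPower X k)
    (m : ∀ k l n, k + l = n → ((S k).obj ⊗ (S l).obj ⟶ (S n).obj))
    (hm : ∀ k l n h, IsFiniteType (m k l n h))
    (hS : ∀ k l n h, ((S k).π ⊗ₘ (S l).π) ≫ m k l n h = concat X h ≫ (S n).π)
    (n : ℕ) (a b : h.Quot X) : h.sigma (S n) (a + b) = ∑ l : Fin (n + 1),
      h.push (m l (n - l) n (Nat.add_sub_of_le l.is_le)) (hm _ _ _ _)
        (h.box (h.sigma (S l) a) (h.sigma (S (n - l)) b)) := by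
  obtain ⟨a, rfl⟩ := h.proj_surjective X a
  obtain ⟨b, rfl⟩ := h.proj_surjective X b
  simp only [← map_add, sigma_proj, box_proj, push_proj]
  rw [← map_sum]
  refine h.proj_congr ?_
  rw [AddSubgroup.val_finsetSum]
  exact M.sigma_add S m hm hS n a.1 b.1

/-- The motivic theory `X ↦ H(X) / I(X)`. -/
def quotient : MotivicTheory.{v} where
  obj := h.Quot
  pull := h.pull
  push := h.push
  box := h.box
  one := h.proj _ ⟨M.one, h.one_mem⟩
  sigma := h.sigma
  pull_id q := by
    obtain ⟨a, rfl⟩ := h.proj_surjective _ q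
    exact h.proj_congr (M.pull_id a.1)
  pull_comp u v q := by
    obtain ⟨a, rfl⟩ := h.proj_surjective _ q
    exact h.proj_congr (M.pull_comp u v a.1)
  push_id q := by
    obtain ⟨a, rfl⟩ := h.proj_surjective _ q
    exact h.proj_congr (M.push_id a.1)
  push_comp u v hu hv q := by
    obtain ⟨a, rfl⟩ := h.proj_surjective _ q
    exact h.proj_congr (M.push_comp u v hu hv a.1)
  box_assoc q q' q'' := by
    obtain ⟨a, rfl⟩ := h.proj_surjective _ q
    obtain ⟨b, rfl⟩ := h.proj_surjective _ q'
    obtain ⟨c, rfl⟩ := h.proj_surjective _ q''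
    exact h.proj_congr (M.box_assoc a.1 b.1 c.1)
  box_symm q q' := by
    obtain ⟨a, rfl⟩ := h.proj_surjective _ q
    obtain ⟨b, rfl⟩ := h.proj_surjective _ q'
    exact h.proj_congr (M.box_symm a.1 b.1)
  box_one q := by
    obtain ⟨a, rfl⟩ := h.proj_surjective _ q
    exact h.proj_congr (M.box_one a.1)
  one_box q := by
    obtain ⟨a, rfl⟩ := h.proj_surjective _ q
    exact h.proj_congr (M.one_box a.1)
  bijective_components := h.bijective_components
  base_change v' u' u v hP hu hu' q := by
    obtain ⟨a, rfl⟩ := h.proj_surjective _ q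
    exact h.proj_congr (M.base_change v' u' u v hP hu hu' a.1)
  pull_box u v q q' := by
    obtain ⟨a, rfl⟩ := h.proj_surjective _ q
    obtain ⟨b, rfl⟩ := h.proj_surjective _ q'
    exact h.proj_congr (M.pull_box u v a.1 b.1)
  push_box u v hu hv q q' := by
    obtain ⟨a, rfl⟩ := h.proj_surjective _ q
    obtain ⟨b, rfl⟩ := h.proj_surjective _ q'
    exact h.proj_congr (M.push_box u v hu hv a.1 b.1)
  push_sigma u hu S S' m hm e q := by
    obtain ⟨a, rfl⟩ := h.proj_surjective _ q
    exact h.proj_congr (M.push_sigma u hu S S' m hm e a.1)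
  sigma_add := h.sigma_add
  sigma_one S q := by
    obtain ⟨a, rfl⟩ := h.proj_surjective _ q
    exact h.proj_congr (M.sigma_one S a.1)
  sigma_zero S q := by
    obtain ⟨a, rfl⟩ := h.proj_surjective _ q
    exact h.proj_congr (M.sigma_zero S a.1)
  closed_open i j hi hj hij hi' hj' := by
    obtain ⟨h1, h2, h3, h4, h5⟩ := M.closed_open i j hi hj hij hi' hj'
    refine ⟨fun q => ?_, fun q => ?_, fun q => ?_, fun q => ?_, fun q => ?_⟩ <;>
      obtain ⟨a, rfl⟩ := h.proj_surjective _ q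
    exacts [h.proj_congr (h1 a.1), h.proj_congr (h2 a.1), h.proj_congr (h3 a.1),
      h.proj_congr (h4 a.1), h.proj_congr (h5 a.1)]
  sigma_unit S := h.proj_congr (M.sigma_unit S)

end IsLambdaIdeal

variable (R : MotivicTheory.{v})

theorem lineOne_mem_homogeneous : R.lineOne ∈ R.homogeneous (𝟙_ SchC) := by
  rw [homogeneous_eq_localSpan]
  exact R.isStableFamily_homogeneousClasses.closure_le_localSpan _
    (AddSubgroup.subset_closure R.lineOne_mem_homogeneousClasses)

theorem linePull_mem_homogeneous {X Y : SchC} (u : X ⟶ Y) {a : R.obj (Y ⊗ A1)}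
    (ha : a ∈ R.homogeneous Y) : R.linePull u a ∈ R.homogeneous X := by
  rw [homogeneous_eq_localSpan] at ha ⊢
  exact IsStableFamily.pull_mem_localSpan (R := R.lineTheory) u ha

theorem sigmaLine_mem_homogeneous {X : SchC} {n : ℕ} (S : SymPower X n) {a : R.obj (X ⊗ A1)}
    (ha : a ∈ R.homogeneous X) : R.sigmaLine S a ∈ R.homogeneous S.obj := by
  rcases Nat.eq_zero_or_pos n with rfl | hn
  · rw [sigmaLine_zero]
    exact R.linePull_mem_homogeneous _ R.lineOne_mem_homogeneous
  · rw [homogeneous_eq_localSpan] at ha ⊢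
    exact R.isStableFamily_homogeneousClasses.sigma_mem_localSpan ha hn S

theorem isLambdaIdeal_monodromyIdeal :
    R.lineTheory.IsLambdaIdeal R.homogeneous R.monodromyIdeal where
  pull_mem := R.linePull_mem_homogeneous
  push_mem u hu a ha := by
    rw [homogeneous_eq_localSpan] at ha ⊢
    exact R.isStableFamily_homogeneousClasses.push_mem_localSpan u hu ha
  box_mem ha hb := by
    rw [homogeneous_eq_localSpan] at ha hb ⊢
    exact R.isStableFamily_homogeneousClasses.box_mem_localSpan ha hb
  one_mem := R.lineOne_mem_homogeneous
  sigma_mem S _ ha := R.sigmaLine_mem_homogeneous S ha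
  mem_of_cover T j hj hX a ha := by
    simp only [homogeneous_eq_localSpan] at ha ⊢
    exact R.isStableFamily_homogeneousClasses.mem_localSpan_of_cover T j
      (fun i => (hj i).isOpenImmersion) (fun x => (hX x).exists) ha
  pull_mem_ideal u a ha := by
    rw [monodromyIdeal_eq_localSpan] at ha ⊢
    exact IsStableFamily.pull_mem_localSpan (R := R.lineTheory) u ha
  push_mem_ideal u hu a ha := by
    rw [monodromyIdeal_eq_localSpan] at ha ⊢
    exact R.isStableFamily_pulledBackClasses.push_mem_localSpan u hu ha
  box_mem_ideal ha hb := R.lineBox_mem_monodromyIdeal ha hb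
  sigma_mem_ideal hn S a ha := by
    rw [monodromyIdeal_eq_localSpan] at ha ⊢
    exact R.isStableFamily_pulledBackClasses.sigma_mem_localSpan ha hn S
  mem_ideal_of_cover T j hj hX a ha := by
    simp only [monodromyIdeal_eq_localSpan] at ha ⊢
    exact R.isStableFamily_pulledBackClasses.mem_localSpan_of_cover T j
      (fun i => (hj i).isOpenImmersion) (fun x => (hX x).exists) ha

theorem lineSigma_eq_sigmaLine {X : SchC} {n : ℕ} (S : SymPower X n) (S' : SymPower (X ⊗ A1) n)
    (m : S'.obj ⟶ S.obj ⊗ A1) (hm : IsFiniteType m) (h : IsFiberSum S S' m)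
    (a : R.obj (X ⊗ A1)) : R.lineSigma S S' m hm a = R.sigmaLine S a :=
  R.lineSigma_eq S S' _ m hm h _ _ (isFiberSum_fiberSum _ _) a

end MotivicTheory

end MotivicTheories

end

theorem mainTheorem5 (R : MotivicTheory.{v}) :
    (∀ (X Y : SchC) (u : X ⟶ Y), ∀ a ∈ R.homogeneous Y, R.linePull u a ∈ R.homogeneous X) ∧
    (∀ (X Y : SchC) (u : X ⟶ Y) (hu : IsFiniteType u), ∀ a ∈ R.homogeneous X,
      R.linePush u hu a ∈ R.homogeneous Y) ∧
    (∀ (X Y : SchC), ∀ a ∈ R.homogeneous X, ∀ b ∈ R.homogeneous Y,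
      R.lineBox a b ∈ R.homogeneous (X ⊗ Y)) ∧
    (∀ (X : SchC) (n : ℕ) (S : SymPower X n) (S' : SymPower (X ⊗ A1) n)
      (m : S'.obj ⟶ S.obj ⊗ A1) (hm : IsFiniteType m), IsFiberSum S S' m →
      ∀ a ∈ R.homogeneous X, R.lineSigma S S' m hm a ∈ R.homogeneous S.obj) ∧
    (∀ X : SchC, R.monodromyIdeal X ≤ R.homogeneous X) ∧
    (∀ (X Y : SchC), ∀ a ∈ R.monodromyIdeal X, ∀ b ∈ R.homogeneous Y,
      R.lineBox a b ∈ R.monodromyIdeal (X ⊗ Y)) ∧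
    (∀ (X : SchC) (n : ℕ), 0 < n → ∀ (S : SymPower X n) (S' : SymPower (X ⊗ A1) n)
      (m : S'.obj ⟶ S.obj ⊗ A1) (hm : IsFiniteType m), IsFiberSum S S' m →
      ∀ a ∈ R.monodromyIdeal X, R.lineSigma S S' m hm a ∈ R.monodromyIdeal S.obj) ∧
    ∃ (T : MotivicTheory.{v}) (π : ∀ X : SchC, R.homogeneous X →+ T.obj X),
      (∀ X : SchC, Function.Surjective (π X)) ∧
      (∀ (X : SchC) (a : R.homogeneous X), π X a = 0 ↔ a.1 ∈ R.monodromyIdeal X) ∧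
      (∀ (X Y : SchC) (u : X ⟶ Y) (a : R.homogeneous Y) (b : R.homogeneous X),
        b.1 = R.linePull u a.1 → π X b = T.pull u (π Y a)) ∧
      (∀ (X Y : SchC) (u : X ⟶ Y) (hu : IsFiniteType u) (a : R.homogeneous X)
        (b : R.homogeneous Y), b.1 = R.linePush u hu a.1 → π Y b = T.push u hu (π X a)) ∧
      (∀ (X Y : SchC) (a : R.homogeneous X) (b : R.homogeneous Y) (c : R.homogeneous (X ⊗ Y)),
        c.1 = R.lineBox a.1 b.1 → π (X ⊗ Y) c = T.box (π X a) (π Y b)) ∧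
      (∃ h : R.lineOne ∈ R.homogeneous (𝟙_ SchC), π (𝟙_ SchC) ⟨R.lineOne, h⟩ = T.one) ∧
      (∀ (X : SchC) (n : ℕ) (S : SymPower X n) (S' : SymPower (X ⊗ A1) n)
        (m : S'.obj ⟶ S.obj ⊗ A1) (hm : IsFiniteType m), IsFiberSum S S' m →
        ∀ (a : R.homogeneous X) (b : R.homogeneous S.obj),
        b.1 = R.lineSigma S S' m hm a.1 → π S.obj b = T.sigma S (π X a)) := by
  have h := R.isLambdaIdeal_monodromyIdeal
  refine ⟨fun X Y u a => h.pull_mem u, fun X Y u hu a => h.push_mem u hu,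
    fun X Y a ha b => h.box_mem ha, fun X n S S' m hm hS a ha => ?_,
    R.monodromyIdeal_le_homogeneous, fun X Y a ha b => h.box_mem_ideal ha,
    fun X n hn S S' m hm hS a ha => ?_, h.quotient, h.proj, h.proj_surjective,
    fun X a => h.proj_eq_zero a, fun X Y u a b e => h.proj_congr e,
    fun X Y u hu a b e => h.proj_congr e, fun X Y a b c e => h.proj_congr e, ⟨h.one_mem, rfl⟩,
    fun X n S S' m hm hS a b e => ?_⟩
  · rw [R.lineSigma_eq_sigmaLine S S' m hm hS]
    exact h.sigma_mem S ha
  · rw [R.lineSigma_eq_sigmaLine S S' m hm hS]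
    exact h.sigma_mem_ideal hn S ha
  · rw [R.lineSigma_eq_sigmaLine S S' m hm hS] at e
    exact h.proj_congr e
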